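/- A \emph{link} $L$ in $\mathbb R^3$ is a finite disjoint union of simple closed curves. For distinct points $x,y,z\in\mathbb R^3$ let $r(x,y,z)\in(0,\infty]$ be the radius of the circle through them ($\infty$ if they are collinear). The \emph{thickness} of $L$ is $$\tau(L)=\inf\{\,r(x,y,z) : x,y,z\in L \text{ distinct}\,\},$$ the length $\mathrm{Len}(L)\in[0,\infty]$ is the sum over the components of the supremal length of inscribed polygons, and the \emph{ropelength} of $L$ is $\mathrm{Len}(L)/\tau(L)\in[0,\infty]$ ($=\infty$ if $\tau(L)=0$ or $\mathrm{Len}(L)=\infty$). The \emph{link type} of $L$ is the class of all links ambient isotopic to $L$ in $\mathbb R^3$; it is \emph{tame} if it contains a polygonal link. \textbf{Theorem.} Every tame link type contains a ropelength minimizer, i.e. a link whose ropelength is at most that of every other link in the type. Moreover, every ropelength minimizer in a tame link type is $C^{1,1}$ with bounded curvature: the constant-speed parametrization of each of its components over the circle is continuously differentiable with Lipschitz derivative, and its curvature, which exists almost everywhere, is bounded. -/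

import Mathlib

namespace Ropelength

open Set MeasureTheory
open scoped ENNReal NNReal

/-- Euclidean three-space. -/
abbrev E3 : Type := EuclideanSpace ℝ (Fin 3)

/-- A simple closed curve, written as a continuous `1`-periodic map of the line that is injective
on a period (that is, a continuous injective map of the circle `ℝ/ℤ` into space). -/
structure IsSimpleClosed (γ : ℝ → E3) : Prop where
  continuous : Continuous γ
  periodic : Function.Periodic γ 1
  injOn : InjOn γ (Ico 0 1)

/-- A link with `n` components: `n` pairwise disjoint simple closed curves, each with some
continuous parametrization. No regularity or tameness is required. -/
structure Link (n : ℕ) where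
  curve : Fin n → ℝ → E3
  simple : ∀ i, IsSimpleClosed (curve i)
  disjoint : ∀ i j, i ≠ j → Disjoint (range (curve i)) (range (curve j))

/-- The point set of a link. -/
def Link.carrier {n : ℕ} (L : Link n) : Set E3 := ⋃ i, range (L.curve i)

open Classical in
/-- The radius `r(x,y,z)` of the circle through three distinct points; it is `∞` when the points
are collinear. -/
noncomputable def circleRadius (x y z : E3) : ℝ≥0∞ :=
  if h : AffineIndependent ℝ ![x, y, z] then
    ENNReal.ofReal (Affine.Simplex.circumradius (⟨![x, y, z], h⟩ : Affine.Simplex ℝ E3 2))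
  else ⊤

/-- The local thickness at `x`: the infimum of `r(x,y,z)` over `y, z` in the set such that
`x, y, z` are distinct. -/
noncomputable def localThickness (S : Set E3) (x : E3) : ℝ≥0∞ :=
  ⨅ (y ∈ S) (z ∈ S) (_ : x ≠ y ∧ y ≠ z ∧ z ≠ x), circleRadius x y z

/-- The thickness: the infimum of the local thickness. -/
noncomputable def thickness (S : Set E3) : ℝ≥0∞ :=
  ⨅ x ∈ S, localThickness S x

/-- The length of a link: the sum over the components of the supremal length of inscribed
polygons. -/
noncomputable def Link.length {n : ℕ} (L : Link n) : ℝ≥0∞ :=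
  ∑ i, eVariationOn (L.curve i) (Icc 0 1)

/-- Ropelength is length divided by thickness. (For a nonempty link the length is positive and the
thickness is finite, so no indeterminate quotient occurs; the value is `∞` exactly when the length
is infinite or the thickness is `0`.) -/
noncomputable def Link.ropelength {n : ℕ} (L : Link n) : ℝ≥0∞ :=
  L.length / thickness L.carrier

/-- Ambient isotopy of subsets of space: a continuous family of homeomorphisms `H t` of space,
`0 ≤ t ≤ 1`, with inverses that are jointly continuous as well (so `(t, x) ↦ (t, H t x)` is a
homeomorphism), which starts at the identity and ends with a map that takes `A` onto `B`. -/
def AmbientIsotopic (A B : Set E3) : Prop :=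
  ∃ H : unitInterval → (E3 ≃ₜ E3),
    Continuous (fun p : unitInterval × E3 => H p.1 p.2) ∧
    Continuous (fun p : unitInterval × E3 => (H p.1).symm p.2) ∧
    H 0 = Homeomorph.refl E3 ∧ H 1 '' A = B

/-- The link type of `L`: all links ambient isotopic to `L`. -/
def linkType {n : ℕ} (L : Link n) : Set (Link n) :=
  {L' | AmbientIsotopic L.carrier L'.carrier}

/-- A polygonal link: the components are closed polygons, parametrized so that each one is affine
on each interval `[k/m, (k+1)/m]`. (Vertices may be straight, so a common number `m` of edges is no
restriction.) -/
def Link.IsPolygonal {n : ℕ} (P : Link n) : Prop :=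
  ∃ m : ℕ, 0 < m ∧ ∀ (i : Fin n) (k : ℕ), ∀ s ∈ Icc (0 : ℝ) 1,
    P.curve i (((k : ℝ) + s) / m) =
      (1 - s) • P.curve i ((k : ℝ) / m) + s • P.curve i (((k : ℝ) + 1) / m)

/-- A link is tame if it is ambient isotopic to a polygonal link. -/
def Link.IsTame {n : ℕ} (L : Link n) : Prop :=
  ∃ P ∈ linkType L, P.IsPolygonal

/-- `L` has least ropelength among all links in the class `T`, to which it belongs. -/
def IsRopelengthMinimizer {n : ℕ} (T : Set (Link n)) (L : Link n) : Prop :=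
  L ∈ T ∧ ∀ L' ∈ T, L.ropelength ≤ L'.ropelength

/-- `γ` is a continuously differentiable constant-speed parametrization, by the circle `ℝ/ℤ`, of
the simple closed curve with point set `K`. -/
def IsConstantSpeedParam (K : Set E3) (γ : ℝ → E3) : Prop :=
  IsSimpleClosed γ ∧ range γ = K ∧ ContDiff ℝ 1 γ ∧ ∃ c : ℝ, 0 < c ∧ ∀ t, ‖deriv γ t‖ = c

/-- The unit tangent vector `T = γ' / |γ'|`. -/
noncomputable def unitTangent (γ : ℝ → E3) (t : ℝ) : E3 := ‖deriv γ t‖⁻¹ • deriv γ t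

/-- The curvature `|dT/ds| = |T'| / |γ'|`, at parameters where `T` is differentiable. -/
noncomputable def curvature (γ : ℝ → E3) (t : ℝ) : ℝ :=
  ‖deriv (unitTangent γ) t‖ / ‖deriv γ t‖

/-- The curvature exists almost everywhere and is bounded there. -/
def HasBoundedCurvature (γ : ℝ → E3) : Prop :=
  ∃ κ : ℝ, ∀ᵐ t, DifferentiableAt ℝ (unitTangent γ) t ∧ curvature γ t ≤ κ

/-- A link is `C^{1,1}` with bounded curvature: the constant-speed parametrization of each
component is `C^1` with Lipschitz derivative, and has bounded curvature. (Such a parametrization is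
unique up to rotation and reflection of the circle.) -/
def Link.IsC11WithBoundedCurvature {n : ℕ} (L : Link n) : Prop :=
  ∀ i, ∃ γ : ℝ → E3, IsConstantSpeedParam (range (L.curve i)) γ ∧
    (∃ M : ℝ≥0, LipschitzWith M (deriv γ)) ∧ HasBoundedCurvature γ

end Ropelength

/-! Thickness at least `τ` means that every triple of points satisfies a polynomial inequality
(`TripleThick`), a closed condition that survives pointwise limits. It also forces regularity. On an
arc of small diameter two chords from a common first endpoint can never be perpendicular, since the
circle through their ends would be too small. Hence chord directions vary in a controlled way
(`ThickArc.norm_dir_sub_endpoints`), length is comparable with the chord, and the arclength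
parametrization has a Lipschitz unit tangent (`UnitLoop.exists_tangent`). So every link of finite
ropelength is C^{1,1}, minimizers in particular.

Existence is the direct method. A minimizing sequence is scaled to thickness 1, so that ropelength
bounds length. Pieces might drift apart, so empty slabs are compressed one coordinate at a time
(`exists_bounded`). The constant-speed parametrizations then have bounded speed, equi-Lipschitz
velocities, a uniform chord-arc bound, and components at distance at least 2, so they converge along
an ultrafilter together with their velocities (`exists_limit_link`). The limit has thickness at
least 1 and length at most the infimum. It stays in the link type because the displacement from a
nearby member of the sequence has a small Lipschitz constant; extended to space it is a contraction
`u`, and `x + t u(x)` is an ambient isotopy.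

The infimum is finite because a polygonal representative has finitely many corners, each of which is
rounded by an isotopy supported near it (`IsCornerAt.exists_rounding`). The result is locally thick,
hence thick by compactness. -/

namespace Ropelength

open Set MeasureTheory Filter Topology
open scoped ENNReal NNReal RealInnerProductSpace

/-! ### Thickness as a closed polynomial condition -/

/-- The polynomial inequality expressing that the circle through `x, y, z` has radius at least
`τ`; it is vacuous for degenerate triples. -/
def TripleThick (τ : ℝ) (x y z : E3) : Prop :=
  4 * τ ^ 2 * (‖y - x‖ ^ 2 * ‖z - x‖ ^ 2 - ⟪y - x, z - x⟫ ^ 2) ≤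
    ‖y - x‖ ^ 2 * ‖z - x‖ ^ 2 * ‖z - y‖ ^ 2

/-- All triples of points of `S` satisfy the radius inequality. -/
def ThickSet (τ : ℝ) (S : Set E3) : Prop :=
  ∀ x ∈ S, ∀ y ∈ S, ∀ z ∈ S, TripleThick τ x y z

theorem gram_nonneg (u v : E3) : 0 ≤ ‖u‖ ^ 2 * ‖v‖ ^ 2 - ⟪u, v⟫ ^ 2 := by
  have h := abs_real_inner_le_norm u v
  have h2 := sq_le_sq' (abs_le.1 h).1 (abs_le.1 h).2
  linarith [mul_pow ‖u‖ ‖v‖ 2]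

/-- By the law of sines the side opposite `x` is `2R sin α`, and the Gram determinant is `(sin α ‖y
- x‖ ‖z - x‖)²`; cancelling leaves `τ² ≤ R²`. For collinear triples `sin α = 0` and both sides hold.
-/
theorem le_circleRadius_iff {τ : ℝ} (hτ : 0 ≤ τ) {x y z : E3} (hxy : x ≠ y) (hzx : z ≠ x) :
    ENNReal.ofReal τ ≤ circleRadius x y z ↔ TripleThick τ x y z := by
  have hu : 0 < ‖y - x‖ := norm_pos_iff.2 (sub_ne_zero.2 hxy.symm)
  have hv : 0 < ‖z - x‖ := norm_pos_iff.2 (sub_ne_zero.2 hzx)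
  have hsin := InnerProductGeometry.sin_angle_mul_norm_mul_norm (y - x) (z - x)
  rw [real_inner_self_eq_norm_sq, real_inner_self_eq_norm_sq, ← pow_two ⟪y - x, z - x⟫] at hsin
  have hsq := congrArg (fun t => t ^ 2) hsin
  simp only [Real.sq_sqrt (gram_nonneg (y - x) (z - x))] at hsq
  unfold circleRadius TripleThick
  rw [← hsq]
  split_ifs with h
  · set R := Affine.Simplex.circumradius (⟨![x, y, z], h⟩ : Affine.Simplex ℝ E3 2)
    have hR : 0 ≤ R := Affine.Simplex.circumradius_nonneg _
    have key := Affine.Triangle.dist_div_sin_angle_eq_two_mul_circumradius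
      (⟨![x, y, z], h⟩ : Affine.Simplex ℝ E3 2) (i₁ := 1) (i₂ := 0) (i₃ := 2)
      (by decide) (by decide) (by decide)
    have hs : 0 < Real.sin (InnerProductGeometry.angle (y - x) (z - x)) := by
      have hnc := affineIndependent_iff_not_collinear_set.1 h
      have := mt EuclideanGeometry.collinear_iff_eq_or_eq_or_sin_eq_zero.2
        (show ¬ Collinear ℝ {y, x, z} by rwa [Set.insert_comm])
      push Not at this
      exact lt_of_le_of_ne (InnerProductGeometry.sin_angle_nonneg _ _) (Ne.symm this.2.2)
    change dist y z / Real.sin (InnerProductGeometry.angle (y - x) (z - x)) = 2 * R at key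
    rw [div_eq_iff hs.ne', dist_comm, dist_eq_norm] at key
    rw [key, ENNReal.ofReal_le_ofReal_iff hR]
    set s := Real.sin (InnerProductGeometry.angle (y - x) (z - x))
    have hpos : 0 < (s * (‖y - x‖ * ‖z - x‖)) ^ 2 := by positivity
    constructor
    · intro hle
      have : τ ^ 2 ≤ R ^ 2 := by gcongr
      nlinarith
    · intro hle
      have : τ ^ 2 * (s * (‖y - x‖ * ‖z - x‖)) ^ 2 ≤ R ^ 2 * (s * (‖y - x‖ * ‖z - x‖)) ^ 2 := by
        nlinarith
      exact (sq_le_sq₀ hτ hR).1 (le_of_mul_le_mul_right this hpos)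
  · simp only [le_top, true_iff]
    have hc : Collinear ℝ {y, x, z} := by
      rw [affineIndependent_iff_not_collinear_set, not_not] at h
      rwa [Set.insert_comm]
    have h0 : Real.sin (InnerProductGeometry.angle (y - x) (z - x)) = 0 := by
      rcases EuclideanGeometry.collinear_iff_eq_or_eq_or_sin_eq_zero.1 hc with h | h | h
      · exact absurd h.symm hxy
      · exact absurd h hzx
      · exact h
    rw [h0]
    simp only [zero_mul, ne_eq, OfNat.ofNat_ne_zero, not_false_eq_true, zero_pow, mul_zero]
    positivity

theorem TripleThick.swap {τ : ℝ} {x y z : E3} (h : TripleThick τ x y z) :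
    TripleThick τ x z y := by
  unfold TripleThick at *
  rw [real_inner_comm, norm_sub_rev y z]
  linarith

theorem TripleThick.rotate {τ : ℝ} {x y z : E3} (h : TripleThick τ x y z) :
    TripleThick τ y z x := by
  unfold TripleThick at *
  have e1 : z - x = (z - y) + (y - x) := by abel
  have e2 : x - y = -(y - x) := by abel
  have e3 : x - z = -((z - y) + (y - x)) := by abel
  rw [e1] at h
  rw [e2, e3, norm_neg, norm_neg, inner_neg_right, neg_sq]
  generalize y - x = a at *
  generalize z - y = b at *
  have n1 : ‖b + a‖ ^ 2 = ‖b‖ ^ 2 + 2 * ⟪b, a⟫ + ‖a‖ ^ 2 := norm_add_sq_real b a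
  rw [inner_add_right, real_inner_self_eq_norm_sq, real_inner_comm b a, n1] at h
  rw [n1]
  nlinarith

theorem TripleThick.mono {τ τ' : ℝ} (h0 : 0 ≤ τ') (h1 : τ' ≤ τ) {x y z : E3}
    (h : TripleThick τ x y z) : TripleThick τ' x y z := by
  unfold TripleThick at *
  have := gram_nonneg (y - x) (z - x)
  have h2 : τ' ^ 2 ≤ τ ^ 2 := by gcongr
  nlinarith

/-- A chord is at most a diameter, so one side of length `2τ` suffices. Only triples with all sides
shorter than `2τ` ever need attention. -/
theorem tripleThick_of_far {τ : ℝ} (hτ : 0 ≤ τ) {x y z : E3} (h : 2 * τ ≤ ‖z - y‖) :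
    TripleThick τ x y z := by
  unfold TripleThick
  have h2 : (2 * τ) ^ 2 ≤ ‖z - y‖ ^ 2 := by gcongr
  have h3 : 0 ≤ ‖y - x‖ ^ 2 * ‖z - x‖ ^ 2 := by positivity
  nlinarith [sq_nonneg ⟪y - x, z - x⟫, mul_nonneg (sq_nonneg τ) (sq_nonneg ⟪y - x, z - x⟫)]

theorem tripleThick_of_far_left {τ : ℝ} (hτ : 0 ≤ τ) {x y z : E3} (h : 2 * τ ≤ ‖y - x‖) :
    TripleThick τ x y z :=
  (tripleThick_of_far (x := z) hτ h).rotate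

theorem tripleThick_of_far_right {τ : ℝ} (hτ : 0 ≤ τ) {x y z : E3} (h : 2 * τ ≤ ‖z - x‖) :
    TripleThick τ x y z :=
  (tripleThick_of_far_left hτ h).swap

theorem tripleThick_of_degenerate (τ : ℝ) {x y z : E3} (h : ¬ (x ≠ y ∧ y ≠ z ∧ z ≠ x)) :
    TripleThick τ x y z := by
  unfold TripleThick
  by_cases h1 : x = y
  · subst h1; simp
  by_cases h2 : z = x
  · subst h2; simp
  by_cases h3 : y = z
  · subst h3; rw [real_inner_self_eq_norm_sq]; simp [← pow_two]
  exact absurd ⟨h1, h3, h2⟩ h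

theorem le_thickness_iff {τ : ℝ} (hτ : 0 ≤ τ) {S : Set E3} :
    ENNReal.ofReal τ ≤ thickness S ↔ ThickSet τ S := by
  simp only [thickness, localThickness, le_iInf_iff, ThickSet]
  refine forall₄_congr fun x _ y _ => forall₂_congr fun z _ => ?_
  constructor
  · intro h
    by_cases hd : x ≠ y ∧ y ≠ z ∧ z ≠ x
    · exact (le_circleRadius_iff hτ hd.1 hd.2.2).1 (h hd)
    · exact tripleThick_of_degenerate τ hd
  · intro h hd
    exact (le_circleRadius_iff hτ hd.1 hd.2.2).2 h

theorem ThickSet.mono {τ τ' : ℝ} (h0 : 0 ≤ τ') (h1 : τ' ≤ τ) {S S' : Set E3} (hS : S' ⊆ S)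
    (h : ThickSet τ S) : ThickSet τ' S' :=
  fun x hx y hy z hz => (h x (hS hx) y (hS hy) z (hS hz)).mono h0 h1

theorem TripleThick.smul {τ : ℝ} {x y z : E3} (h : TripleThick τ x y z) (c : ℝ) :
    TripleThick (c * τ) (c • x) (c • y) (c • z) := by
  unfold TripleThick at *
  simp only [← smul_sub, norm_smul, inner_smul_left, inner_smul_right, mul_pow,
    Real.norm_eq_abs, sq_abs, RCLike.conj_to_real]
  have : 0 ≤ c ^ 6 := by positivity
  nlinarith [mul_le_mul_of_nonneg_left h this]

theorem TripleThick.of_tendsto {ι : Type*} {F : Filter ι} [F.NeBot] {τ : ℝ} {x y z : ι → E3}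
    {x' y' z' : E3} (hx : Tendsto x F (𝓝 x')) (hy : Tendsto y F (𝓝 y')) (hz : Tendsto z F (𝓝 z'))
    (h : ∀ k, TripleThick τ (x k) (y k) (z k)) : TripleThick τ x' y' z' := by
  unfold TripleThick at *
  have hn := (hy.sub hx).norm.pow 2
  have hm := (hz.sub hx).norm.pow 2
  have hi := ((hy.sub hx).inner (𝕜 := ℝ) (hz.sub hx)).pow 2
  exact le_of_tendsto_of_tendsto' (((hn.mul hm).sub hi).const_mul _)
    ((hn.mul hm).mul ((hz.sub hy).norm.pow 2)) h

theorem tripleThick_congr {τ : ℝ} {x y z x' y' z' : E3} (h1 : y' - x' = y - x)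
    (h2 : z' - x' = z - x) (h : TripleThick τ x y z) : TripleThick τ x' y' z' := by
  have h3 : z' - y' = z - y := by
    calc z' - y' = (z' - x') - (y' - x') := by abel
      _ = z - y := by rw [h1, h2]; abel
  unfold TripleThick at *
  rwa [h1, h2, h3]

/-- Every point of `S` has a neighbourhood in which `S` has positive thickness. -/
def LocallyThickAt (S : Set E3) (x : E3) : Prop :=
  ∃ U ∈ 𝓝 x, ∃ τ : ℝ, 0 < τ ∧ ThickSet τ (S ∩ U)

/-- A triple starting near `x` either stays in the good neighbourhood or has a side of length at
least `r / 2`, which is enough once the constant is at most `r / 4`. Finitely many such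
neighbourhoods cover. -/
theorem IsCompact.exists_thickSet {S : Set E3} (hS : IsCompact S)
    (h : ∀ x ∈ S, LocallyThickAt S x) : ∃ τ : ℝ, 0 < τ ∧ ThickSet τ S := by
  suffices H : ∃ τ : ℝ, 0 < τ ∧ ∀ x ∈ S, ∀ y ∈ S, ∀ z ∈ S, TripleThick τ x y z from H
  refine hS.induction_on
    (p := fun A => ∃ τ : ℝ, 0 < τ ∧ ∀ x ∈ A, ∀ y ∈ S, ∀ z ∈ S, TripleThick τ x y z)
    ⟨1, one_pos, by simp⟩ ?_ ?_ ?_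
  · rintro A B hAB ⟨τ, hτ, hB⟩
    exact ⟨τ, hτ, fun x hx => hB x (hAB hx)⟩
  · rintro A B ⟨τ, hτ, hA⟩ ⟨τ', hτ', hB⟩
    refine ⟨min τ τ', lt_min hτ hτ', ?_⟩
    rintro x (hx | hx) y hy z hz
    · exact (hA x hx y hy z hz).mono (lt_min hτ hτ').le (min_le_left _ _)
    · exact (hB x hx y hy z hz).mono (lt_min hτ hτ').le (min_le_right _ _)
  · intro x hx
    obtain ⟨U, hU, τ, hτ, hT⟩ := h x hx
    obtain ⟨r, hr, hrU⟩ := Metric.mem_nhds_iff.1 hU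
    have hm : 0 < min τ (r / 4) := lt_min hτ (by positivity)
    refine ⟨S ∩ Metric.ball x (r / 2), inter_mem self_mem_nhdsWithin
      (mem_nhdsWithin_of_mem_nhds (Metric.ball_mem_nhds x (by positivity))), min τ (r / 4), hm, ?_⟩
    rintro p ⟨hp, hpx⟩ y hy z hz
    rw [Metric.mem_ball, dist_eq_norm] at hpx
    have hin : ∀ q, ‖q - p‖ < r / 2 → q ∈ U := fun q hq => hrU <| by
      rw [Metric.mem_ball, dist_eq_norm]
      have := norm_add_le (q - p) (p - x)
      rw [sub_add_sub_cancel] at this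
      linarith
    have h4 : 2 * min τ (r / 4) ≤ r / 2 := by linarith [min_le_right τ (r / 4)]
    by_cases h1 : ‖y - p‖ < r / 2
    · by_cases h2 : ‖z - p‖ < r / 2
      · exact (hT p ⟨hp, hin p (by simpa using by positivity)⟩ y ⟨hy, hin y h1⟩ z
          ⟨hz, hin z h2⟩).mono hm.le (min_le_left _ _)
      · exact tripleThick_of_far_right hm.le (h4.trans (not_lt.1 h2))
    · exact tripleThick_of_far_left hm.le (h4.trans (not_lt.1 h1))

/-! ### Ambient isotopies -/

theorem AmbientIsotopic.refl (A : Set E3) : AmbientIsotopic A A :=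
  ⟨fun _ => Homeomorph.refl E3, continuous_snd, continuous_snd, rfl, by simp⟩

theorem AmbientIsotopic.trans {A B C : Set E3} (h₁ : AmbientIsotopic A B)
    (h₂ : AmbientIsotopic B C) : AmbientIsotopic A C := by
  obtain ⟨H, hc, hs, h0, rfl⟩ := h₁
  obtain ⟨K, kc, ks, k0, rfl⟩ := h₂
  refine ⟨fun t => (H t).trans (K t), ?_, ?_, ?_, ?_⟩
  · exact kc.comp (continuous_fst.prodMk hc)
  · exact hs.comp (continuous_fst.prodMk ks)
  · ext1 x; simp [h0, k0]
  · rw [← image_comp]; rfl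

/-- Each `x + t u(x)` differs from the identity by a contraction, hence is a homeomorphism of space.
-/
theorem exists_isotopy_id_add {u : E3 → E3} {k : ℝ≥0} (hk : k < 1) (hu : LipschitzWith k u) :
    ∃ H : unitInterval → (E3 ≃ₜ E3),
      Continuous (fun p : unitInterval × E3 => H p.1 p.2) ∧
      Continuous (fun p : unitInterval × E3 => (H p.1).symm p.2) ∧
      H 0 = Homeomorph.refl E3 ∧ ∀ x, H 1 x = x + u x := by
  have hk' : (k : ℝ) < 1 := by exact_mod_cast hk
  have happ : ∀ t : unitInterval, ApproximatesLinearOn (fun x => x + (t : ℝ) • u x)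
      ((ContinuousLinearEquiv.refl ℝ E3 : E3 ≃L[ℝ] E3) : E3 →L[ℝ] E3) univ k := by
    intro t x _ y _
    have e : x + (t : ℝ) • u x - (y + (t : ℝ) • u y) -
      ((ContinuousLinearEquiv.refl ℝ E3 : E3 ≃L[ℝ] E3) : E3 →L[ℝ] E3) (x - y) =
        (t : ℝ) • (u x - u y) := by
      simp only [ContinuousLinearEquiv.coe_refl, ContinuousLinearMap.coe_id', id_eq, smul_sub]
      abel
    rw [e, norm_smul, Real.norm_of_nonneg t.2.1]
    have h1 := hu.norm_sub_le x y
    have h2 : (t : ℝ) * ‖u x - u y‖ ≤ 1 * ‖u x - u y‖ :=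
      mul_le_mul_of_nonneg_right t.2.2 (norm_nonneg _)
    linarith
  have hinv : Subsingleton E3 ∨ k < ‖((ContinuousLinearEquiv.refl ℝ E3).symm :
      E3 →L[ℝ] E3)‖₊⁻¹ := by
    right
    have : ‖((ContinuousLinearEquiv.refl ℝ E3).symm : E3 →L[ℝ] E3)‖₊ = 1 := by
      simp
    rw [this, inv_one]
    exact hk
  let H : unitInterval → (E3 ≃ₜ E3) := fun t => (happ t).toHomeomorph _ hinv
  have hH : ∀ t x, H t x = x + (t : ℝ) • u x := fun t x => rfl
  have hcont : Continuous (fun p : unitInterval × E3 => H p.1 p.2) := by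
    simp only [hH]
    have := hu.continuous
    fun_prop
  -- Expansion uniform in `t` is what makes the inverses jointly continuous in `(t, x)`.
  have hexp : ∀ t x y, (1 - (k : ℝ)) * ‖x - y‖ ≤ ‖H t x - H t y‖ := by
    intro t x y
    have h1 := happ t x (mem_univ x) y (mem_univ y)
    simp only [ContinuousLinearEquiv.coe_refl, ContinuousLinearMap.coe_id', id_eq] at h1
    have h2 := norm_sub_norm_le (x - y) (H t x - H t y)
    rw [norm_sub_rev (x - y)] at h2
    rw [← hH, ← hH] at h1
    linarith
  refine ⟨H, hcont, ?_, ?_, fun x => by simp [hH]⟩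
  · rw [continuous_iff_continuousAt]
    rintro ⟨t₀, y₀⟩
    set x₀ := (H t₀).symm y₀ with hx₀
    rw [ContinuousAt, tendsto_iff_norm_sub_tendsto_zero]
    have hlim : Tendsto (fun p : unitInterval × E3 => (1 - (k : ℝ))⁻¹ * ‖p.2 - H p.1 x₀‖)
        (𝓝 (t₀, y₀)) (𝓝 0) := by
      have hc : Continuous (fun p : unitInterval × E3 => (1 - (k : ℝ))⁻¹ * ‖p.2 - H p.1 x₀‖) :=
        continuous_const.mul (continuous_snd.sub
          (hcont.comp (continuous_fst.prodMk continuous_const))).norm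
      have := hc.tendsto (t₀, y₀)
      simpa [hx₀] using this
    refine squeeze_zero (fun _ => norm_nonneg _) (fun p => ?_) hlim
    have h1 := hexp p.1 ((H p.1).symm p.2) x₀
    rw [Homeomorph.apply_symm_apply] at h1
    rw [inv_mul_eq_div, le_div_iff₀ (by linarith), mul_comm]
    exact h1
  · ext1 x
    simp [hH]

/-- Being a contraction in some linear coordinates is enough; steep corners need coordinates
squeezed along the bisector. -/
theorem exists_isotopy_id_add_conj (A : E3 ≃L[ℝ] E3) {u : E3 → E3} {k : ℝ≥0} (hk : k < 1)
    (hu : LipschitzWith k (fun x => A (u (A.symm x)))) :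
    ∃ H : unitInterval → (E3 ≃ₜ E3),
      Continuous (fun p : unitInterval × E3 => H p.1 p.2) ∧
      Continuous (fun p : unitInterval × E3 => (H p.1).symm p.2) ∧
      H 0 = Homeomorph.refl E3 ∧ ∀ x, H 1 x = x + u x := by
  obtain ⟨H, hc, hs, h0, h1⟩ := exists_isotopy_id_add hk hu
  refine ⟨fun t => (A.toHomeomorph.trans (H t)).trans A.symm.toHomeomorph, ?_, ?_, ?_, ?_⟩
  · exact A.symm.continuous.comp
      (hc.comp (continuous_fst.prodMk (A.continuous.comp continuous_snd)))
  · exact A.symm.continuous.comp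
      (hs.comp (continuous_fst.prodMk (A.continuous.comp continuous_snd)))
  · ext1 x
    simp [h0]
  · intro x
    simp [h1]

theorem ambientIsotopic_of_lipschitz {u : E3 → E3} {k : ℝ≥0} (hk : k < 1)
    (hu : LipschitzWith k u) (A : Set E3) : AmbientIsotopic A ((fun x => x + u x) '' A) := by
  obtain ⟨H, hc, hs, h0, h1⟩ := exists_isotopy_id_add hk hu
  exact ⟨H, hc, hs, h0, by congr 1; ext1 x; exact h1 x⟩

theorem ambientIsotopic_smul {c : ℝ} (hc : 0 < c) (A : Set E3) :
    AmbientIsotopic A ((fun x => c • x) '' A) := by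
  have hpos : ∀ t : unitInterval, 0 < 1 - (t : ℝ) + t * c := by
    intro t
    rcases eq_or_lt_of_le t.2.1 with h | h
    · simp [← h]
    · have := mul_pos h hc
      have := t.2.2
      linarith
  let H : unitInterval → (E3 ≃ₜ E3) := fun t => Homeomorph.smulOfNeZero _ (hpos t).ne'
  have hH : ∀ t x, H t x = (1 - (t : ℝ) + t * c) • x := fun t x => rfl
  have hH' : ∀ t x, (H t).symm x = (1 - (t : ℝ) + t * c)⁻¹ • x := fun t x => rfl
  refine ⟨H, ?_, ?_, ?_, ?_⟩
  · simp only [hH]; fun_prop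
  · simp only [hH']
    have hc' : Continuous fun p : unitInterval × E3 => 1 - (p.1 : ℝ) + p.1 * c := by fun_prop
    exact (hc'.inv₀ fun p => (hpos p.1).ne').smul continuous_snd
  · ext1 x; simp [hH]
  · congr 1; ext1 x; simp [hH]

/-! ### Short arcs in thick sets -/

/-- The unit vector pointing from `p` to `q`. -/
noncomputable def dir (p q : E3) : E3 := ‖q - p‖⁻¹ • (q - p)

theorem dir_swap (p q : E3) : dir q p = -dir p q := by
  rw [dir, dir, norm_sub_rev, ← smul_neg, neg_sub]

theorem norm_dir {p q : E3} (h : p ≠ q) : ‖dir p q‖ = 1 := by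
  rw [dir, norm_smul, norm_inv, norm_norm, inv_mul_cancel₀]
  exact norm_ne_zero_iff.2 (sub_ne_zero.2 h.symm)

theorem norm_smul_dir (p q : E3) : ‖q - p‖ • dir p q = q - p := by
  by_cases h : q - p = 0
  · simp [h]
  · rw [dir, smul_inv_smul₀ (norm_ne_zero_iff.2 h)]

theorem norm_sub_sq_of_unit {u v : E3} (hu : ‖u‖ = 1) (hv : ‖v‖ = 1) :
    ‖u - v‖ ^ 2 = 2 - 2 * ⟪u, v⟫ := by
  rw [norm_sub_sq_real, hu, hv]; ring

/-- The sine of the angle at `x` is at most `‖z - y‖ / (2τ)`, and for cosine `c ≥ 0` the squared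
distance of the directions is `2 - 2c ≤ 2(1 - c²)`. -/
theorem TripleThick.norm_dir_sub_dir_le {τ : ℝ} (hτ : 0 < τ) {x y z : E3}
    (h : TripleThick τ x y z) (hxy : x ≠ y) (hxz : x ≠ z) (hpos : 0 ≤ ⟪y - x, z - x⟫) :
    ‖dir x y - dir x z‖ ≤ ‖z - y‖ / τ := by
  have hu : 0 < ‖y - x‖ := norm_pos_iff.2 (sub_ne_zero.2 hxy.symm)
  have hv : 0 < ‖z - x‖ := norm_pos_iff.2 (sub_ne_zero.2 hxz.symm)
  have hc : ⟪y - x, z - x⟫ = ‖y - x‖ * ‖z - x‖ * ⟪dir x y, dir x z⟫ := by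
    conv_lhs => rw [← norm_smul_dir x y, ← norm_smul_dir x z]
    rw [inner_smul_left, inner_smul_right]
    simp; ring
  have hle : ⟪dir x y, dir x z⟫ ≤ 1 := by
    have := real_inner_le_norm (dir x y) (dir x z)
    rwa [norm_dir hxy, norm_dir hxz, one_mul] at this
  set c := ⟪dir x y, dir x z⟫
  have hc0 : 0 ≤ c := by
    by_contra hneg
    have := mul_neg_of_pos_of_neg (mul_pos hu hv) (not_le.1 hneg)
    linarith
  unfold TripleThick at h
  rw [hc] at h
  have h1 : 4 * τ ^ 2 * (1 - c ^ 2) ≤ ‖z - y‖ ^ 2 := by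
    have hp : 0 < ‖y - x‖ ^ 2 * ‖z - x‖ ^ 2 := by positivity
    refine le_of_mul_le_mul_left ?_ hp
    calc _ = 4 * τ ^ 2 * (‖y - x‖ ^ 2 * ‖z - x‖ ^ 2 - (‖y - x‖ * ‖z - x‖ * c) ^ 2) := by ring
      _ ≤ _ := h
  rw [le_div_iff₀ hτ]
  refine le_of_sq_le_sq ?_ (norm_nonneg _)
  rw [mul_pow, norm_sub_sq_of_unit (norm_dir hxy) (norm_dir hxz)]
  have : 1 - c ≤ 1 - c ^ 2 := by nlinarith
  nlinarith [mul_le_mul_of_nonneg_left this (sq_nonneg τ), mul_nonneg (sq_nonneg τ) (sub_nonneg.2 hle)]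

/-- A simple arc of small diameter satisfying the radius inequality. -/
structure ThickArc (τ d : ℝ) (γ : ℝ → E3) (a b : ℝ) : Prop where
  pos : 0 < τ
  lt : d < 2 * τ
  cont : ContinuousOn γ (Icc a b)
  inj : InjOn γ (Icc a b)
  thick : ∀ r ∈ Icc a b, ∀ s ∈ Icc a b, ∀ t ∈ Icc a b, TripleThick τ (γ r) (γ s) (γ t)
  diam : ∀ s ∈ Icc a b, ∀ t ∈ Icc a b, ‖γ s - γ t‖ ≤ d

namespace ThickArc

variable {τ d : ℝ} {γ : ℝ → E3} {a b : ℝ}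

theorem mono (h : ThickArc τ d γ a b) {a' b' : ℝ} (ha : a ≤ a') (hb : b' ≤ b) :
    ThickArc τ d γ a' b' :=
  have hs : Icc a' b' ⊆ Icc a b := Icc_subset_Icc ha hb
  ⟨h.pos, h.lt, h.cont.mono hs, h.inj.mono hs,
    fun r hr s hr' t ht => h.thick r (hs hr) s (hs hr') t (hs ht),
    fun s hs' t ht => h.diam s (hs hs') t (hs ht)⟩

theorem neg (h : ThickArc τ d γ a b) : ThickArc τ d (fun t => γ (-t)) (-b) (-a) := by
  have hs : ∀ t ∈ Icc (-b) (-a), -t ∈ Icc a b := fun t ht => ⟨by linarith [ht.2], by linarith [ht.1]⟩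
  exact ⟨h.pos, h.lt, h.cont.comp continuous_neg.continuousOn hs,
    fun x hx y hy hxy => neg_injective (h.inj (hs x hx) (hs y hy) hxy),
    fun r hr s hr' t ht => h.thick _ (hs r hr) _ (hs s hr') _ (hs t ht),
    fun s hs' t ht => h.diam _ (hs s hs') _ (hs t ht)⟩

/-- Otherwise the intermediate value theorem on `(s, b]` yields a right angle at `γ s`. The opposite
side is then a diameter, of length at most `d < 2τ`, contradicting thickness. -/
theorem inner_pos (h : ThickArc τ d γ a b) {s t t' : ℝ} (hs : a ≤ s) (hst : s < t) (hst' : s < t')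
    (ht : t ≤ b) (ht' : t' ≤ b) : 0 < ⟪γ t - γ s, γ t' - γ s⟫ := by
  have hI : ∀ r ∈ Ioc s b, r ∈ Icc a b := fun r hr => ⟨hs.trans hr.1.le, hr.2⟩
  have hsI : s ∈ Icc a b := ⟨hs, hst.le.trans ht⟩
  have hpos : ∀ r ∈ Ioc s b, 0 < ‖γ r - γ s‖ := fun r hr =>
    norm_pos_iff.2 (sub_ne_zero.2 fun he => hr.1.ne' (h.inj (hI r hr) hsI he))
  by_contra hneg
  have hcont : ContinuousOn (fun r => ⟪γ t - γ s, γ r - γ s⟫) (Ioc s b) :=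
    continuousOn_const.inner ((h.cont.mono hI).sub continuousOn_const)
  have h1 : (0 : ℝ) ∈ Icc ⟪γ t - γ s, γ t' - γ s⟫ ⟪γ t - γ s, γ t - γ s⟫ :=
    ⟨not_lt.1 hneg, real_inner_self_nonneg⟩
  obtain ⟨r, hr, h0⟩ := isPreconnected_Ioc.intermediate_value (show t' ∈ Ioc s b from ⟨hst', ht'⟩)
    (show t ∈ Ioc s b from ⟨hst, ht⟩) hcont h1
  have hth := h.thick s hsI t (hI t ⟨hst, ht⟩) r (hI r hr)
  unfold TripleThick at hth
  simp only at h0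
  rw [h0] at hth
  have p1 := hpos t ⟨hst, ht⟩
  have p2 := hpos r hr
  have hd := h.diam r (hI r hr) t (hI t ⟨hst, ht⟩)
  have hd2 : ‖γ r - γ t‖ ^ 2 < (2 * τ) ^ 2 := by
    have := hd.trans_lt h.lt
    gcongr
  have hp : 0 < ‖γ t - γ s‖ ^ 2 * ‖γ r - γ s‖ ^ 2 := by positivity
  nlinarith

theorem norm_dir_sub_left (h : ThickArc τ d γ a b) {s t t' : ℝ} (hs : a ≤ s) (hst : s < t)
    (hst' : s < t') (ht : t ≤ b) (ht' : t' ≤ b) :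
    ‖dir (γ s) (γ t) - dir (γ s) (γ t')‖ ≤ ‖γ t' - γ t‖ / τ := by
  have hsI : s ∈ Icc a b := ⟨hs, hst.le.trans ht⟩
  have htI : t ∈ Icc a b := ⟨hs.trans hst.le, ht⟩
  have htI' : t' ∈ Icc a b := ⟨hs.trans hst'.le, ht'⟩
  exact (h.thick s hsI t htI t' htI').norm_dir_sub_dir_le h.pos
    (fun he => hst.ne (h.inj hsI htI he)) (fun he => hst'.ne (h.inj hsI htI' he))
    (h.inner_pos hs hst hst' ht ht').le

theorem norm_dir_sub_right (h : ThickArc τ d γ a b) {s s' t : ℝ} (ht : t ≤ b) (hst : s < t)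
    (hst' : s' < t) (hs : a ≤ s) (hs' : a ≤ s') :
    ‖dir (γ s) (γ t) - dir (γ s') (γ t)‖ ≤ ‖γ s' - γ s‖ / τ := by
  have := h.neg.norm_dir_sub_left (s := -t) (t := -s) (t' := -s') (by linarith) (by linarith)
    (by linarith) (by linarith) (by linarith)
  simp only [neg_neg] at this
  rwa [dir_swap (γ s), dir_swap (γ s'), neg_sub_neg, norm_sub_rev] at this

/-- The endpoints are moved one at a time, through the chord from `γ s` to `γ b`; each move costs at
most `d / τ`. -/
theorem norm_dir_sub_endpoints (h : ThickArc τ d γ a b) {s t : ℝ} (hs : a ≤ s) (hst : s < t)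
    (ht : t ≤ b) : ‖dir (γ s) (γ t) - dir (γ a) (γ b)‖ ≤ 2 * d / τ := by
  have h1 := h.norm_dir_sub_left hs hst (hst.trans_le ht) ht le_rfl
  have h2 := h.norm_dir_sub_right le_rfl (hst.trans_le ht) (hs.trans_lt (hst.trans_le ht)) hs le_rfl
  have hab : a ≤ b := hs.trans (hst.le.trans ht)
  have h3 := h.diam b ⟨hab, le_rfl⟩ t ⟨hs.trans hst.le, ht⟩
  have h4 := h.diam a ⟨le_rfl, hab⟩ s ⟨hs, hst.le.trans ht⟩
  have h5 := norm_sub_le_norm_sub_add_norm_sub (dir (γ s) (γ t)) (dir (γ s) (γ b))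
    (dir (γ a) (γ b))
  have h6 : ‖γ b - γ t‖ / τ ≤ d / τ := div_le_div_of_nonneg_right h3 h.pos.le
  have h7 : ‖γ a - γ s‖ / τ ≤ d / τ := div_le_div_of_nonneg_right h4 h.pos.le
  rw [two_mul, add_div]
  linarith

/-- Unit vectors at distance at most `2d/τ` have inner product at least `1 - 2(d/τ)²`. So every
chord advances along the end-to-end direction, and for an inscribed polygon these advances
telescope. -/
theorem mul_norm_sub_le_inner (h : ThickArc τ d γ a b) {s t : ℝ} (hs : a ≤ s) (hst : s ≤ t)
    (ht : t ≤ b) :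
    (1 - 2 * (d / τ) ^ 2) * ‖γ t - γ s‖ ≤ ⟪γ t, dir (γ a) (γ b)⟫ - ⟪γ s, dir (γ a) (γ b)⟫ := by
  rcases hst.eq_or_lt with rfl | hst
  · simp
  have hne : ∀ {s t : ℝ}, a ≤ s → s < t → t ≤ b → γ s ≠ γ t := fun h1 h2 h3 he =>
    h2.ne (h.inj ⟨h1, h2.le.trans h3⟩ ⟨h1.trans h2.le, h3⟩ he)
  have hab := hs.trans_lt (hst.trans_le ht)
  rw [← inner_sub_left]
  nth_rw 2 [← norm_smul_dir (γ s) (γ t)]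
  rw [inner_smul_left, RCLike.conj_to_real, mul_comm]
  refine mul_le_mul_of_nonneg_left ?_ (norm_nonneg _)
  have h1 := h.norm_dir_sub_endpoints hs hst ht
  have h2 := norm_sub_sq_of_unit (norm_dir (hne hs hst ht)) (norm_dir (hne le_rfl hab le_rfl))
  have h3 : ‖dir (γ s) (γ t) - dir (γ a) (γ b)‖ ^ 2 ≤ (2 * d / τ) ^ 2 := by gcongr
  have h4 : (2 * d / τ) ^ 2 = 4 * (d / τ) ^ 2 := by ring
  linarith

theorem mul_eVariationOn_le (h : ThickArc τ d γ a b) (hd : 2 * (d / τ) ^ 2 < 1) :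
    eVariationOn γ (Icc a b) ≤
      ENNReal.ofReal ((1 - 2 * (d / τ) ^ 2)⁻¹ * ‖γ b - γ a‖) := by
  set m := 1 - 2 * (d / τ) ^ 2 with hm
  have hm0 : 0 < m := by linarith
  set D := dir (γ a) (γ b)
  refine iSup_le ?_
  rintro ⟨n, u, hu, huI⟩
  simp only
  have hstep : ∀ i, edist (γ (u (i + 1))) (γ (u i)) ≤
      ENNReal.ofReal (m⁻¹ * (⟪γ (u (i + 1)), D⟫ - ⟪γ (u i), D⟫)) := by
    intro i
    rw [edist_dist, dist_eq_norm]
    refine ENNReal.ofReal_le_ofReal ?_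
    rw [inv_mul_eq_div, le_div_iff₀ hm0, mul_comm]
    exact h.mul_norm_sub_le_inner (huI i).1 (hu (Nat.le_succ i)) (huI (i + 1)).2
  have hnn : ∀ i ∈ Finset.range n, 0 ≤ m⁻¹ * (⟪γ (u (i + 1)), D⟫ - ⟪γ (u i), D⟫) := fun i _ =>
    mul_nonneg (by positivity) (le_trans (by positivity) (h.mul_norm_sub_le_inner (huI i).1
      (hu (Nat.le_succ i)) (huI (i + 1)).2))
  refine (Finset.sum_le_sum fun i _ => hstep i).trans ?_
  rw [← ENNReal.ofReal_sum_of_nonneg hnn, ← Finset.mul_sum,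
    Finset.sum_range_sub (fun i => ⟪γ (u i), D⟫)]
  refine ENNReal.ofReal_le_ofReal (mul_le_mul_of_nonneg_left ?_ (by positivity))
  have h1 := h.mul_norm_sub_le_inner le_rfl (huI 0).1 (huI 0).2
  have h2 := h.mul_norm_sub_le_inner (huI n).1 (huI n).2 le_rfl
  have h3 : ⟪γ b, D⟫ - ⟪γ a, D⟫ ≤ ‖γ b - γ a‖ := by
    rw [← inner_sub_left]
    refine (real_inner_le_norm _ _).trans ?_
    refine mul_le_of_le_one_right (norm_nonneg _) ?_
    by_cases he : γ a = γ b
    · simp [D, dir, he]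
    · exact (norm_dir he).le
  have p1 : 0 ≤ m * ‖γ (u 0) - γ a‖ := by positivity
  have p2 : 0 ≤ m * ‖γ b - γ (u n)‖ := by positivity
  linarith

end ThickArc

/-! ### Arclength parametrization of thick loops -/

theorem injOn_Ico_of_periodic {α : Type*} {γ : ℝ → α} {p : ℝ} (hp : 0 < p)
    (hper : Function.Periodic γ p) (hinj : InjOn γ (Ico 0 p)) (a : ℝ) :
    InjOn γ (Ico a (a + p)) := by
  intro x hx y hy hxy
  have key : ∀ z, γ (toIcoMod hp 0 z) = γ z := fun z => by
    rw [← self_sub_toIcoDiv_zsmul]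
    exact hper.sub_zsmul_eq _
  have hm : ∀ z, toIcoMod hp 0 z ∈ Ico 0 p := fun z => by
    simpa using toIcoMod_mem_Ico hp 0 z
  have h1 : toIcoMod hp 0 x = toIcoMod hp 0 y :=
    hinj (hm x) (hm y) (by rw [key, key, hxy])
  rw [toIcoMod_inj] at h1
  have h2 : toIcoMod hp a x = toIcoMod hp a y := by
    rw [toIcoMod_inj]; exact h1
  rwa [(toIcoMod_eq_self hp).2 hx, (toIcoMod_eq_self hp).2 hy] at h2

theorem eVariationOn_Icc_add_period {γ : ℝ → E3} {p : ℝ} (hper : Function.Periodic γ p)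
    (a b : ℝ) : eVariationOn γ (Icc (a + p) (b + p)) = eVariationOn γ (Icc a b) := by
  have h := eVariationOn.comp_eq_of_monotoneOn γ (t := Icc a b) (fun x => x + p)
    (fun x _ y _ hxy => by simpa using hxy)
  rw [image_add_const_Icc] at h
  rw [← h]
  congr 1
  ext1 x
  exact hper x

theorem locallyBoundedVariationOn_of_periodic {γ : ℝ → E3} (hper : Function.Periodic γ 1)
    (hfin : eVariationOn γ (Icc 0 1) ≠ ⊤) : LocallyBoundedVariationOn γ univ := by
  have hn : ∀ n : ℕ, eVariationOn γ (Icc 0 (n : ℝ)) ≠ ⊤ := by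
    intro n
    induction n with
    | zero => simp [eVariationOn.subsingleton]
    | succ n ih =>
      have h := eVariationOn.Icc_add_Icc γ (s := univ) (a := 0) (b := (n : ℝ)) (c := n + 1)
        (by positivity) (by linarith) (mem_univ _)
      simp only [univ_inter] at h
      have h2 := eVariationOn_Icc_add_period (p := n) (by simpa using hper.nat_mul n) 0 1
      rw [zero_add, add_comm 1] at h2
      push_cast
      rw [← h, h2]
      exact ENNReal.add_ne_top.2 ⟨ih, hfin⟩
  intro a b _ _
  rw [univ_inter]
  obtain ⟨n, hn'⟩ := exists_nat_ge (max (-a) b)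
  have h2 := eVariationOn_Icc_add_period (p := n) (by simpa using hper.nat_mul n) (-n) n
  rw [neg_add_cancel] at h2
  refine ne_top_of_le_ne_top (hn (n + n)) ?_
  push_cast
  rw [h2]
  exact eVariationOn.mono _ (Icc_subset_Icc (by linarith [le_max_left (-a) b])
    ((le_max_right _ _).trans hn'))

/-- A loop of length `ℓ` parametrized by arclength, satisfying the radius inequality. -/
structure UnitLoop (τ ℓ : ℝ) (β : ℝ → E3) : Prop where
  pos : 0 < τ
  len_pos : 0 < ℓ
  periodic : Function.Periodic β ℓ
  injOn : InjOn β (Ico 0 ℓ)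
  thick : ∀ r s t, TripleThick τ (β r) (β s) (β t)
  unit : ∀ x y, x ≤ y → eVariationOn β (Icc x y) = ENNReal.ofReal (y - x)

/-- Arclength is strictly increasing because `γ` is injective on a period, and continuous because a
short arc is at most twice as long as its chord. It is thus a bijection of the line that grows by
`ℓ` per period. -/
theorem exists_unitLoop {τ : ℝ} (hτ : 0 < τ) {γ : ℝ → E3} (hγ : IsSimpleClosed γ)
    (hth : ThickSet τ (range γ)) (hfin : eVariationOn γ (Icc 0 1) ≠ ⊤) :
    ∃ β : ℝ → E3, UnitLoop τ (eVariationOn γ (Icc 0 1)).toReal β ∧ range β = range γ := by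
  have hbv := locallyBoundedVariationOn_of_periodic hγ.periodic hfin
  set arc := variationOnFromTo γ univ 0 with harc
  set ℓ := (eVariationOn γ (Icc 0 1)).toReal with hℓ
  have hdiff : ∀ a b, a ≤ b → arc b - arc a = (eVariationOn γ (Icc a b)).toReal := by
    intro a b hab
    have h := variationOnFromTo.add hbv (mem_univ 0) (mem_univ a) (mem_univ b)
    rw [variationOnFromTo.eq_of_le γ univ hab, univ_inter] at h
    rw [harc, ← h]; ring
  have harc0 : arc 0 = 0 := variationOnFromTo.self _ _ _
  have hmono : Monotone arc := fun a b hab =>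
    variationOnFromTo.monotoneOn hbv (mem_univ 0) (mem_univ a) (mem_univ b) hab
  have hstrict : StrictMono arc := by
    intro a b hab
    refine lt_of_le_of_ne (hmono hab.le) fun he => ?_
    -- Within half a period, injectivity applies; zero variation would give `γ a = γ c`.
    set c := min b (a + 1 / 2)
    have hac : a < c := lt_min hab (by linarith)
    have hc : arc a = arc c := le_antisymm (hmono hac.le) (he ▸ hmono (min_le_left _ _))
    have h0 : variationOnFromTo γ univ a c = 0 := by
      rw [variationOnFromTo.eq_of_le γ univ hac.le, univ_inter, ← hdiff a c hac.le, hc, sub_self]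
    have h1 := variationOnFromTo.edist_zero_of_eq_zero hbv (mem_univ a) (mem_univ c) h0
    have h2 := injOn_Ico_of_periodic one_pos hγ.periodic hγ.injOn a
      ⟨le_rfl, by linarith⟩ ⟨hac.le, (min_le_right b (a + 1 / 2)).trans_lt (by linarith)⟩
      (edist_eq_zero.1 h1)
    exact hac.ne h2
  have hper : ∀ t, arc (t + 1) = arc t + ℓ := by
    have hd : ∀ a b, a ≤ b → arc (b + 1) - arc (a + 1) = arc b - arc a := fun a b hab => by
      rw [hdiff _ _ hab, hdiff _ _ (by linarith), eVariationOn_Icc_add_period hγ.periodic]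
    have h1 : arc 1 = ℓ := by
      have := hdiff 0 1 zero_le_one
      rwa [harc0, sub_zero] at this
    intro t
    rcases le_total 0 t with h | h
    · have := hd 0 t h
      rw [zero_add] at this
      linarith
    · have := hd t 0 h
      rw [zero_add] at this
      linarith
  have hℓpos : 0 < ℓ := by
    have := hper 0
    have h2 := hstrict (show (0 : ℝ) < 0 + 1 by norm_num)
    linarith
  have harcn : ∀ n : ℤ, arc n = n * ℓ := by
    have hp : Function.Periodic (fun t => arc t - ℓ * t) 1 := fun t => by
      simp only [hper]; ring
    intro n
    have := hp.int_mul n 0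
    simp only [mul_one, zero_add, harc0] at this
    linarith
  have hcont : Continuous arc := by
    rw [continuous_iff_continuousAt]
    intro t₀
    obtain ⟨δ, hδ, hball⟩ := Metric.continuousAt_iff.1 (hγ.continuous.continuousAt (x := t₀))
      (τ / 8) (by positivity)
    set η := min (δ / 2) (1 / 4)
    have hη : 0 < η := lt_min (by positivity) (by norm_num)
    have hη1 : η ≤ δ / 2 := min_le_left _ _
    have hη2 : η ≤ 1 / 4 := min_le_right _ _
    have hA : ThickArc τ (τ / 4) γ (t₀ - η) (t₀ + η) := by
      have hd : ∀ s ∈ Icc (t₀ - η) (t₀ + η), dist (γ s) (γ t₀) < τ / 8 := fun s hs =>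
        hball (by rw [Real.dist_eq, abs_lt]; constructor <;> linarith [hs.1, hs.2])
      refine ⟨hτ, by linarith, hγ.continuous.continuousOn, ?_, fun r _ s _ t _ =>
        hth _ (mem_range_self r) _ (mem_range_self s) _ (mem_range_self t), fun s hs t ht => ?_⟩
      · exact (injOn_Ico_of_periodic one_pos hγ.periodic hγ.injOn (t₀ - η)).mono
          (Icc_subset_Ico_right (by linarith))
      · rw [← dist_eq_norm]
        linarith [dist_triangle_right (γ s) (γ t) (γ t₀), hd s hs, hd t ht]
    have hbound : ∀ a b, t₀ - η ≤ a → a ≤ b → b ≤ t₀ + η → arc b - arc a ≤ 2 * ‖γ b - γ a‖ := by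
      intro a b ha hab hb
      -- Diameter `τ / 4` gives the factor `(1 - 2/16)⁻¹ = 8/7`, rounded up to 2.
      have e : τ / 4 / τ = 1 / 4 := by field_simp
      have h := (hA.mono ha hb).mul_eVariationOn_le (by rw [e]; norm_num)
      rw [e] at h
      rw [hdiff a b hab]
      refine ENNReal.toReal_le_of_le_ofReal (by positivity) (h.trans ?_)
      refine ENNReal.ofReal_le_ofReal (mul_le_mul_of_nonneg_right (by norm_num) (norm_nonneg _))
    rw [ContinuousAt, tendsto_iff_dist_tendsto_zero]
    have hlim : Tendsto (fun t => 2 * ‖γ t - γ t₀‖) (𝓝 t₀) (𝓝 0) := by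
      have hc : Continuous fun t => 2 * ‖γ t - γ t₀‖ :=
        continuous_const.mul (hγ.continuous.sub continuous_const).norm
      simpa using hc.tendsto t₀
    refine squeeze_zero' (Eventually.of_forall fun _ => dist_nonneg) ?_ hlim
    filter_upwards [Icc_mem_nhds (show t₀ - η < t₀ by linarith) (show t₀ < t₀ + η by linarith)]
      with t ht
    rw [Real.dist_eq]
    rcases le_total t t₀ with h | h
    · rw [abs_of_nonpos (by linarith [hmono h]), norm_sub_rev]
      linarith [hbound t t₀ ht.1 h (by linarith)]
    · rw [abs_of_nonneg (by linarith [hmono h])]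
      exact hbound t₀ t (by linarith) h ht.2
  have hsurj : Function.Surjective arc := by
    intro y
    obtain ⟨n, hn⟩ := exists_nat_ge (|y| / ℓ)
    rw [div_le_iff₀ hℓpos] at hn
    refine mem_range_of_exists_le_of_exists_ge hcont ⟨((-n : ℤ) : ℝ), ?_⟩ ⟨((n : ℤ) : ℝ), ?_⟩
    · rw [harcn]; push_cast; linarith [neg_abs_le y]
    · rw [harcn]; push_cast; linarith [le_abs_self y]
  have hβ : ∀ t, naturalParameterization γ univ 0 (arc t) = γ t := fun t =>
    edist_eq_zero.1 (edist_naturalParameterization_eq_zero hbv (mem_univ 0) (mem_univ t))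
  set β := naturalParameterization γ univ 0
  have hrange : range β = range γ := by
    ext p
    constructor
    · rintro ⟨x, rfl⟩
      obtain ⟨t, rfl⟩ := hsurj x
      exact ⟨t, (hβ t).symm⟩
    · rintro ⟨t, rfl⟩
      exact ⟨arc t, hβ t⟩
  have hunit := has_unit_speed_naturalParameterization γ hbv (mem_univ 0)
  rw [image_univ, ← harc, hsurj.range_eq] at hunit
  refine ⟨β, ⟨hτ, hℓpos, ?_, ?_, ?_, ?_⟩, hrange⟩
  · intro x
    obtain ⟨t, rfl⟩ := hsurj x
    rw [← hper, hβ, hβ, hγ.periodic]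
  · intro x hx y hy hxy
    obtain ⟨s, rfl⟩ := hsurj x
    obtain ⟨t, rfl⟩ := hsurj y
    have hI : ∀ s, arc s ∈ Ico 0 ℓ → s ∈ Ico 0 1 := by
      intro s hs
      have h1 : arc 1 = ℓ := by simpa using harcn 1
      exact ⟨hstrict.le_iff_le.1 (harc0.trans_le hs.1), hstrict.lt_iff_lt.1 (hs.2.trans_eq h1.symm)⟩
    rw [hβ, hβ] at hxy
    rw [hγ.injOn (hI s hx) (hI t hy) hxy]
  · intro r s t
    have hm : ∀ x, β x ∈ range γ := fun x => hrange ▸ ⟨x, rfl⟩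
    exact hth _ (hm r) _ (hm s) _ (hm t)
  · intro x y hxy
    have := hunit (mem_univ x) (mem_univ y)
    simpa using this

/-! ### Regularity of thick loops -/

/-- Slopes over subintervals of a short interval nearly agree, so the difference quotients at `x`
form a Cauchy filter; the limit inherits the comparison. -/
theorem exists_hasDerivAt_of_slope {β : ℝ → E3} {C w : ℝ} (hC : 0 ≤ C) (hw : 0 < w)
    (h : ∀ a b s t, a ≤ s → s < t → t ≤ b → b - a ≤ w →
      ‖slope β s t - slope β a b‖ ≤ C * (b - a)) (x : ℝ) :
    ∃ T, HasDerivAt β T x ∧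
      ∀ a b, a ≤ x → x ≤ b → a < b → b - a ≤ w → ‖T - slope β a b‖ ≤ C * (b - a) := by
  have h' : ∀ a b s t, a ≤ s → s ≤ b → a ≤ t → t ≤ b → s ≠ t → b - a ≤ w →
      ‖slope β s t - slope β a b‖ ≤ C * (b - a) := by
    intro a b s t h1 h2 h3 h4 hne hb
    rcases lt_or_gt_of_ne hne with hlt | hlt
    · exact h a b s t h1 hlt h4 hb
    · rw [slope_comm]
      exact h a b t s h3 hlt h2 hb
  have hcauchy : Cauchy (map (slope β x) (𝓝[≠] x)) := by
    rw [Metric.cauchy_iff]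
    refine ⟨inferInstance, fun ε hε => ?_⟩
    set r := min (w / 2) (ε / (4 * (C + 1)) / 2) with hr
    have hr0 : 0 < r := lt_min (by positivity) (by positivity)
    have hr1 : r ≤ w / 2 := min_le_left _ _
    have hr2 : r ≤ ε / (4 * (C + 1)) / 2 := min_le_right _ _
    have hCr : C * (2 * r) < ε / 2 := by
      have h1 : (C + 1) * (2 * r) ≤ ε / 4 := by
        have : 2 * r ≤ ε / (4 * (C + 1)) := by linarith
        rw [le_div_iff₀ (by positivity)] at this
        linarith
      nlinarith
    refine ⟨slope β x '' (Icc (x - r) (x + r) \ {x}), image_mem_map ?_, ?_⟩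
    · exact sdiff_mem_nhdsWithin_compl (Icc_mem_nhds (by linarith) (by linarith)) _
    · rintro _ ⟨y, ⟨hy, hyx⟩, rfl⟩ _ ⟨z, ⟨hz, hzx⟩, rfl⟩
      have e1 := h' (x - r) (x + r) x y (by linarith) (by linarith) hy.1 hy.2 (Ne.symm hyx)
        (by linarith)
      have e2 := h' (x - r) (x + r) x z (by linarith) (by linarith) hz.1 hz.2 (Ne.symm hzx)
        (by linarith)
      have e3 : x + r - (x - r) = 2 * r := by ring
      rw [e3] at e1 e2
      rw [← dist_eq_norm] at e1 e2
      linarith [dist_triangle_right (slope β x y) (slope β x z) (slope β (x - r) (x + r))]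
  obtain ⟨T, hT⟩ := cauchy_map_iff_exists_tendsto.1 hcauchy
  refine ⟨T, hasDerivAt_iff_tendsto_slope.2 hT, fun a b ha hb hab hw' => ?_⟩
  have hlim : Tendsto (fun y => ‖slope β x y - slope β a b‖) (𝓝[≠] x)
      (𝓝 ‖T - slope β a b‖) := (hT.sub_const _).norm
  -- `x` may be an endpoint of `[a, b]`, so the interval may approach it from one side only.
  have hfreq : ∃ᶠ y in 𝓝[≠] x, y ∈ Icc a b := by
    have hmem : x ∈ closure (Ioo a b) := by
      rw [closure_Ioo hab.ne]; exact ⟨ha, hb⟩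
    by_cases hxb : x < b
    · have h1 : ∃ᶠ y in 𝓝[>] x, y ∈ Icc a b :=
        (Filter.Eventually.frequently (by
          filter_upwards [Ioc_mem_nhdsGT hxb] with y hy
          exact ⟨ha.trans hy.1.le, hy.2⟩))
      exact h1.filter_mono (nhdsWithin_mono _ fun y hy => ne_of_gt hy)
    · have hax : a < x := hab.trans_le (not_lt.1 hxb)
      have h1 : ∃ᶠ y in 𝓝[<] x, y ∈ Icc a b :=
        (Filter.Eventually.frequently (by
          filter_upwards [Ico_mem_nhdsLT hax] with y hy
          exact ⟨hy.1, hy.2.le.trans hb⟩))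
      exact h1.filter_mono (nhdsWithin_mono _ fun y hy => ne_of_lt hy)
  by_contra hlt
  have h2 := hlim.eventually (lt_mem_nhds (not_le.1 hlt))
  obtain ⟨y, hy, hy2, hne⟩ := (hfreq.and_eventually (h2.and self_mem_nhdsWithin)).exists
  exact absurd (h' a b x y ha hb hy.1 hy.2 (Ne.symm hne) hw') (not_le.2 hy2)

/-- The distance from `x` to a critical point on a curve through a thick set is at least `2τ`. -/
theorem le_norm_sub_of_critical {τ t : ℝ} {β : ℝ → E3} {x T : E3}
    (hth : ∀ t', TripleThick τ (β t) x (β t')) (hT : HasDerivAt β T t) (hT1 : ‖T‖ = 1)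
    (hne : x ≠ β t) (hcrit : ⟪x - β t, T⟫ = 0) : 2 * τ ≤ ‖x - β t‖ := by
  have hs := hasDerivAt_iff_tendsto_slope.1 hT
  have hb : Tendsto β (𝓝[≠] t) (𝓝 (β t)) := hT.continuousAt.tendsto.mono_left inf_le_left
  -- Divide the inequality for `β t, x, β y` by `(y - t)²` and let `y → t`: the limit concerns the
  -- circle through `x` tangent to the curve at `β t`.
  have hL : Tendsto (fun y => 4 * τ ^ 2 * (‖x - β t‖ ^ 2 * ‖slope β t y‖ ^ 2 -
      ⟪x - β t, slope β t y⟫ ^ 2)) (𝓝[≠] t)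
      (𝓝 (4 * τ ^ 2 * (‖x - β t‖ ^ 2 * ‖T‖ ^ 2 - ⟪x - β t, T⟫ ^ 2))) :=
    (((hs.norm.pow 2).const_mul _).sub ((tendsto_const_nhds.inner hs).pow 2)).const_mul _
  have hR : Tendsto (fun y => ‖x - β t‖ ^ 2 * ‖slope β t y‖ ^ 2 * ‖β y - x‖ ^ 2) (𝓝[≠] t)
      (𝓝 (‖x - β t‖ ^ 2 * ‖T‖ ^ 2 * ‖β t - x‖ ^ 2)) :=
    ((hs.norm.pow 2).const_mul _).mul ((hb.sub_const x).norm.pow 2)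
  have hle := le_of_tendsto_of_tendsto' hL hR fun y => by
    have h := hth y
    unfold TripleThick at h
    rw [slope_def_module, norm_smul, inner_smul_right, Real.norm_eq_abs, mul_pow, sq_abs, mul_pow]
    have := mul_le_mul_of_nonneg_left h (sq_nonneg (y - t)⁻¹)
    linarith
  rw [hcrit, hT1, norm_sub_rev (β t)] at hle
  have hpos : 0 < ‖x - β t‖ := norm_pos_iff.2 (sub_ne_zero.2 hne)
  have h4 : (2 * τ) ^ 2 ≤ ‖x - β t‖ ^ 2 := by
    have hp : 0 < ‖x - β t‖ ^ 2 := by positivity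
    refine le_of_mul_le_mul_left ?_ hp
    linarith
  exact le_of_sq_le_sq h4 hpos.le

theorem inner_eq_zero_of_isLocalMin {β : ℝ → E3} {x T : E3} {t : ℝ} (hT : HasDerivAt β T t)
    (hmin : IsLocalMin (fun s => ‖β s - x‖) t) : ⟪x - β t, T⟫ = 0 := by
  have hmin2 : IsLocalMin (fun s => ‖β s - x‖ ^ 2) t := by
    filter_upwards [hmin] with s hs
    gcongr
  have h := hmin2.hasDerivAt_eq_zero (hT.sub_const x).norm_sq
  rw [← neg_sub, inner_neg_left]
  linarith

/-! ### Chord-arc estimates and tangents of unit-speed loops -/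

namespace UnitLoop

variable {τ ℓ : ℝ} {β : ℝ → E3}

theorem norm_sub_le_abs (h : UnitLoop τ ℓ β) (x y : ℝ) : ‖β x - β y‖ ≤ |x - y| := by
  wlog hxy : x ≤ y generalizing x y
  · rw [norm_sub_rev, abs_sub_comm]
    exact this y x (le_of_not_ge hxy)
  have h1 := eVariationOn.edist_le β (s := Icc x y) (x := x) (y := y) ⟨le_rfl, hxy⟩ ⟨hxy, le_rfl⟩
  rw [h.unit x y hxy, edist_dist, dist_eq_norm,
    ENNReal.ofReal_le_ofReal_iff (by linarith)] at h1
  rw [abs_sub_comm, abs_of_nonneg (by linarith)]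
  exact h1

theorem continuous (h : UnitLoop τ ℓ β) : Continuous β :=
  (LipschitzWith.of_dist_le_mul (K := 1) fun x y => by
    rw [dist_eq_norm, Real.dist_eq, NNReal.coe_one, one_mul]; exact h.norm_sub_le_abs x y).continuous

theorem thickArc (h : UnitLoop τ ℓ β) {a b w : ℝ} (h1 : b - a < ℓ) (h2 : b - a ≤ w)
    (h3 : w < 2 * τ) : ThickArc τ w β a b :=
  ⟨h.pos, h3, h.continuous.continuousOn,
    (injOn_Ico_of_periodic h.len_pos h.periodic h.injOn a).mono
      (Icc_subset_Ico_right (by linarith)),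
    fun r _ s _ t _ => h.thick r s t,
    fun s hs t ht => (h.norm_sub_le_abs s t).trans (by
      rw [abs_le]; constructor <;> linarith [hs.1, hs.2, ht.1, ht.2])⟩

theorem sq_div_le (h : UnitLoop τ ℓ β) {w : ℝ} (hw : 0 ≤ w) (hw2 : w ≤ τ / 4) :
    2 * (w / τ) ^ 2 ≤ w / τ / 2 := by
  have h1 : 0 ≤ w / τ := div_nonneg hw h.pos.le
  have h2 : w / τ ≤ 1 / 4 := by
    rw [div_le_iff₀ h.pos]; linarith
  nlinarith

/-- The arc has length `y - x`, so the bound of length by chord is a lower bound for the chord. -/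
theorem chord_aux (h : UnitLoop τ ℓ β) {x y : ℝ} (hxy : x ≤ y) (h1 : y - x < ℓ)
    (h2 : y - x ≤ τ / 4) : (1 - 2 * ((y - x) / τ) ^ 2) * (y - x) ≤ ‖β y - β x‖ := by
  have hpos := h.pos
  have hs := h.sq_div_le (by linarith) h2
  have hq : (y - x) / τ ≤ 1 / 4 := by
    rw [div_le_iff₀ h.pos]; linarith
  have hm : 0 < 1 - 2 * ((y - x) / τ) ^ 2 := by linarith
  have h3 := (h.thickArc h1 le_rfl (by linarith)).mul_eVariationOn_le (by linarith)
  rw [h.unit x y hxy, ENNReal.ofReal_le_ofReal_iff (by positivity), inv_mul_eq_div,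
    le_div_iff₀ hm] at h3
  linarith

/-- If `ℓ ≤ τ / 4`, three quarters of the loop would have endpoints at least `(7/8)(3/4)ℓ` apart,
although the remaining quarter joins them within `ℓ / 4`. -/
theorem lt_len (h : UnitLoop τ ℓ β) : τ / 4 < ℓ := by
  by_contra hle
  have hl := h.len_pos
  have h1 := h.chord_aux (x := 0) (y := ℓ * (3 / 4)) (by positivity) (by linarith) (by linarith)
  have h2 := h.norm_sub_le_abs (ℓ * (3 / 4)) ℓ
  have h3 : β ℓ = β 0 := by simpa using h.periodic 0
  rw [h3, abs_of_nonpos (by linarith)] at h2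
  have hs := h.sq_div_le (w := ℓ * (3 / 4) - 0) (by linarith) (by linarith)
  have hq : (ℓ * (3 / 4) - 0) / τ ≤ 1 / 4 := by
    rw [div_le_iff₀ h.pos]; linarith
  nlinarith

theorem chord (h : UnitLoop τ ℓ β) {x y : ℝ} (hxy : x ≤ y) (h2 : y - x ≤ τ / 4) :
    (1 - 2 * ((y - x) / τ) ^ 2) * (y - x) ≤ ‖β y - β x‖ :=
  h.chord_aux hxy (h2.trans_lt h.lt_len) h2

theorem half_chord (h : UnitLoop τ ℓ β) {x y : ℝ} (hxy : x ≤ y) (h2 : y - x ≤ τ / 4) :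
    (y - x) / 2 ≤ ‖β y - β x‖ := by
  have h1 := h.chord hxy h2
  have hs := h.sq_div_le (by linarith) h2
  have hq : (y - x) / τ ≤ 1 / 4 := by
    rw [div_le_iff₀ h.pos]; linarith
  nlinarith

/-- The two vectors are parallel, and their lengths differ by one minus the ratio of chord to arc.
-/
theorem norm_slope_sub_dir (h : UnitLoop τ ℓ β) {x y : ℝ} (hxy : x < y) (h2 : y - x ≤ τ / 4) :
    ‖slope β x y - dir (β x) (β y)‖ ≤ (y - x) / τ / 2 := by
  have hp : 0 < y - x := by linarith
  have h1 := h.chord hxy.le h2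
  have hc := h.half_chord hxy.le h2
  have hs := h.sq_div_le hp.le h2
  have hne : β x ≠ β y := fun he => by
    rw [he, sub_self, norm_zero] at hc; linarith
  have h3 := h.norm_sub_le_abs y x
  rw [abs_of_pos hp] at h3
  have e : slope β x y - dir (β x) (β y) =
      (‖β y - β x‖ / (y - x) - 1) • dir (β x) (β y) := by
    rw [slope_def_module, sub_smul, one_smul, div_eq_inv_mul, mul_smul, norm_smul_dir]
  rw [e, norm_smul, norm_dir hne, mul_one, Real.norm_eq_abs, abs_le]
  have l1 : 1 - 2 * ((y - x) / τ) ^ 2 ≤ ‖β y - β x‖ / (y - x) := by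
    rwa [le_div_iff₀ hp]
  have l2 : ‖β y - β x‖ / (y - x) ≤ 1 := by
    rwa [div_le_iff₀ hp, one_mul]
  have l3 : 0 ≤ (y - x) / τ / 2 := by have := h.pos; positivity
  constructor <;> linarith

/-- The 3 is 2 for the turning of chord directions plus 1/2 for each passage from a slope to a
direction. -/
theorem norm_slope_sub_slope (h : UnitLoop τ ℓ β) (a b s t : ℝ) (has : a ≤ s) (hst : s < t)
    (htb : t ≤ b) (hw : b - a ≤ τ / 4) : ‖slope β s t - slope β a b‖ ≤ 3 / τ * (b - a) := by
  have hpos := h.pos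
  have h1 := h.norm_slope_sub_dir hst (by linarith)
  have h2 := h.norm_slope_sub_dir (has.trans_lt (hst.trans_le htb)) hw
  have h3 := (h.thickArc (hw.trans_lt h.lt_len) le_rfl (by linarith)).norm_dir_sub_endpoints
    has hst htb
  have h4 : (t - s) / τ / 2 ≤ (b - a) / τ / 2 := by gcongr
  have e : slope β s t - slope β a b = (slope β s t - dir (β s) (β t)) +
      (dir (β s) (β t) - dir (β a) (β b)) - (slope β a b - dir (β a) (β b)) := by abel
  rw [e]
  have h5 := norm_sub_le ((slope β s t - dir (β s) (β t)) + (dir (β s) (β t) - dir (β a) (β b)))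
    (slope β a b - dir (β a) (β b))
  have h6 := norm_add_le (slope β s t - dir (β s) (β t)) (dir (β s) (β t) - dir (β a) (β b))
  have e1 : 3 / τ * (b - a) = 3 * ((b - a) / τ) := by ring
  have e2 : 2 * (b - a) / τ = 2 * ((b - a) / τ) := by ring
  rw [e1]; rw [e2] at h3
  linarith

theorem exists_tangent (h : UnitLoop τ ℓ β) :
    ∃ T : ℝ → E3, (∀ x, HasDerivAt β (T x) x) ∧ (∀ x, ‖T x‖ = 1) ∧
      ∀ x y, ‖T x - T y‖ ≤ 8 / τ * |x - y| := by
  have hpos := h.pos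
  choose T hT hTs using exists_hasDerivAt_of_slope (β := β) (C := 3 / τ) (w := τ / 4)
    (by positivity) (by positivity) h.norm_slope_sub_slope
  have hnorm : ∀ x, ‖T x‖ = 1 := by
    intro x
    have hq : ∀ y, x < y → y - x ≤ τ / 4 → |‖T x‖ - 1| ≤ 4 / τ * (y - x) := by
      intro y hxy hy
      have h1 := hTs x x y le_rfl hxy.le hxy hy
      have h2 := h.norm_slope_sub_dir hxy hy
      have hc := h.half_chord hxy.le hy
      have hne : β x ≠ β y := fun he => by
        rw [he, sub_self, norm_zero] at hc; linarith
      have h3 := abs_norm_sub_norm_le (T x) (dir (β x) (β y))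
      rw [norm_dir hne] at h3
      have h4 := norm_sub_le_norm_sub_add_norm_sub (T x) (slope β x y) (dir (β x) (β y))
      have h5 : 0 ≤ (y - x) / τ := div_nonneg (by linarith) hpos.le
      have e1 : 3 / τ * (y - x) = 3 * ((y - x) / τ) := by ring
      have e2 : 4 / τ * (y - x) = 4 * ((y - x) / τ) := by ring
      rw [e1] at h1; rw [e2]
      linarith
    have hlim : Tendsto (fun y => 4 / τ * (y - x)) (𝓝[>] x) (𝓝 0) := by
      have : Continuous fun y => 4 / τ * (y - x) := by fun_prop
      simpa using (this.tendsto x).mono_left nhdsWithin_le_nhds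
    have hle : |‖T x‖ - 1| ≤ 0 := ge_of_tendsto hlim (by
      filter_upwards [Ioc_mem_nhdsGT (show x < x + τ / 4 by linarith)] with y hy
      exact hq y hy.1 (by linarith [hy.2]))
    have := abs_nonpos_iff.1 hle
    linarith
  refine ⟨T, hT, hnorm, fun x y => ?_⟩
  wlog hxy : x ≤ y generalizing x y
  · rw [norm_sub_rev, abs_sub_comm]
    exact this y x (le_of_not_ge hxy)
  rcases hxy.eq_or_lt with rfl | hxy
  · simp
  rw [abs_sub_comm, abs_of_pos (by linarith)]
  by_cases hle : y - x ≤ τ / 4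
  · have h1 := hTs x x y le_rfl hxy.le hxy hle
    have h2 := hTs y x y hxy.le le_rfl hxy hle
    rw [norm_sub_rev] at h2
    have h3 := norm_sub_le_norm_sub_add_norm_sub (T x) (slope β x y) (T y)
    have h5 : 0 ≤ (y - x) / τ := div_nonneg (by linarith) hpos.le
    have e1 : 3 / τ * (y - x) = 3 * ((y - x) / τ) := by ring
    have e2 : 8 / τ * (y - x) = 8 * ((y - x) / τ) := by ring
    rw [e1] at h1 h2; rw [e2]
    linarith
  -- Beyond `τ / 4` the trivial bound 2 for unit vectors suffices, as `(8/τ)(τ/4) = 2`.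
  · have h1 := norm_sub_le (T x) (T y)
    rw [hnorm, hnorm] at h1
    have h2 : 8 / τ * (τ / 4) ≤ 8 / τ * (y - x) := by gcongr; exact (not_le.1 hle).le
    have e : 8 / τ * (τ / 4) = 2 := by field_simp; norm_num
    linarith

/-- Points far apart along the loop are far apart in space. -/
theorem far_chord (h : UnitLoop τ ℓ β) {s t : ℝ} (h1 : τ / 4 ≤ t - s) (h2 : t - s ≤ ℓ - τ / 4) :
    τ / 8 ≤ ‖β t - β s‖ := by
  have hpos := h.pos
  obtain ⟨T, hT, hT1, -⟩ := h.exists_tangent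
  obtain ⟨t₀, ht₀, hmin⟩ := isCompact_Icc.exists_isMinOn
    (⟨t, by constructor <;> linarith⟩ : (Icc (s + τ / 4) (s + ℓ - τ / 4)).Nonempty)
    ((h.continuous.sub continuous_const).norm.continuousOn (f := fun r => ‖β r - β s‖))
  have hle : ‖β t₀ - β s‖ ≤ ‖β t - β s‖ := hmin ⟨by linarith, by linarith⟩
  refine le_trans ?_ hle
  -- At either end of the range the short-arc estimate applies; an interior minimum is critical,
  -- hence at distance at least `2τ`.
  rcases ht₀.1.eq_or_lt with he | hlt
  · have := h.half_chord (x := s) (y := t₀) (by linarith) (by linarith)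
    linarith
  rcases ht₀.2.eq_or_lt with he | hlt'
  · have h3 := h.half_chord (x := s - τ / 4) (y := s) (by linarith) (by linarith)
    have h4 : β t₀ = β (s - τ / 4) := by
      rw [← h.periodic (s - τ / 4)]; congr 1; linarith
    rw [h4, norm_sub_rev]
    linarith
  · have hloc : IsLocalMin (fun r => ‖β r - β s‖) t₀ :=
      hmin.isLocalMin (Icc_mem_nhds hlt hlt')
    have hne : β s ≠ β t₀ := fun he => by
      have := injOn_Ico_of_periodic h.len_pos h.periodic h.injOn s
        ⟨le_rfl, by linarith⟩ ⟨by linarith, by linarith⟩ he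
      linarith
    have := le_norm_sub_of_critical (fun t' => h.thick t₀ s t') (hT t₀) (hT1 t₀) hne
      (inner_eq_zero_of_isLocalMin (hT t₀) hloc)
    rw [norm_sub_rev]
    linarith

/-- Quantitative injectivity with a constant depending on `τ` alone, so that it survives limits. The
cases are short arcs, the middle range, and arcs that nearly close up. -/
theorem chord_arc (h : UnitLoop τ ℓ β) {s t : ℝ} (hst : |s - t| ≤ 1 / 2) :
    τ / 8 * |s - t| ≤ ‖β (ℓ * s) - β (ℓ * t)‖ := by
  wlog hle : t ≤ s generalizing s t
  · rw [norm_sub_rev, abs_sub_comm]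
    exact this (by rwa [abs_sub_comm]) (le_of_not_ge hle)
  have hpos := h.pos
  have hl := h.lt_len
  have hlp := h.len_pos
  rw [abs_of_nonneg (by linarith)] at hst ⊢
  have e : ℓ * s - ℓ * t = ℓ * (s - t) := by ring
  by_cases hc : ℓ * (s - t) ≤ τ / 4
  · have h1 := h.half_chord (x := ℓ * t) (y := ℓ * s) (by gcongr) (by rw [e]; exact hc)
    rw [e] at h1
    nlinarith
  · by_cases hc2 : ℓ * (s - t) ≤ ℓ - τ / 4
    · have := h.far_chord (s := ℓ * t) (t := ℓ * s) (by linarith) (by linarith)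
      nlinarith
    · have h3 : β (ℓ * t + ℓ) = β (ℓ * t) := h.periodic _
      have h1 := h.half_chord (x := ℓ * s) (y := ℓ * t + ℓ) (by nlinarith) (by linarith)
      rw [h3, norm_sub_rev] at h1
      nlinarith

/-- Two disjoint thick loops are at distance at least `2τ`. -/
theorem two_mul_le_norm_sub (h : UnitLoop τ ℓ β) {x : E3} (hx : x ∉ range β)
    (hth : ∀ t t', TripleThick τ (β t) x (β t')) (t : ℝ) : 2 * τ ≤ ‖x - β t‖ := by
  obtain ⟨T, hT, hT1, -⟩ := h.exists_tangent
  obtain ⟨t₀, -, hmin⟩ := isCompact_Icc.exists_isMinOn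
    (nonempty_Icc.2 h.len_pos.le)
    ((h.continuous.sub continuous_const).norm.continuousOn (f := fun r => ‖β r - x‖))
  -- Periodicity makes the minimum over one period global, hence local even if `t₀` is an end of the
  -- period.
  have hglob : ∀ r, ‖β t₀ - x‖ ≤ ‖β r - x‖ := by
    intro r
    obtain ⟨y, hy, hry⟩ := h.periodic.exists_mem_Ico₀ h.len_pos r
    rw [hry]
    exact hmin ⟨hy.1, hy.2.le⟩
  have h1 := le_norm_sub_of_critical (hth t₀) (hT t₀) (hT1 t₀)
    (fun he => hx ⟨t₀, he.symm⟩)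
    (inner_eq_zero_of_isLocalMin (hT t₀) (Eventually.of_forall hglob))
  have := hglob t
  rw [norm_sub_rev, norm_sub_rev (β t)] at this
  linarith

theorem hasDerivAt_rescale {T : ℝ → E3} (hT : ∀ x, HasDerivAt β (T x) x) (t : ℝ) :
    HasDerivAt (fun t => β (ℓ * t)) (ℓ • T (ℓ * t)) t := by
  have := (hT (ℓ * t)).scomp t ((hasDerivAt_id t).const_mul ℓ)
  rw [mul_one] at this
  exact this

theorem isSimpleClosed_rescale (h : UnitLoop τ ℓ β) : IsSimpleClosed (fun t => β (ℓ * t)) where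
  continuous := h.continuous.comp (continuous_const.mul continuous_id)
  periodic t := by simp only [mul_add, mul_one]; exact h.periodic _
  injOn s hs t ht hst := by
    have hl := h.len_pos
    have hI : ∀ s ∈ Ico (0 : ℝ) 1, ℓ * s ∈ Ico 0 ℓ := fun s hs =>
      ⟨mul_nonneg hl.le hs.1, by nlinarith [hs.2]⟩
    exact mul_left_cancel₀ hl.ne' (h.injOn (hI s hs) (hI t ht) hst)

theorem range_rescale (h : UnitLoop τ ℓ β) : range (fun t => β (ℓ * t)) = range β := by
  ext p
  constructor
  · rintro ⟨t, rfl⟩; exact ⟨ℓ * t, rfl⟩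
  · rintro ⟨t, rfl⟩
    exact ⟨t / ℓ, by simp only; rw [mul_div_cancel₀ _ h.len_pos.ne']⟩

theorem isC11 (h : UnitLoop τ ℓ β) :
    IsConstantSpeedParam (range β) (fun t => β (ℓ * t)) ∧
    (∃ M : ℝ≥0, LipschitzWith M (deriv fun t => β (ℓ * t))) ∧
    HasBoundedCurvature (fun t => β (ℓ * t)) := by
  have hpos := h.pos
  have hl := h.len_pos
  obtain ⟨T, hT, hT1, hTL⟩ := h.exists_tangent
  have hderiv : (deriv fun t => β (ℓ * t)) = fun t => ℓ • T (ℓ * t) :=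
    funext fun t => (hasDerivAt_rescale hT t).deriv
  have hspeed : ∀ t, ‖ℓ • T (ℓ * t)‖ = ℓ := fun t => by
    rw [norm_smul, hT1, mul_one, Real.norm_of_nonneg hl.le]
  have hTlip : LipschitzWith (8 / τ * ℓ).toNNReal (fun t => T (ℓ * t)) := by
    refine LipschitzWith.of_dist_le_mul fun x y => ?_
    rw [dist_eq_norm, Real.coe_toNNReal _ (by positivity), Real.dist_eq]
    refine (hTL _ _).trans_eq ?_
    rw [← mul_sub, abs_mul, abs_of_pos hl]; ring
  have hlip : LipschitzWith (ℓ.toNNReal * (8 / τ * ℓ).toNNReal) (fun t => ℓ • T (ℓ * t)) := by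
    refine LipschitzWith.of_dist_le_mul fun x y => ?_
    rw [dist_smul₀, Real.norm_of_nonneg hl.le, NNReal.coe_mul, Real.coe_toNNReal _ hl.le, mul_assoc]
    exact mul_le_mul_of_nonneg_left (hTlip.dist_le_mul x y) hl.le
  refine ⟨⟨h.isSimpleClosed_rescale, h.range_rescale, ?_, ℓ, hl, fun t => by
    rw [hderiv]; exact hspeed t⟩, ⟨_, hderiv ▸ hlip⟩, ?_⟩
  · rw [contDiff_one_iff_deriv]
    exact ⟨fun t => (hasDerivAt_rescale hT t).differentiableAt, hderiv ▸ hlip.continuous⟩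
  · have hu : unitTangent (fun t => β (ℓ * t)) = fun t => T (ℓ * t) := by
      funext t
      rw [unitTangent, hderiv]
      simp only [hspeed]
      rw [inv_smul_smul₀ hl.ne']
    refine ⟨(8 / τ * ℓ).toNNReal / ℓ, ?_⟩
    rw [hu]
    filter_upwards [hTlip.ae_differentiableAt_real] with t ht
    refine ⟨ht, ?_⟩
    rw [curvature, hu, hderiv]
    simp only [hspeed]
    exact div_le_div_of_nonneg_right (norm_deriv_le_of_lipschitz hTlip) hl.le

end UnitLoop

/-! ### Limits of thick links -/

/-- Ultrafilter limits replace the extraction of subsequences: all points, velocities and lengths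
converge at once. -/
theorem exists_tendsto_of_bounded {E : Type*} [NormedAddCommGroup E] [ProperSpace E]
    (𝒰 : Ultrafilter ℕ) {u : ℕ → E} {R : ℝ} (h : ∀ k, ‖u k‖ ≤ R) :
    ∃ x, Tendsto u 𝒰 (𝓝 x) := by
  obtain ⟨x, -, hx⟩ := (isCompact_closedBall (0 : E) R).ultrafilter_le_nhds (𝒰.map u) (by
    rw [le_principal_iff, Ultrafilter.mem_coe, Ultrafilter.mem_map]
    exact univ_mem' fun k => by simpa using h k)
  exact ⟨x, hx⟩

theorem eventually_uniform_of_lipschitz (𝒰 : Ultrafilter ℕ) {F : ℕ → ℝ → E3} {G : ℝ → E3} {M : ℝ}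
    (hF : ∀ k s t, ‖F k s - F k t‖ ≤ M * |s - t|) (hG : ∀ t, Tendsto (F · t) 𝒰 (𝓝 (G t)))
    {K : Set ℝ} (hK : IsCompact K) {ε : ℝ} (hε : 0 < ε) :
    ∀ᶠ k in 𝒰, ∀ t ∈ K, ‖F k t - G t‖ ≤ ε := by
  have hM : 0 ≤ M := by
    have := (norm_nonneg _).trans (hF 0 1 0)
    simpa using this
  have hGL : ∀ s t, ‖G s - G t‖ ≤ M * |s - t| := fun s t =>
    le_of_tendsto ((hG s).sub (hG t)).norm (Eventually.of_forall fun k => hF k s t)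
  refine hK.induction_on (p := fun A => ∀ᶠ k in 𝒰, ∀ t ∈ A, ‖F k t - G t‖ ≤ ε) (by simp)
    (fun A B hAB hB => hB.mono fun k hk t ht => hk t (hAB ht))
    (fun A B hA hB => (hA.and hB).mono fun k hk t ht => ht.elim (hk.1 t) (hk.2 t)) ?_
  intro t₀ _
  set r := ε / (3 * (M + 1))
  have hr : 0 < r := by positivity
  have hMr : M * r ≤ ε / 3 := by
    have : (M + 1) * r = ε / 3 := by simp only [r]; field_simp
    nlinarith
  refine ⟨Metric.ball t₀ r, mem_nhdsWithin_of_mem_nhds (Metric.ball_mem_nhds t₀ hr), ?_⟩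
  have h0 := (tendsto_iff_norm_sub_tendsto_zero.1 (hG t₀)).eventually
    (gt_mem_nhds (show (0 : ℝ) < ε / 3 by positivity))
  filter_upwards [h0] with k hk t ht
  rw [Metric.mem_ball, Real.dist_eq] at ht
  have h1 : M * |t - t₀| ≤ ε / 3 := (mul_le_mul_of_nonneg_left ht.le hM).trans hMr
  have h2 := hF k t t₀
  have h3 := hGL t₀ t
  rw [abs_sub_comm] at h3
  have e : F k t - G t = (F k t - F k t₀) + (F k t₀ - G t₀) + (G t₀ - G t) := by abel
  rw [e]
  have h4 := norm_add₃_le (a := F k t - F k t₀) (b := F k t₀ - G t₀) (c := G t₀ - G t)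
  linarith

/-- C¹ closeness without differentiating the limit: the mean value inequality is applied to `γ m - γ
k`, and then `m` goes to the limit. -/
theorem eventually_lipschitz_of_deriv (𝒰 : Ultrafilter ℕ) {γ V : ℕ → ℝ → E3} {γ' V' : ℝ → E3}
    {M : ℝ} (hder : ∀ k t, HasDerivAt (γ k) (V k t) t)
    (hV : ∀ k s t, ‖V k s - V k t‖ ≤ M * |s - t|) (hV' : ∀ t, Tendsto (V · t) 𝒰 (𝓝 (V' t)))
    (hγ' : ∀ t, Tendsto (γ · t) 𝒰 (𝓝 (γ' t))) (a b : ℝ) {ε : ℝ} (hε : 0 < ε) :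
    ∀ᶠ k in 𝒰, ∀ s ∈ Icc a b, ∀ t ∈ Icc a b,
      ‖(γ' s - γ k s) - (γ' t - γ k t)‖ ≤ ε * |s - t| := by
  have hu := eventually_uniform_of_lipschitz 𝒰 hV hV' (isCompact_Icc (a := a) (b := b))
    (half_pos hε)
  filter_upwards [hu] with k hk s hs t ht
  refine le_of_tendsto ((((hγ' s).sub_const (γ k s)).sub ((hγ' t).sub_const (γ k t))).norm) ?_
  filter_upwards [hu] with m hm
  have := (convex_Icc a b).norm_image_sub_le_of_norm_hasDerivWithin_le
    (f := fun x => γ m x - γ k x) (f' := fun x => V m x - V k x) (C := ε)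
    (fun x _ => ((hder m x).sub (hder k x)).hasDerivWithinAt) (fun x hx => by
      have e : V m x - V k x = (V m x - V' x) - (V k x - V' x) := by abel
      rw [e]
      linarith [norm_sub_le (V m x - V' x) (V k x - V' x), hm x hx, hk x hx]) ht hs
  simpa [Real.norm_eq_abs] using this

/-- `p` need not be injective: the hypothesis forces `Δ i = Δ j` whenever `p i = p j`. -/
theorem exists_lipschitzWith_extension {ι : Type*} {K : ℝ≥0} (p Δ : ι → E3)
    (h : ∀ i j, ‖Δ i - Δ j‖ ≤ K * ‖p i - p j‖) :
    ∃ u : E3 → E3, LipschitzWith (lipschitzExtensionConstant E3 * K) u ∧ ∀ i, u (p i) = Δ i := by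
  classical
  have hc : ∀ q : range p, ∃ i, p i = q := fun q => q.2
  choose r hr using hc
  let f : E3 → E3 := fun q => if hq : q ∈ range p then Δ (r ⟨q, hq⟩) else 0
  have hf : ∀ i, f (p i) = Δ i := by
    intro i
    have hq : p i ∈ range p := ⟨i, rfl⟩
    simp only [f, hq, dif_pos]
    have h1 := h (r ⟨p i, hq⟩) i
    rw [hr, sub_self, norm_zero, mul_zero] at h1
    exact sub_eq_zero.1 (norm_le_zero_iff.1 h1)
  have hL : LipschitzOnWith K f (range p) := by
    refine LipschitzOnWith.of_dist_le_mul ?_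
    rintro _ ⟨i, rfl⟩ _ ⟨j, rfl⟩
    rw [hf, hf, dist_eq_norm, dist_eq_norm]
    exact h i j
  obtain ⟨u, hu, he⟩ := hL.extend_finite_dimension
  exact ⟨u, hu, fun i => (he ⟨i, rfl⟩).symm.trans (hf i)⟩

theorem eVariationOn_le_of_lipschitz {γ : ℝ → E3} {m : ℝ} (hm : 0 ≤ m)
    (h : ∀ s t, ‖γ s - γ t‖ ≤ m * |s - t|) : eVariationOn γ (Icc 0 1) ≤ ENNReal.ofReal m := by
  have hL : LipschitzOnWith m.toNNReal γ (Icc 0 1) := LipschitzOnWith.of_dist_le_mul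
    fun s _ t _ => by
      rw [dist_eq_norm, Real.dist_eq, Real.coe_toNNReal _ hm]; exact h s t
  have h1 := hL.comp_eVariationOn_le (g := id) (s := Icc (0 : ℝ) 1) (fun x hx => hx)
  rw [eVariationOn_id_Icc] at h1
  simpa [ENNReal.ofReal] using h1

/-- The hypotheses are closed inequalities and pass to the limit. For the isotopy, the displacement
from `γ k` to the limit is shown to be Lipschitz with small constant for the distance in space, not
merely for the parameter. -/
theorem exists_limit_link {n : ℕ} (𝒰 : Ultrafilter ℕ) {γ V : ℕ → Fin n → ℝ → E3}
    {ℓ : ℕ → Fin n → ℝ} {Λ M R c : ℝ} (hc : 0 < c) (hper : ∀ k i, Function.Periodic (γ k i) 1)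
    (hder : ∀ k i t, HasDerivAt (γ k i) (V k i t) t) (hV : ∀ k i t, ‖V k i t‖ ≤ ℓ k i)
    (hℓ : ∀ k i, ℓ k i ≤ Λ) (hVL : ∀ k i s t, ‖V k i s - V k i t‖ ≤ M * |s - t|)
    (hR : ∀ k i, ‖γ k i 0‖ ≤ R)
    (hchord : ∀ k i s t, |s - t| ≤ 1 / 2 → c * |s - t| ≤ ‖γ k i s - γ k i t‖)
    (hsep : ∀ k i j, i ≠ j → ∀ s t, 2 ≤ ‖γ k i s - γ k j t‖)
    (hth : ∀ k, ThickSet 1 (⋃ i, range (γ k i))) :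
    ∃ L : Link n, ThickSet 1 L.carrier ∧
      (∃ m : Fin n → ℝ, (∀ i, Tendsto (ℓ · i) 𝒰 (𝓝 (m i))) ∧
        L.length ≤ ENNReal.ofReal (∑ i, m i)) ∧
      ∀ᶠ k in 𝒰, AmbientIsotopic (⋃ i, range (γ k i)) L.carrier := by
  have hℓ0 : ∀ k i, 0 ≤ ℓ k i := fun k i => (norm_nonneg _).trans (hV k i 0)
  have hγL : ∀ k i s t, ‖γ k i s - γ k i t‖ ≤ ℓ k i * |s - t| := by
    intro k i s t
    have := convex_univ.norm_image_sub_le_of_norm_hasDerivWithin_le (f := γ k i) (C := ℓ k i)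
      (fun x _ => (hder k i x).hasDerivWithinAt) (fun x _ => hV k i x) (mem_univ t) (mem_univ s)
    simpa [Real.norm_eq_abs] using this
  have hγΛ : ∀ i k s t, ‖γ k i s - γ k i t‖ ≤ Λ * |s - t| := fun i k s t =>
    (hγL k i s t).trans (mul_le_mul_of_nonneg_right (hℓ k i) (abs_nonneg _))
  choose m hm using fun i => exists_tendsto_of_bounded 𝒰 (u := fun k => ℓ k i) (R := Λ) fun k => by
    rw [Real.norm_of_nonneg (hℓ0 k i)]; exact hℓ k i
  choose V' hV' using fun i t => exists_tendsto_of_bounded 𝒰 (u := fun k => V k i t) (R := Λ)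
    fun k => (hV k i t).trans (hℓ k i)
  choose γ' hγ' using fun i t => exists_tendsto_of_bounded 𝒰 (u := fun k => γ k i t)
    (R := Λ * |t - 0| + R) fun k => by
      have h1 := norm_le_norm_sub_add (γ k i t) (γ k i 0)
      linarith [hγΛ i k t 0, hR k i]
  have hm0 : ∀ i, 0 ≤ m i := fun i => ge_of_tendsto' (hm i) fun k => hℓ0 k i
  have hper' : ∀ i, Function.Periodic (γ' i) 1 := fun i t =>
    tendsto_nhds_unique (hγ' i (t + 1)) ((hγ' i t).congr fun k => (hper k i t).symm)
  have hγL' : ∀ i s t, ‖γ' i s - γ' i t‖ ≤ m i * |s - t| := fun i s t =>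
    le_of_tendsto_of_tendsto' ((hγ' i s).sub (hγ' i t)).norm ((hm i).mul_const _)
      fun k => hγL k i s t
  have hchord' : ∀ i s t, |s - t| ≤ 1 / 2 → c * |s - t| ≤ ‖γ' i s - γ' i t‖ := fun i s t h =>
    ge_of_tendsto' ((hγ' i s).sub (hγ' i t)).norm fun k => hchord k i s t h
  have hsep' : ∀ i j, i ≠ j → ∀ s t, 2 ≤ ‖γ' i s - γ' j t‖ := fun i j h s t =>
    ge_of_tendsto' ((hγ' i s).sub (hγ' j t)).norm fun k => hsep k i j h s t
  have hsimple : ∀ i, IsSimpleClosed (γ' i) := fun i =>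
    { continuous := (LipschitzWith.of_dist_le_mul (K := (m i).toNNReal) fun s t => by
        rw [dist_eq_norm, Real.dist_eq, Real.coe_toNNReal _ (hm0 i)]
        exact hγL' i s t).continuous
      periodic := hper' i
      injOn := by
        have hlt : ∀ s ∈ Ico (0 : ℝ) 1, ∀ t ∈ Ico (0 : ℝ) 1, γ' i s = γ' i t → s ≤ t → s = t := by
          intro s hs t ht he hst
          by_cases h : t - s ≤ 1 / 2
          · have h1 := hchord' i s t (by rw [abs_sub_comm, abs_of_nonneg] <;> linarith)
            rw [he, sub_self, norm_zero] at h1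
            have h2 : |s - t| = 0 :=
              le_antisymm (nonpos_of_mul_nonpos_right h1 hc) (abs_nonneg _)
            exact sub_eq_zero.1 (abs_eq_zero.1 h2)
          -- Parameters more than half a period apart are compared across the period.
          · have h0 : |s + 1 - t| = s + 1 - t := abs_of_nonneg (by linarith [ht.2, hs.1])
            have h1 := hchord' i (s + 1) t (by rw [h0]; linarith)
            rw [hper' i s, he, sub_self, norm_zero, h0] at h1
            have := nonpos_of_mul_nonpos_right h1 hc
            linarith [ht.2, hs.1]
        intro s hs t ht he
        rcases le_total s t with h | h
        · exact hlt s hs t ht he h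
        · exact (hlt t ht s hs he.symm h).symm }
  let L : Link n :=
    { curve := γ'
      simple := hsimple
      disjoint := fun i j hij => by
        rw [Set.disjoint_left]
        rintro _ ⟨s, rfl⟩ ⟨t, ht⟩
        have := hsep' i j hij s t
        rw [ht, sub_self, norm_zero] at this
        linarith }
  have hcar : L.carrier = ⋃ i, range (γ' i) := rfl
  refine ⟨L, ?_, ⟨m, hm, ?_⟩, ?_⟩
  · rw [hcar]
    intro x hx y hy z hz
    obtain ⟨i, s, rfl⟩ := mem_iUnion.1 hx
    obtain ⟨j, t, rfl⟩ := mem_iUnion.1 hy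
    obtain ⟨l, r, rfl⟩ := mem_iUnion.1 hz
    exact TripleThick.of_tendsto (hγ' i s) (hγ' j t) (hγ' l r) fun k =>
      hth k _ (mem_iUnion.2 ⟨i, s, rfl⟩) _ (mem_iUnion.2 ⟨j, t, rfl⟩) _
        (mem_iUnion.2 ⟨l, r, rfl⟩)
  · rw [ENNReal.ofReal_sum_of_nonneg fun i _ => hm0 i]
    exact Finset.sum_le_sum fun i _ => eVariationOn_le_of_lipschitz (hm0 i) (hγL' i)
  -- Extension to space costs a factor `lipschitzExtensionConstant E3`; with this `K` it remains a
  -- contraction.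
  · set K : ℝ≥0 := (2 * (lipschitzExtensionConstant E3 + 1))⁻¹ with hK
    have hKpos : 0 < K := by positivity
    have hK1 : lipschitzExtensionConstant E3 * K < 1 := by
      rw [hK, ← div_eq_mul_inv, div_lt_one (by positivity)]
      have : lipschitzExtensionConstant E3 < lipschitzExtensionConstant E3 + 1 :=
        lt_add_of_pos_right _ one_pos
      refine this.trans_le (le_mul_of_one_le_left (by positivity) one_le_two)
    have hKr : (0 : ℝ) < K := by exact_mod_cast hKpos
    have hU := eventually_all.2 fun i => eventually_uniform_of_lipschitz 𝒰 (hγΛ i) (hγ' i)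
      (isCompact_Icc (a := (0 : ℝ)) (b := 1)) hKr
    -- The window holds the representatives `s₀ ∈ [0, 1)` and `t₀` within `1/2` of it; the factor
    -- `c` is absorbed by the chord-arc bound.
    have hD := eventually_all.2 fun i => eventually_lipschitz_of_deriv 𝒰 (fun k => hder k i)
      (fun k => hVL k i) (hV' i) (hγ' i) (-1) 2 (mul_pos hKr hc)
    filter_upwards [hU, hD] with k hUk hDk
    have hshift : ∀ i t (z : ℤ), γ' i (t - z) - γ k i (t - z) = γ' i t - γ k i t := by
      intro i t z
      have h1 := (hper' i).sub_int_mul_eq z (x := t)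
      have h2 := (hper k i).sub_int_mul_eq z (x := t)
      rw [mul_one] at h1 h2
      rw [h1, h2]
    have hshiftk : ∀ i t (z : ℤ), γ k i (t - z) = γ k i t := by
      intro i t z
      simpa using (hper k i).sub_int_mul_eq z (x := t)
    have hsmall : ∀ i t, ‖γ' i t - γ k i t‖ ≤ K := by
      intro i t
      rw [← hshift i t ⌊t⌋, norm_sub_rev]
      exact hUk i _ ⟨by linarith [Int.floor_le t], by linarith [Int.lt_floor_add_one t]⟩
    obtain ⟨u, hu, hup⟩ := exists_lipschitzWith_extension (K := K)
      (fun q : Fin n × ℝ => γ k q.1 q.2) (fun q => γ' q.1 q.2 - γ k q.1 q.2) (by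
        rintro ⟨i, s⟩ ⟨j, t⟩
        simp only
        by_cases hij : i = j
        · subst hij
          set s₀ := s - (⌊s⌋ : ℤ) with hs₀
          set t₀ := t - (round (t - s₀) : ℤ) with ht₀
          have hs1 : 0 ≤ s₀ := by linarith [Int.floor_le s]
          have hs2 : s₀ < 1 := by linarith [Int.lt_floor_add_one s]
          have hst : |s₀ - t₀| ≤ 1 / 2 := by
            rw [abs_sub_comm, ht₀, sub_right_comm]
            exact abs_sub_round _
          have hab := abs_le.1 hst
          rw [← hshift i s ⌊s⌋, ← hshift i t (round (t - s₀)), ← hshiftk i s ⌊s⌋,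
            ← hshiftk i t (round (t - s₀)), ← hs₀, ← ht₀]
          have h1 := hDk i s₀ ⟨by linarith, by linarith⟩ t₀ ⟨by linarith, by linarith⟩
          have h2 := mul_le_mul_of_nonneg_left (hchord k i s₀ t₀ hst) hKr.le
          linarith
        -- On different components each displacement is at most `K`, and the points are at least 2
        -- apart.
        · have h1 := norm_sub_le (γ' i s - γ k i s) (γ' j t - γ k j t)
          have h2 := mul_le_mul_of_nonneg_left (hsep k i j hij s t) hKr.le
          linarith [hsmall i s, hsmall j t])
    have hiso := ambientIsotopic_of_lipschitz hK1 hu (⋃ i, range (γ k i))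
    convert hiso using 1
    rw [hcar, image_iUnion]
    refine iUnion_congr fun i => ?_
    rw [← range_comp]
    congr 1
    funext t
    have := hup (i, t)
    simp only at this
    simp [this]

/-! ### Bringing distant parts of a link together -/

/-- The image of a link under a continuous injective map. -/
def Link.map {n : ℕ} (L : Link n) (F : E3 → E3) (hc : Continuous F)
    (hi : Function.Injective F) : Link n where
  curve i t := F (L.curve i t)
  simple i :=
    { continuous := hc.comp (L.simple i).continuous
      periodic := fun t => congrArg F ((L.simple i).periodic t)
      injOn := fun s hs t ht h => (L.simple i).injOn hs ht (hi h) }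
  disjoint i j hij := by
    rw [Set.disjoint_left]
    rintro _ ⟨s, rfl⟩ ⟨t, ht⟩
    exact Set.disjoint_left.1 (L.disjoint i j hij) ⟨s, rfl⟩ ⟨t, hi ht⟩

theorem Link.carrier_map {n : ℕ} (L : Link n) (F : E3 → E3) (hc : Continuous F)
    (hi : Function.Injective F) : (L.map F hc hi).carrier = F '' L.carrier := by
  unfold Link.carrier
  rw [image_iUnion]
  exact iUnion_congr fun i => range_comp F (L.curve i)

theorem Link.length_map_le {n : ℕ} (L : Link n) (F : E3 → E3) (hc : Continuous F)
    (hi : Function.Injective F) {C : ℝ≥0} (hF : LipschitzWith C F) (i : Fin n) :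
    eVariationOn ((L.map F hc hi).curve i) (Icc 0 1) ≤ C * eVariationOn (L.curve i) (Icc 0 1) :=
  (hF.lipschitzOnWith (s := univ)).comp_eVariationOn_le (fun _ _ => mem_univ _)

theorem Link.isCompact_range {n : ℕ} (L : Link n) (i : Fin n) : IsCompact (range (L.curve i)) := by
  have : range (L.curve i) = L.curve i '' Icc 0 1 := by
    refine subset_antisymm ?_ (image_subset_range _ _)
    rintro _ ⟨t, rfl⟩
    obtain ⟨y, hy, he⟩ := (L.simple i).periodic.exists_mem_Ico₀ one_pos t
    exact ⟨y, ⟨hy.1, hy.2.le⟩, he.symm⟩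
  rw [this]
  exact isCompact_Icc.image (L.simple i).continuous

theorem Link.isCompact_carrier {n : ℕ} (L : Link n) : IsCompact L.carrier :=
  isCompact_iUnion fun i => L.isCompact_range i

/-! ### Compressing a coordinate axis outside a set of finite measure -/

/-- The signed measure of the part of `U` between `0` and `x`. -/
noncomputable def fillLength (U : Set ℝ) (x : ℝ) : ℝ := ∫ t in (0 : ℝ)..x, U.indicator 1 t

section fillLength

variable {U : Set ℝ}

theorem intervalIntegrable_indicator_one (hU : MeasurableSet U) (a b : ℝ) :
    IntervalIntegrable (U.indicator (1 : ℝ → ℝ)) volume a b := by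
  rw [intervalIntegrable_iff]
  exact (integrableOn_const (C := (1 : ℝ)) (by simp)).indicator hU

theorem fillLength_sub (hU : MeasurableSet U) (x y : ℝ) :
    fillLength U y - fillLength U x = ∫ t in x..y, U.indicator (1 : ℝ → ℝ) t :=
  intervalIntegral.integral_interval_sub_left (intervalIntegrable_indicator_one hU _ _)
    (intervalIntegrable_indicator_one hU _ _)

theorem fillLength_mono (hU : MeasurableSet U) {x y : ℝ} (h : x ≤ y) :
    fillLength U x ≤ fillLength U y := by
  rw [← sub_nonneg, fillLength_sub hU]
  exact intervalIntegral.integral_nonneg h fun t _ =>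
    indicator_nonneg (fun _ _ => zero_le_one) t

theorem fillLength_sub_le (hU : MeasurableSet U) {x y : ℝ} (h : x ≤ y) :
    fillLength U y - fillLength U x ≤ y - x := by
  rw [fillLength_sub hU]
  have := intervalIntegral.integral_mono_on (μ := volume) h
    (intervalIntegrable_indicator_one hU x y)
    (intervalIntegrable_const (c := (1 : ℝ))) fun t _ =>
      indicator_le_self' (fun _ _ => zero_le_one) t
  simpa using this

theorem fillLength_sub_of_subset (hU : MeasurableSet U) {x y : ℝ} (h : x ≤ y)
    (hI : Icc x y ⊆ U) : fillLength U y - fillLength U x = y - x := by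
  rw [fillLength_sub hU, intervalIntegral.integral_congr (g := fun _ => (1 : ℝ))]
  · simp
  · intro t ht
    rw [uIcc_of_le h] at ht
    simp [hI ht]

theorem abs_fillLength_le (hU : MeasurableSet U) (hfin : volume U ≠ ⊤) (x : ℝ) :
    |fillLength U x| ≤ volume.real U := by
  have hint : Integrable (U.indicator (1 : ℝ → ℝ)) :=
    (integrableOn_const (C := (1 : ℝ)) hfin).integrable_indicator hU
  have h1 := intervalIntegral.norm_integral_le_integral_norm_uIoc (μ := volume) (a := 0) (b := x)
    (f := U.indicator (1 : ℝ → ℝ))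
  have h2 : ∀ t, ‖U.indicator (1 : ℝ → ℝ) t‖ = U.indicator 1 t := fun t =>
    Real.norm_of_nonneg (indicator_nonneg (fun _ _ => zero_le_one) t)
  simp only [h2] at h1
  refine h1.trans ?_
  rw [← integral_indicator_one hU]
  exact setIntegral_le_integral hint
    (Eventually.of_forall fun t => indicator_nonneg (fun _ _ => zero_le_one) t)

end fillLength

theorem EuclideanSpace.norm_le_norm_of_abs_le {v w : E3} (h : ∀ i, |v i| ≤ |w i|) : ‖v‖ ≤ ‖w‖ := by
  rw [EuclideanSpace.norm_eq, EuclideanSpace.norm_eq]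
  refine Real.sqrt_le_sqrt (Finset.sum_le_sum fun i _ => ?_)
  rw [Real.norm_eq_abs, Real.norm_eq_abs]
  have := h i
  gcongr

theorem norm_curve_sub_le {n : ℕ} (L : Link n) {Λ : ℝ} (i : Fin n)
    (hΛ : eVariationOn (L.curve i) (Icc 0 1) ≤ ENNReal.ofReal Λ) (hΛ0 : 0 ≤ Λ) (t : ℝ) :
    ‖L.curve i t - L.curve i 0‖ ≤ Λ := by
  obtain ⟨y, hy, he⟩ := (L.simple i).periodic.exists_mem_Ico₀ one_pos t
  rw [he]
  have h1 := (eVariationOn.edist_le (L.curve i) (s := Icc (0 : ℝ) 1) (x := y) (y := 0)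
    ⟨hy.1, hy.2.le⟩ ⟨le_rfl, zero_le_one⟩).trans hΛ
  rwa [edist_dist, dist_eq_norm, ENNReal.ofReal_le_ofReal_iff hΛ0] at h1

/-- The `j`-th coordinate is mapped by `φ`, of slope 1 on the slabs `U` around the components and of
small slope elsewhere. This expands no distance, and two points of the link either keep their
difference vector or remain 2 apart. -/
theorem exists_coordinate_bounded {n : ℕ} (j : Fin 3) (L : Link n) {Λ : ℝ} (hΛ0 : 0 ≤ Λ)
    (hΛ : ∀ i, eVariationOn (L.curve i) (Icc 0 1) ≤ ENNReal.ofReal Λ)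
    (hth : ThickSet 1 L.carrier) :
    ∃ L' : Link n, AmbientIsotopic L.carrier L'.carrier ∧ ThickSet 1 L'.carrier ∧
      (∀ i, eVariationOn (L'.curve i) (Icc 0 1) ≤ eVariationOn (L.curve i) (Icc 0 1)) ∧
      (∀ i t, |L'.curve i t j| ≤ 1 + 2 * (Λ + 1) * n) ∧
      ∀ i t, ∀ k ≠ j, L'.curve i t k = L.curve i t k := by
  obtain ⟨B, hB⟩ := L.isCompact_carrier.isBounded.exists_norm_le
  -- A positive slope off `U` keeps the map a homeomorphism; this size makes `δ * x` at most 1 in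
  -- absolute value on the link.
  set δ : ℝ := 1 / (|B| + 2) with hδ
  have hδ0 : 0 < δ := by positivity
  have hδ1 : δ < 1 := by
    rw [hδ, div_lt_one (by positivity)]
    linarith [abs_nonneg B]
  -- A component stays within `Λ` of its base point; the extra 1 is a margin that `φ` does not
  -- compress.
  set U : Set ℝ := ⋃ i, Icc (L.curve i 0 j - (Λ + 1)) (L.curve i 0 j + (Λ + 1)) with hUdef
  have hU : MeasurableSet U := MeasurableSet.iUnion fun i => measurableSet_Icc
  have hvol : volume U ≤ ENNReal.ofReal (2 * (Λ + 1) * n) := by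
    refine (measure_iUnion_fintype_le _ _).trans ?_
    simp only [Real.volume_Icc]
    have e : ∀ i, L.curve i 0 j + (Λ + 1) - (L.curve i 0 j - (Λ + 1)) = 2 * (Λ + 1) := fun i => by
      ring
    simp only [e, Finset.sum_const, Finset.card_univ, Fintype.card_fin, nsmul_eq_mul]
    rw [ENNReal.ofReal_mul (p := 2 * (Λ + 1)) (by positivity), ENNReal.ofReal_natCast, mul_comm]
  have hfin : volume U ≠ ⊤ := ne_top_of_le_ne_top ENNReal.ofReal_ne_top hvol
  set φ : ℝ → ℝ := fun x => δ * x + (1 - δ) * fillLength U x with hφ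
  have hφle : ∀ x y, |(φ x - x) - (φ y - y)| ≤ (1 - δ) * |x - y| := by
    intro x y
    wlog hxy : y ≤ x generalizing x y
    · rw [abs_sub_comm, abs_sub_comm x]
      exact this y x (le_of_not_ge hxy)
    have h1 := fillLength_mono hU hxy
    have h2 := fillLength_sub_le hU hxy
    rw [abs_of_nonneg (sub_nonneg.2 hxy), abs_le]
    constructor <;> simp only [hφ] <;> nlinarith
  have hφ1 : ∀ x y, |φ x - φ y| ≤ |x - y| := by
    intro x y
    wlog hxy : y ≤ x generalizing x y
    · rw [abs_sub_comm, abs_sub_comm x]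
      exact this y x (le_of_not_ge hxy)
    have h1 := fillLength_mono hU hxy
    have h2 := fillLength_sub_le hU hxy
    rw [abs_of_nonneg (sub_nonneg.2 hxy), abs_le]
    constructor <;> simp only [hφ] <;> nlinarith
  set u : E3 → E3 := fun p => EuclideanSpace.single j (φ (p j) - p j) with hu
  have huL : LipschitzWith (1 - δ).toNNReal u := by
    refine LipschitzWith.of_dist_le_mul fun p q => ?_
    rw [Real.coe_toNNReal _ (by linarith)]
    simp only [hu]
    rw [PiLp.dist_single_same, Real.dist_eq]
    refine (hφle _ _).trans (mul_le_mul_of_nonneg_left ?_ (by linarith))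
    rw [dist_eq_norm]
    exact PiLp.norm_apply_le (p - q) j
  obtain ⟨H, hc, hs, h0, h1⟩ := exists_isotopy_id_add
    (show (1 - δ).toNNReal < 1 by rw [Real.toNNReal_lt_one]; linarith) huL
  have hFj : ∀ p, H 1 p j = φ (p j) := fun p => by simp [h1, hu]
  have hFk : ∀ p, ∀ k ≠ j, H 1 p k = p k := fun p k hk => by simp [h1, hu, hk]
  have hFL : LipschitzWith 1 (H 1) := by
    refine LipschitzWith.of_dist_le_mul fun p q => ?_
    rw [NNReal.coe_one, one_mul, dist_eq_norm, dist_eq_norm]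
    refine EuclideanSpace.norm_le_norm_of_abs_le fun k => ?_
    by_cases hk : k = j
    · subst hk
      simpa [hFj] using hφ1 (p k) (q k)
    · simp [hFk _ k hk]
  have hmargin : ∀ i t, Icc (L.curve i t j - 1) (L.curve i t j + 1) ⊆ U := by
    intro i t x hx
    have h2 := norm_curve_sub_le L i (hΛ i) hΛ0 t
    have h3 := abs_le.1 ((PiLp.norm_apply_le (L.curve i t - L.curve i 0) j).trans h2)
    simp only [PiLp.sub_apply] at h3
    exact mem_iUnion.2 ⟨i, by constructor <;> linarith [hx.1, hx.2, h3.1, h3.2]⟩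
  have hordered : ∀ i s i' t, L.curve i s j ≤ L.curve i' t j →
      H 1 (L.curve i' t) - H 1 (L.curve i s) = L.curve i' t - L.curve i s ∨
        2 ≤ ‖H 1 (L.curve i' t) - H 1 (L.curve i s)‖ := by
    intro i s i' t hle
    set x := L.curve i s j with hx
    set y := L.curve i' t j with hy
    by_cases hsub : Icc x y ⊆ U
    · left
      have h2 := fillLength_sub_of_subset hU hle hsub
      ext k
      by_cases hk : k = j
      · subst hk
        simp only [PiLp.sub_apply, hFj, ← hx, ← hy, hφ]
        linear_combination (1 - δ) * h2
      · simp [hFk _ k hk]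
    · right
      -- A gap between the two points leaves a full unit margin on either side, so the image
      -- coordinates differ by at least 2.
      obtain ⟨z, hz, hzU⟩ := not_subset.1 hsub
      have hz1 : x + 1 < z := by
        by_contra hcon
        exact hzU (hmargin i s ⟨by linarith [hz.1], not_lt.1 hcon⟩)
      have hz2 : z < y - 1 := by
        by_contra hcon
        exact hzU (hmargin i' t ⟨not_lt.1 hcon, by linarith [hz.2]⟩)
      have f1 := fillLength_sub_of_subset hU (show x ≤ x + 1 by linarith)
        ((Icc_subset_Icc_left (by linarith)).trans (hmargin i s))
      have f2 := fillLength_mono hU (show x + 1 ≤ y - 1 by linarith)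
      have f3 := fillLength_sub_of_subset hU (show y - 1 ≤ y by linarith)
        ((Icc_subset_Icc_right (by linarith)).trans (hmargin i' t))
      have h2 := PiLp.norm_apply_le (H 1 (L.curve i' t) - H 1 (L.curve i s)) j
      rw [PiLp.sub_apply, hFj, hFj, ← hx, ← hy, Real.norm_eq_abs] at h2
      refine le_trans ?_ ((le_abs_self _).trans h2)
      simp only [hφ]
      nlinarith
  have hpair : ∀ p ∈ L.carrier, ∀ q ∈ L.carrier,
      H 1 q - H 1 p = q - p ∨ 2 ≤ ‖H 1 q - H 1 p‖ := by
    intro p hp q hq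
    obtain ⟨i, s, rfl⟩ := mem_iUnion.1 hp
    obtain ⟨i', t, rfl⟩ := mem_iUnion.1 hq
    rcases le_total (L.curve i s j) (L.curve i' t j) with h | h
    · exact hordered i s i' t h
    · rcases hordered i' t i s h with h2 | h2
      · left
        rw [← neg_sub, h2, neg_sub]
      · right
        rwa [norm_sub_rev]
  refine ⟨L.map (H 1) (H 1).continuous (H 1).injective, ⟨H, hc, hs, h0, ?_⟩, ?_, fun i => ?_,
    fun i t => ?_, fun i t k hk => hFk _ k hk⟩
  · rw [Link.carrier_map]
  · rw [Link.carrier_map]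
    rintro _ ⟨x, hx, rfl⟩ _ ⟨y, hy, rfl⟩ _ ⟨z, hz, rfl⟩
    -- Either both difference vectors from `x` are unchanged and the triple is only translated, or a
    -- side is at least 2.
    rcases hpair x hx y hy with hxy | hxy
    · rcases hpair x hx z hz with hxz | hxz
      · exact tripleThick_congr hxy hxz (hth x hx y hy z hz)
      · exact tripleThick_of_far_right zero_le_one (by linarith)
    · exact tripleThick_of_far_left zero_le_one (by linarith)
  · simpa using L.length_map_le (H 1) (H 1).continuous (H 1).injective hFL i
  · change |H 1 (L.curve i t) j| ≤ _
    rw [hFj]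
    set x := L.curve i t j with hx
    have h2 : |x| ≤ |B| := ((PiLp.norm_apply_le (L.curve i t) j).trans
      (hB _ (mem_iUnion.2 ⟨i, t, rfl⟩))).trans (le_abs_self B)
    have h3 : |fillLength U x| ≤ 2 * (Λ + 1) * n :=
      (abs_fillLength_le hU hfin x).trans (ENNReal.toReal_le_of_le_ofReal (by positivity) hvol)
    have h4 : δ * |x| ≤ 1 := by
      rw [hδ, one_div, inv_mul_le_iff₀ (by positivity)]
      linarith
    have h5 : (1 - δ) * |fillLength U x| ≤ |fillLength U x| :=
      mul_le_of_le_one_left (abs_nonneg _) (by linarith)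
    have h6 := abs_add_le (δ * x) ((1 - δ) * fillLength U x)
    rw [abs_mul, abs_mul, abs_of_pos hδ0, abs_of_pos (show 0 < 1 - δ by linarith)] at h6
    simp only [hφ]
    linarith

theorem exists_bounded {n : ℕ} (L : Link n) {Λ : ℝ} (hΛ0 : 0 ≤ Λ)
    (hΛ : ∀ i, eVariationOn (L.curve i) (Icc 0 1) ≤ ENNReal.ofReal Λ)
    (hth : ThickSet 1 L.carrier) :
    ∃ L' : Link n, AmbientIsotopic L.carrier L'.carrier ∧ ThickSet 1 L'.carrier ∧
      (∀ i, eVariationOn (L'.curve i) (Icc 0 1) ≤ eVariationOn (L.curve i) (Icc 0 1)) ∧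
      ∀ i t, ‖L'.curve i t‖ ≤ 2 * (1 + 2 * (Λ + 1) * n) := by
  obtain ⟨L₁, i₁, t₁, l₁, b₁, -⟩ := exists_coordinate_bounded 0 L hΛ0 hΛ hth
  obtain ⟨L₂, i₂, t₂, l₂, b₂, e₂⟩ := exists_coordinate_bounded 1 L₁ hΛ0
    (fun i => (l₁ i).trans (hΛ i)) t₁
  obtain ⟨L₃, i₃, t₃, l₃, b₃, e₃⟩ := exists_coordinate_bounded 2 L₂ hΛ0
    (fun i => ((l₂ i).trans (l₁ i)).trans (hΛ i)) t₂
  refine ⟨L₃, (i₁.trans i₂).trans i₃, t₃, fun i => ((l₃ i).trans (l₂ i)).trans (l₁ i),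
    fun i t => ?_⟩
  set R := 1 + 2 * (Λ + 1) * (n : ℝ) with hR
  have hR0 : 0 ≤ R := by positivity
  have h0 : |L₃.curve i t 0| ≤ R := by
    rw [e₃ i t 0 (by decide), e₂ i t 0 (by decide)]; exact b₁ i t
  have h1 : |L₃.curve i t 1| ≤ R := by
    rw [e₃ i t 1 (by decide)]; exact b₂ i t
  have h2 : |L₃.curve i t 2| ≤ R := b₃ i t
  rw [EuclideanSpace.norm_eq, Fin.sum_univ_three]
  simp only [Real.norm_eq_abs]
  refine Real.sqrt_le_iff.2 ⟨by positivity, ?_⟩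
  have q0 : |L₃.curve i t 0| ^ 2 ≤ R ^ 2 := by gcongr
  have q1 : |L₃.curve i t 1| ^ 2 ≤ R ^ 2 := by gcongr
  have q2 : |L₃.curve i t 2| ^ 2 ≤ R ^ 2 := by gcongr
  nlinarith

/-! ### Rounding corners -/

theorem hasDerivAt_max_zero_sq (x : ℝ) :
    HasDerivAt (fun y : ℝ => (max 0 y) ^ 2) (2 * max 0 x) x := by
  rcases lt_trichotomy x 0 with h | rfl | h
  · rw [max_eq_left h.le, mul_zero]
    refine (hasDerivAt_const x (0 : ℝ)).congr_of_eventuallyEq ?_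
    filter_upwards [gt_mem_nhds h] with y hy
    rw [max_eq_left hy.le]; simp
  · rw [max_self, mul_zero, hasDerivAt_iff_tendsto_slope]
    refine squeeze_zero_norm (a := fun y => |y|) (fun y => ?_) ?_
    · rw [slope_def_field]
      rcases le_total y 0 with hy | hy
      · rw [max_eq_left hy]; simp
      · rw [max_eq_right hy]
        rw [max_self, sub_zero, zero_pow two_ne_zero, sub_zero, pow_two, mul_self_div_self]
        exact le_rfl
    · have := (continuous_abs (G := ℝ)).tendsto 0
      rw [abs_zero] at this
      exact this.mono_left inf_le_left
  · rw [max_eq_right h.le]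
    have h1 := hasDerivAt_pow 2 x
    simp only [Nat.add_one_sub_one, pow_one, Nat.cast_ofNat] at h1
    refine h1.congr_of_eventuallyEq ?_
    filter_upwards [lt_mem_nhds h] with y hy
    rw [max_eq_right hy.le]

/-- A `C^{1,1}` rounding of `|x|` at scale `ε`. -/
noncomputable def smoothAbs (ε x : ℝ) : ℝ :=
  ((max 0 (x + ε)) ^ 2 - (max 0 (x - ε)) ^ 2) / (2 * ε) - x

theorem hasDerivAt_smoothAbs (ε x : ℝ) :
    HasDerivAt (smoothAbs ε) ((2 * max 0 (x + ε) - 2 * max 0 (x - ε)) / (2 * ε) - 1) x :=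
  ((((hasDerivAt_max_zero_sq (x + ε)).comp_add_const x ε).sub
    ((hasDerivAt_max_zero_sq (x - ε)).comp_sub_const x ε)).div_const (2 * ε)).sub (hasDerivAt_id x)

/-- This form shows that `|x|` changes only for `|x| < ε`; the defining form shows that the
derivative is Lipschitz. -/
theorem smoothAbs_eq {ε : ℝ} (hε : 0 < ε) (x : ℝ) :
    smoothAbs ε x = |x| + (max 0 (ε - |x|)) ^ 2 / (2 * ε) := by
  unfold smoothAbs
  rcases le_total 0 x with hx | hx
  · rw [abs_of_nonneg hx, max_eq_right (by linarith : (0 : ℝ) ≤ x + ε)]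
    rcases le_total x ε with h | h
    · rw [max_eq_left (by linarith : x - ε ≤ 0), max_eq_right (by linarith : 0 ≤ ε - x)]
      field_simp; ring
    · rw [max_eq_right (by linarith : 0 ≤ x - ε), max_eq_left (by linarith : ε - x ≤ 0)]
      field_simp; ring
  · rw [abs_of_nonpos hx, max_eq_left (by linarith : x - ε ≤ 0), sub_neg_eq_add, add_comm ε x]
    rcases le_total (-ε) x with h | h
    · rw [max_eq_right (by linarith : 0 ≤ x + ε)]
      field_simp; ring
    · rw [max_eq_left (by linarith : x + ε ≤ 0)]
      simp

/-- The determinant is the increment over `[0, 1]` of `ψ`, whose derivative is `(y - x)(z - x)`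
times a difference of values of `g'` at points `s(z - y)` apart. -/
theorem abs_det_smoothAbs_le {ε : ℝ} (hε : 0 < ε) (x y z : ℝ) :
    |(y - x) * (smoothAbs ε z - smoothAbs ε x) - (z - x) * (smoothAbs ε y - smoothAbs ε x)| ≤
      2 / ε * (|y - x| * |z - x| * |z - y|) := by
  set g' : ℝ → ℝ := fun x => (2 * max 0 (x + ε) - 2 * max 0 (x - ε)) / (2 * ε) - 1 with hg'
  have hlip : ∀ a b, |g' a - g' b| ≤ 2 / ε * |a - b| := by
    intro a b
    have h1 := abs_max_sub_max_le_abs (a + ε) (b + ε) 0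
    have h2 := abs_max_sub_max_le_abs (a - ε) (b - ε) 0
    rw [max_comm, max_comm _ (0 : ℝ)] at h1 h2
    have e : g' a - g' b = ((max 0 (a + ε) - max 0 (b + ε)) - (max 0 (a - ε) - max 0 (b - ε))) / ε := by
      simp only [hg']; field_simp; ring
    rw [e, abs_div, abs_of_pos hε, div_mul_eq_mul_div]
    refine div_le_div_of_nonneg_right ?_ hε.le
    have h3 := abs_sub (max 0 (a + ε) - max 0 (b + ε)) (max 0 (a - ε) - max 0 (b - ε))
    rw [add_sub_add_right_eq_sub] at h1
    rw [sub_sub_sub_cancel_right] at h2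
    linarith
  set ψ : ℝ → ℝ := fun s =>
    (y - x) * smoothAbs ε (x + s * (z - x)) - (z - x) * smoothAbs ε (x + s * (y - x)) with hψ
  have hder : ∀ s, HasDerivAt ψ ((y - x) * (g' (x + s * (z - x)) * (z - x)) -
      (z - x) * (g' (x + s * (y - x)) * (y - x))) s := by
    intro s
    have hin : ∀ w : ℝ, HasDerivAt (fun s => x + s * w) w s := fun w => by
      simpa using ((hasDerivAt_id s).mul_const w).const_add x
    exact (((hasDerivAt_smoothAbs ε _).comp s (hin (z - x))).const_mul _).sub
      (((hasDerivAt_smoothAbs ε _).comp s (hin (y - x))).const_mul _)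
  have h := norm_image_sub_le_of_norm_deriv_le_segment_01' (f := ψ)
    (C := 2 / ε * (|y - x| * |z - x| * |z - y|))
    (fun s _ => (hder s).hasDerivWithinAt) (fun s hs => by
      have e : (y - x) * (g' (x + s * (z - x)) * (z - x)) -
        (z - x) * (g' (x + s * (y - x)) * (y - x)) =
        (y - x) * (z - x) * (g' (x + s * (z - x)) - g' (x + s * (y - x))) := by ring
      rw [e, Real.norm_eq_abs, abs_mul, abs_mul]
      have h1 := hlip (x + s * (z - x)) (x + s * (y - x))
      have e2 : x + s * (z - x) - (x + s * (y - x)) = s * (z - y) := by ring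
      rw [e2, abs_mul, abs_of_nonneg hs.1] at h1
      have h2 : s * |z - y| ≤ 1 * |z - y| := mul_le_mul_of_nonneg_right hs.2.le (abs_nonneg _)
      have h3 : 2 / ε * (s * |z - y|) ≤ 2 / ε * |z - y| :=
        mul_le_mul_of_nonneg_left (by linarith) (by positivity)
      calc _ ≤ |y - x| * |z - x| * (2 / ε * |z - y|) :=
            mul_le_mul_of_nonneg_left (h1.trans h3) (by positivity)
        _ = _ := by ring)
  rw [Real.norm_eq_abs] at h
  convert h using 2
  simp only [hψ, one_mul, zero_mul, add_zero, add_sub_cancel]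
  ring

theorem inner_frame {e f : E3} (he : ‖e‖ = 1) (hf : ‖f‖ = 1) (hef : ⟪e, f⟫ = 0) (a b a' b' : ℝ) :
    ⟪a • e + b • f, a' • e + b' • f⟫ = a * a' + b * b' := by
  have hfe : ⟪f, e⟫ = 0 := by rw [real_inner_comm, hef]
  simp only [inner_add_left, inner_add_right, real_inner_smul_left, real_inner_smul_right,
    real_inner_self_eq_norm_sq, he, hf, hef, hfe]
  ring

/-- In an orthonormal frame the Gram determinant is the square of the planar determinant, and
horizontal differences do not exceed distances. -/
theorem tripleThick_frame {e f : E3} (he : ‖e‖ = 1) (hf : ‖f‖ = 1) (hef : ⟪e, f⟫ = 0) {v : E3}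
    {K : ℝ} (hK : 0 < K) {x y z x' y' z' : ℝ}
    (h : |(y - x) * (z' - x') - (z - x) * (y' - x')| ≤ K * (|y - x| * |z - x| * |z - y|)) :
    TripleThick (1 / (2 * K)) (v + x • e + x' • f) (v + y • e + y' • f) (v + z • e + z' • f) := by
  unfold TripleThick
  have e1 : ∀ a a' b b' : ℝ, (v + a • e + a' • f) - (v + b • e + b' • f) =
      (a - b) • e + (a' - b') • f := fun a a' b b' => by
    rw [sub_smul, sub_smul]; abel
  simp only [e1, ← real_inner_self_eq_norm_sq, inner_frame he hf hef]
  have h2 := pow_le_pow_left₀ (abs_nonneg _) h 2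
  rw [sq_abs, mul_pow, mul_pow, mul_pow, sq_abs, sq_abs, sq_abs] at h2
  have e3 : 4 * (1 / (2 * K)) ^ 2 = 1 / K ^ 2 := by field_simp; norm_num
  rw [e3, one_div, inv_mul_le_iff₀ (by positivity)]
  have p1 : (y - x) ^ 2 ≤ (y - x) * (y - x) + (y' - x') * (y' - x') := by nlinarith [sq_nonneg (y' - x')]
  have p2 : (z - x) ^ 2 ≤ (z - x) * (z - x) + (z' - x') * (z' - x') := by nlinarith [sq_nonneg (z' - x')]
  have p3 : (z - y) ^ 2 ≤ (z - y) * (z - y) + (z' - y') * (z' - y') := by nlinarith [sq_nonneg (z' - y')]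
  have p4 : (y - x) ^ 2 * (z - x) ^ 2 * (z - y) ^ 2 ≤
      ((y - x) * (y - x) + (y' - x') * (y' - x')) * ((z - x) * (z - x) + (z' - x') * (z' - x')) *
        ((z - y) * (z - y) + (z' - y') * (z' - y')) :=
    mul_le_mul (mul_le_mul p1 p2 (sq_nonneg _) ((sq_nonneg _).trans p1)) p3 (sq_nonneg _)
      (mul_nonneg ((sq_nonneg _).trans p1) ((sq_nonneg _).trans p2))
  have p5 := mul_le_mul_of_nonneg_left p4 (sq_nonneg K)
  refine le_trans (le_of_eq ?_) (h2.trans p5)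
  ring

/-- Near `v`, the set `S` lies on two rays from `v`, written as the graph of `c |x|`. -/
def IsCornerAt (S : Set E3) (v : E3) : Prop :=
  ∃ U ∈ 𝓝 v, ∃ e f : E3, ∃ c : ℝ, ‖e‖ = 1 ∧ ‖f‖ = 1 ∧ ⟪e, f⟫ = 0 ∧ 0 ≤ c ∧
    ∀ p ∈ S ∩ U, ∃ x : ℝ, p = v + x • e + (c * |x|) • f

/-! ### Shears supported near a corner -/

/-- The dilation by `1 + a` along the unit vector `f`. -/
noncomputable def stretch (f : E3) (a : ℝ) : E3 →L[ℝ] E3 :=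
  ContinuousLinearMap.id ℝ E3 + a • (innerSL ℝ f).smulRight f

theorem stretch_apply (f : E3) (a : ℝ) (p : E3) : stretch f a p = p + (a * ⟪f, p⟫) • f := by
  simp [stretch, mul_smul]

theorem stretch_stretch {f : E3} (hf : ‖f‖ = 1) {a b : ℝ} (hab : a + b + a * b = 0) (p : E3) :
    stretch f b (stretch f a p) = p := by
  simp only [stretch_apply, inner_add_right, real_inner_smul_right, real_inner_self_eq_norm_sq, hf]
  rw [add_assoc, ← add_smul]
  have : a * ⟪f, p⟫ + b * (⟪f, p⟫ + a * ⟪f, p⟫ * 1 ^ 2) = 0 := by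
    linear_combination ⟪f, p⟫ * hab
  rw [this, zero_smul, add_zero]

/-- `h` may be steep along `e`, but moves points along `f` only. Squeezing `f` by `δ` multiplies the
steep part by `δ` and leaves the constant `1/2` of the other part, for a total of at most `1/4 +
1/2`. -/
theorem exists_isotopy_shear {e f : E3} (he : ‖e‖ = 1) (hf : ‖f‖ = 1) (hef : ⟪e, f⟫ = 0)
    {h : E3 → ℝ} {c : ℝ} (hc : 0 ≤ c)
    (hh : ∀ p q, |h p - h q| ≤ c * |⟪e, p - q⟫| + 1 / 2 * ‖p - q‖) :
    ∃ H : unitInterval → (E3 ≃ₜ E3),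
      Continuous (fun p : unitInterval × E3 => H p.1 p.2) ∧
      Continuous (fun p : unitInterval × E3 => (H p.1).symm p.2) ∧
      H 0 = Homeomorph.refl E3 ∧ ∀ x, H 1 x = x + h x • f := by
  set δ : ℝ := 1 / (4 * (c + 1)) with hδ
  have hδ0 : 0 < δ := by positivity
  have hδ1 : δ ≤ 1 := by
    rw [hδ, div_le_one (by positivity)]; linarith
  have hδc : δ * c ≤ 1 / 4 := by
    rw [hδ, one_div, inv_mul_le_iff₀ (by positivity)]; linarith
  have hab : (δ - 1) + (δ⁻¹ - 1) + (δ - 1) * (δ⁻¹ - 1) = 0 := by field_simp; ring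
  let A : E3 ≃L[ℝ] E3 := ContinuousLinearEquiv.equivOfInverse (stretch f (δ - 1))
    (stretch f (δ⁻¹ - 1)) (stretch_stretch hf hab) (stretch_stretch hf (by linarith))
  have hA : ∀ p, A p = p + ((δ - 1) * ⟪f, p⟫) • f := stretch_apply f _
  have hA' : ∀ p, A.symm p = p + ((δ⁻¹ - 1) * ⟪f, p⟫) • f := stretch_apply f _
  have hAf : ∀ a : ℝ, A (a • f) = (δ * a) • f := fun a => by
    rw [hA, real_inner_smul_right, real_inner_self_eq_norm_sq, hf, ← add_smul]
    congr 1; ring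
  have hAe : ∀ p, ⟪e, A.symm p⟫ = ⟪e, p⟫ := fun p => by
    rw [hA', inner_add_right, real_inner_smul_right, hef, mul_zero, add_zero]
  have hAn : ∀ p, δ * ‖A.symm p‖ ≤ ‖p‖ := fun p => by
    have h1 : ‖A.symm p‖ ≤ ‖p‖ + (δ⁻¹ - 1) * ‖p‖ := by
      rw [hA']
      refine (norm_add_le _ _).trans (add_le_add le_rfl ?_)
      rw [norm_smul, hf, mul_one, norm_mul, Real.norm_of_nonneg (sub_nonneg.2
        (one_le_inv₀ hδ0 |>.2 hδ1))]
      refine mul_le_mul_of_nonneg_left ?_ (sub_nonneg.2 (one_le_inv₀ hδ0 |>.2 hδ1))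
      have := norm_inner_le_norm (𝕜 := ℝ) f p
      rwa [hf, one_mul] at this
    have h2 := mul_le_mul_of_nonneg_left h1 hδ0.le
    have h3 : δ * (‖p‖ + (δ⁻¹ - 1) * ‖p‖) = ‖p‖ := by field_simp; ring
    linarith
  refine exists_isotopy_id_add_conj A (k := 3 / 4) (by
    rw [div_lt_one (by norm_num)]; norm_num) (LipschitzWith.of_dist_le_mul fun p q => ?_)
  rw [hAf, hAf, dist_eq_norm, ← sub_smul, norm_smul, hf, mul_one, ← mul_sub, norm_mul,
    Real.norm_of_nonneg hδ0.le, Real.norm_eq_abs, dist_eq_norm]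
  have h1 := mul_le_mul_of_nonneg_left (hh (A.symm p) (A.symm q)) hδ0.le
  rw [← map_sub, hAe] at h1
  have h2 := hAn (p - q)
  have h3 : |⟪e, p - q⟫| ≤ ‖p - q‖ := by
    have := abs_real_inner_le_norm e (p - q)
    rwa [he, one_mul] at this
  have h4 : δ * c * |⟪e, p - q⟫| ≤ 1 / 4 * ‖p - q‖ := by
    refine mul_le_mul hδc h3 (abs_nonneg _) (by norm_num)
  push_cast
  linarith

/-- The radial cutoff equal to `1` on the ball of radius `σ` and `0` off that of radius `2σ`. -/
noncomputable def cutoff (σ : ℝ) (p : E3) : ℝ := max 0 (min 1 (2 - ‖p‖ / σ))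

theorem cutoff_nonneg (σ : ℝ) (p : E3) : 0 ≤ cutoff σ p := le_max_left _ _

theorem cutoff_le_one (σ : ℝ) (p : E3) : cutoff σ p ≤ 1 :=
  max_le zero_le_one (min_le_left _ _)

theorem cutoff_eq_one {σ : ℝ} (hσ : 0 < σ) {p : E3} (h : ‖p‖ ≤ σ) : cutoff σ p = 1 := by
  have : ‖p‖ / σ ≤ 1 := (div_le_one hσ).2 h
  rw [cutoff, min_eq_left (by linarith), max_eq_right zero_le_one]

theorem cutoff_eq_zero {σ : ℝ} (hσ : 0 < σ) {p : E3} (h : 2 * σ ≤ ‖p‖) : cutoff σ p = 0 := by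
  have : 2 ≤ ‖p‖ / σ := (le_div_iff₀ hσ).2 h
  exact max_eq_left ((min_le_right _ _).trans (by linarith))

theorem abs_cutoff_sub_le {σ : ℝ} (hσ : 0 < σ) (p q : E3) :
    |cutoff σ p - cutoff σ q| ≤ ‖p - q‖ / σ := by
  unfold cutoff
  have h1 := abs_max_sub_max_le_abs (min 1 (2 - ‖p‖ / σ)) (min 1 (2 - ‖q‖ / σ)) 0
  have h2 := abs_min_sub_min_le_max 1 (2 - ‖p‖ / σ) 1 (2 - ‖q‖ / σ)
  rw [max_comm, max_comm _ (0 : ℝ)] at h1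
  refine h1.trans (h2.trans ?_)
  rw [sub_self, abs_zero, max_eq_right (abs_nonneg _), sub_sub_sub_cancel_left, ← sub_div, abs_div,
    abs_of_pos hσ]
  refine div_le_div_of_nonneg_right ?_ hσ.le
  rw [norm_sub_rev]
  exact abs_norm_sub_norm_le q p

/-- The shear along `f` replaces `c |x|` by `c * smoothAbs ε x`, and a radial cutoff confines it to
a small ball. -/
theorem IsCornerAt.exists_rounding {S : Set E3} {v : E3} (hS : IsCornerAt S v) {r : ℝ}
    (hr : 0 < r) :
    ∃ H : unitInterval → (E3 ≃ₜ E3),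
      Continuous (fun p : unitInterval × E3 => H p.1 p.2) ∧
      Continuous (fun p : unitInterval × E3 => (H p.1).symm p.2) ∧
      H 0 = Homeomorph.refl E3 ∧ (∃ C, LipschitzWith C (H 1)) ∧
      ∃ ρ, 0 < ρ ∧ ρ ≤ r ∧ (∀ p, ρ / 2 ≤ ‖p - v‖ → H 1 p = p) ∧
        ∃ τ : ℝ, 0 < τ ∧ ThickSet τ (H 1 '' S ∩ Metric.ball v ρ) := by
  obtain ⟨U, hU, e, f, c, he, hf, hef, hc, hSU⟩ := hS
  obtain ⟨ρ₀, hρ₀, hball⟩ := Metric.mem_nhds_iff.1 hU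
  set ρ := min ρ₀ r with hρdef
  have hρ : 0 < ρ := lt_min hρ₀ hr
  set σ := ρ / 4 with hσdef
  have hσ : 0 < σ := by positivity
  -- A corner point with `|x| < ε` is within `(1 + c) ε = σ` of `v`, where the cutoff equals 1.
  set ε := σ / (1 + c) with hεdef
  have hε : 0 < ε := by positivity
  have hεσ : (1 + c) * ε = σ := by rw [hεdef]; field_simp
  set η : ℝ → ℝ := fun x => (max 0 (ε - |x|)) ^ 2 / (2 * ε) with hη
  have hη0 : ∀ x, 0 ≤ η x := fun x => by positivity
  have hηmax : ∀ x : ℝ, max 0 (ε - |x|) ≤ ε := fun x =>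
    max_le hε.le (by linarith [abs_nonneg x])
  have hηle : ∀ x, η x ≤ ε / 2 := fun x => by
    simp only [hη]
    rw [div_le_iff₀ (by positivity)]
    have h1 : (max 0 (ε - |x|)) ^ 2 ≤ ε ^ 2 :=
      pow_le_pow_left₀ (le_max_left _ _) (hηmax x) 2
    linarith
  have hηL : ∀ x y, |η x - η y| ≤ |x - y| := by
    intro x y
    have h1 := abs_max_sub_max_le_abs (ε - |x|) (ε - |y|) 0
    rw [max_comm, max_comm _ (0 : ℝ), sub_sub_sub_cancel_left] at h1
    have h2 := abs_abs_sub_abs_le y x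
    have hx := hηmax x
    have hy := hηmax y
    have hx0 : 0 ≤ max 0 (ε - |x|) := le_max_left _ _
    have hy0 : 0 ≤ max 0 (ε - |y|) := le_max_left _ _
    simp only [hη]
    rw [← sub_div, sq_sub_sq, abs_div, abs_mul, abs_of_pos (show 0 < 2 * ε by positivity),
      div_le_iff₀ (by positivity), abs_of_nonneg (by positivity), abs_sub_comm x y, mul_comm]
    exact mul_le_mul (h1.trans h2) (by linarith) (by positivity) (abs_nonneg _)
  set h : E3 → ℝ := fun p => c * η ⟪e, p - v⟫ * cutoff σ (p - v) with hh
  have hhL : ∀ p q, |h p - h q| ≤ c * |⟪e, p - q⟫| + 1 / 2 * ‖p - q‖ := by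
    intro p q
    have e1 : h p - h q = c * (η ⟪e, p - v⟫ - η ⟪e, q - v⟫) * cutoff σ (p - v) +
        c * η ⟪e, q - v⟫ * (cutoff σ (p - v) - cutoff σ (q - v)) := by
      simp only [hh]; ring
    have h1 := hηL ⟪e, p - v⟫ ⟪e, q - v⟫
    rw [← inner_sub_right, sub_sub_sub_cancel_right] at h1
    have h2 := abs_cutoff_sub_le hσ (p - v) (q - v)
    rw [sub_sub_sub_cancel_right] at h2
    rw [e1]
    refine (abs_add_le _ _).trans (add_le_add ?_ ?_)
    · rw [abs_mul, abs_mul, abs_of_nonneg hc, abs_of_nonneg (cutoff_nonneg _ _)]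
      refine (mul_le_of_le_one_right (by positivity) (cutoff_le_one _ _)).trans ?_
      exact mul_le_mul_of_nonneg_left h1 hc
    · rw [abs_mul, abs_mul, abs_of_nonneg hc, abs_of_nonneg (hη0 _)]
      -- Against the cutoff's slope `1 / σ`, this height yields the Lipschitz constant `1/2`.
      have h3 : c * η ⟪e, q - v⟫ ≤ σ / 2 := by
        have := mul_le_mul_of_nonneg_left (hηle ⟪e, q - v⟫) hc
        nlinarith
      refine (mul_le_mul h3 h2 (abs_nonneg _) (by positivity)).trans (le_of_eq ?_)
      field_simp
  obtain ⟨H, hHc, hHs, hH0, hH1⟩ := exists_isotopy_shear he hf hef hc hhL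
  have hsupp : ∀ p, ρ / 2 ≤ ‖p - v‖ → H 1 p = p := by
    intro p hp
    rw [hH1]
    simp only [hh]
    rw [cutoff_eq_zero hσ (by rw [hσdef]; linarith)]
    simp
  refine ⟨H, hHc, hHs, hH0, ⟨(1 + (c + 1 / 2)).toNNReal, ?_⟩, ρ, hρ, min_le_right _ _, hsupp,
    1 / (2 * ((c + 1) * (2 / ε))), by positivity, ?_⟩
  · refine LipschitzWith.of_dist_le_mul fun p q => ?_
    rw [Real.coe_toNNReal _ (by positivity), hH1, hH1, dist_eq_norm, dist_eq_norm]
    have e1 : p + h p • f - (q + h q • f) = (p - q) + (h p - h q) • f := by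
      rw [sub_smul]; abel
    rw [e1]
    refine (norm_add_le _ _).trans ?_
    rw [norm_smul, hf, mul_one, Real.norm_eq_abs]
    have h1 := hhL p q
    have h3 : |⟪e, p - q⟫| ≤ ‖p - q‖ := by
      have := abs_real_inner_le_norm e (p - q)
      rwa [he, one_mul] at this
    have h4 := mul_le_mul_of_nonneg_left h3 hc
    linarith
  · have hgraph : ∀ q ∈ H 1 '' S ∩ Metric.ball v ρ,
        ∃ x : ℝ, q = v + x • e + (c * smoothAbs ε x) • f := by
      rintro _ ⟨⟨p, hp, rfl⟩, hq⟩
      have hpball : p ∈ Metric.ball v ρ := by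
        by_contra hcon
        rw [Metric.mem_ball, dist_eq_norm, not_lt] at hcon
        rw [hsupp p (by linarith), Metric.mem_ball, dist_eq_norm] at hq
        linarith
      obtain ⟨x, hx⟩ := hSU p ⟨hp, hball (Metric.ball_subset_ball (min_le_left _ _) hpball)⟩
      have hpv : p - v = x • e + (c * |x|) • f := by rw [hx]; abel
      have hxe : ⟪e, p - v⟫ = x := by
        have := inner_frame he hf hef 1 0 x (c * |x|)
        rw [hpv]
        simpa using this
      refine ⟨x, ?_⟩
      rw [hH1, smoothAbs_eq hε]
      simp only [hh, hxe]
      have key : c * η x * cutoff σ (p - v) = c * η x := by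
        by_cases hxε : |x| < ε
        · rw [cutoff_eq_one hσ, mul_one]
          rw [hpv]
          refine (norm_add_le _ _).trans ?_
          rw [norm_smul, norm_smul, he, hf, mul_one, mul_one, Real.norm_eq_abs, Real.norm_eq_abs,
            abs_of_nonneg (mul_nonneg hc (abs_nonneg x))]
          have := mul_le_mul_of_nonneg_left hxε.le (show 0 ≤ 1 + c by linarith)
          linarith
        · have : η x = 0 := by
            simp only [hη]
            rw [max_eq_left (by linarith)]; simp
          rw [this]; simp
      rw [key]
      nth_rw 1 [hx]
      rw [add_assoc, ← add_smul, ← mul_add]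
    intro p hp q hq s hs
    obtain ⟨x, rfl⟩ := hgraph p hp
    obtain ⟨y, rfl⟩ := hgraph q hq
    obtain ⟨z, rfl⟩ := hgraph s hs
    -- The constant uses `c + 1`, which is positive even when `c = 0`.
    refine tripleThick_frame he hf hef (by positivity) ?_
    rw [← mul_sub, ← mul_sub, mul_left_comm, mul_left_comm (z - x), ← mul_sub, abs_mul,
      abs_of_nonneg hc, mul_assoc]
    refine mul_le_mul (by linarith) (abs_det_smoothAbs_le hε x y z) (abs_nonneg _) (by linarith)

theorem LocallyThickAt.congr {S S' : Set E3} {x : E3} {U : Set E3} (hU : U ∈ 𝓝 x)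
    (hS : S' ∩ U ⊆ S) (h : LocallyThickAt S x) : LocallyThickAt S' x := by
  obtain ⟨W, hW, τ, hτ, hT⟩ := h
  exact ⟨W ∩ U, inter_mem hW hU, τ, hτ,
    hT.mono hτ.le le_rfl (by rintro p ⟨hp, hpW, hpU⟩; exact ⟨hS ⟨hp, hpU⟩, hpW⟩)⟩

theorem IsCornerAt.congr {S S' : Set E3} {x : E3} {U : Set E3} (hU : U ∈ 𝓝 x)
    (hS : S' ∩ U ⊆ S) (h : IsCornerAt S x) : IsCornerAt S' x := by
  obtain ⟨W, hW, e, f, c, he, hf, hef, hc, hT⟩ := h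
  exact ⟨W ∩ U, inter_mem hW hU, e, f, c, he, hf, hef, hc,
    fun p hp => hT p ⟨hS ⟨hp.1, hp.2.2⟩, hp.2.1⟩⟩

/-- Corners are rounded one by one. Each isotopy is the identity away from `v`, in particular near
the remaining corners, so their local picture is unchanged. The set varies with the induction. -/
theorem exists_rounding (V : Finset E3) : ∀ (S : Set E3),
    (∀ x ∈ S, x ∉ V → LocallyThickAt S x) →
    (∀ v ∈ V, LocallyThickAt S v ∨ IsCornerAt S v) →
    ∃ F : E3 → E3, Continuous F ∧ Function.Injective F ∧ (∃ C, LipschitzWith C F) ∧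
      AmbientIsotopic S (F '' S) ∧ ∀ x ∈ F '' S, LocallyThickAt (F '' S) x := by
  classical
  induction V using Finset.induction_on with
  | empty =>
    intro S hS _
    exact ⟨id, continuous_id, Function.injective_id, ⟨1, LipschitzWith.id⟩,
      by rw [image_id]; exact AmbientIsotopic.refl S,
      by rw [image_id]; exact fun x hx => hS x hx (Finset.notMem_empty x)⟩
  | insert v V hv ih =>
    intro S hS hV
    rcases hV v (Finset.mem_insert_self v V) with hthick | hcorner
    · refine ih S (fun x hx hxV => ?_) fun w hw => hV w (Finset.mem_insert_of_mem hw)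
      by_cases hxv : x = v
      · rwa [hxv]
      · exact hS x hx (by simp [hxv, hxV])
    · obtain ⟨r, hr, hrV⟩ : ∃ r : ℝ, 0 < r ∧ ∀ w ∈ V, r ≤ ‖w - v‖ := by
        have hcl : IsClosed (V : Set E3) := V.finite_toSet.isClosed
        obtain ⟨r, hr, hball⟩ := Metric.isOpen_iff.1 hcl.isOpen_compl v (by simpa using hv)
        refine ⟨r, hr, fun w hw => ?_⟩
        by_contra hlt
        exact hball (by rw [Metric.mem_ball, dist_eq_norm]; exact not_le.1 hlt) hw
      obtain ⟨H, hHc, hHs, hH0, ⟨C, hC⟩, ρ, hρ, hρr, hsupp, τ, hτ, hth⟩ :=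
        hcorner.exists_rounding hr
      set O : Set E3 := {p | ρ / 2 < ‖p - v‖} with hO
      have hOopen : IsOpen O := isOpen_lt continuous_const (by fun_prop)
      have hback : H 1 '' S ∩ O ⊆ S := by
        rintro _ ⟨⟨p, hp, rfl⟩, hpO⟩
        -- `H 1 p` lies where `H 1` is the identity; injectivity gives `H 1 p = p`.
        have h1 : H 1 (H 1 p) = H 1 p := hsupp _ (le_of_lt hpO)
        rw [(H 1).injective h1]
        exact hp
      have hOmem : ∀ x, ρ ≤ ‖x - v‖ → O ∈ 𝓝 x := fun x hx =>
        hOopen.mem_nhds (show ρ / 2 < ‖x - v‖ by linarith)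
      obtain ⟨F, hFc, hFi, ⟨D, hD⟩, hFiso, hFth⟩ := ih (H 1 '' S) (fun x hx hxV => by
          by_cases hxb : ‖x - v‖ < ρ
          · exact ⟨Metric.ball v ρ, Metric.isOpen_ball.mem_nhds (by
              rwa [Metric.mem_ball, dist_eq_norm]), τ, hτ, hth⟩
          · have hO' := hOmem x (not_lt.1 hxb)
            refine (hS x (hback ⟨hx, mem_of_mem_nhds hO'⟩) ?_).congr hO' hback
            rw [Finset.mem_insert, not_or]
            refine ⟨fun hxv => hxb ?_, hxV⟩
            rw [hxv, sub_self, norm_zero]; exact hρ)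
        (fun w hw => by
          have hO' := hOmem w (hρr.trans (hrV w hw))
          exact (hV w (Finset.mem_insert_of_mem hw)).imp (fun h => h.congr hO' hback)
            fun h => h.congr hO' hback)
      refine ⟨F ∘ H 1, hFc.comp (H 1).continuous, hFi.comp (H 1).injective, ⟨_, hD.comp hC⟩, ?_, ?_⟩
      · rw [image_comp]
        exact AmbientIsotopic.trans ⟨H, hHc, hHs, hH0, rfl⟩ hFiso
      · rw [image_comp]
        exact hFth

/-! ### Polygonal links have links of finite ropelength in their type -/

theorem tripleThick_line (τ : ℝ) (v w : E3) (x y z : ℝ) :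
    TripleThick τ (v + x • w) (v + y • w) (v + z • w) := by
  unfold TripleThick
  simp only [add_sub_add_left_eq_sub, ← sub_smul, norm_smul, real_inner_smul_left,
    real_inner_smul_right, real_inner_self_eq_norm_sq, mul_pow, Real.norm_eq_abs, sq_abs]
  have h : 4 * τ ^ 2 * ((y - x) ^ 2 * ‖w‖ ^ 2 * ((z - x) ^ 2 * ‖w‖ ^ 2) -
      (z - x) ^ 2 * ((y - x) ^ 2 * (‖w‖ ^ 2) ^ 2)) = 0 := by ring
  have h' : 0 ≤ (y - x) ^ 2 * ‖w‖ ^ 2 * ((z - x) ^ 2 * ‖w‖ ^ 2) * ((z - y) ^ 2 * ‖w‖ ^ 2) := by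
    positivity
  nlinarith

theorem locallyThickAt_of_line {S U : Set E3} {p v w : E3} (hU : U ∈ 𝓝 p)
    (h : ∀ q ∈ S ∩ U, ∃ x : ℝ, q = v + x • w) : LocallyThickAt S p := by
  refine ⟨U, hU, 1, one_pos, fun x hx y hy z hz => ?_⟩
  obtain ⟨a, rfl⟩ := h x hx
  obtain ⟨b, rfl⟩ := h y hy
  obtain ⟨c, rfl⟩ := h z hz
  exact tripleThick_line 1 v w a b c

/-- Two rays in different directions are on a line or form the graph of `c |x|`. -/
theorem rays_subset_line_or_graph {A B : E3} (h : ¬ SameRay ℝ A B) :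
    (∃ (w : E3) (α β : ℝ), A = α • w ∧ B = β • w) ∨
    ∃ (e f : E3) (c : ℝ), ‖e‖ = 1 ∧ ‖f‖ = 1 ∧ ⟪e, f⟫ = 0 ∧ 0 ≤ c ∧
      (∀ r : ℝ, 0 ≤ r → ∃ x : ℝ, r • A = x • e + (c * |x|) • f) ∧
      ∀ r : ℝ, 0 ≤ r → ∃ x : ℝ, r • B = x • e + (c * |x|) • f := by
  have hA : A ≠ 0 := by rintro rfl; exact h (SameRay.zero_left _)
  have hB : B ≠ 0 := by rintro rfl; exact h (SameRay.zero_right _)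
  have hnA : 0 < ‖A‖ := norm_pos_iff.2 hA
  have hnB : 0 < ‖B‖ := norm_pos_iff.2 hB
  set a := ‖A‖⁻¹ • A with ha
  set b := ‖B‖⁻¹ • B with hb
  have hAa : A = ‖A‖ • a := by rw [ha, smul_inv_smul₀ hnA.ne']
  have hBb : B = ‖B‖ • b := by rw [hb, smul_inv_smul₀ hnB.ne']
  have ha1 : ‖a‖ = 1 := by rw [ha, norm_smul, norm_inv, norm_norm, inv_mul_cancel₀ hnA.ne']
  have hb1 : ‖b‖ = 1 := by rw [hb, norm_smul, norm_inv, norm_norm, inv_mul_cancel₀ hnB.ne']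
  have hab : a ≠ b := fun he => h ((sameRay_iff_inv_norm_smul_eq_of_ne hA hB).2 he)
  have hm : 0 < ‖a - b‖ := norm_pos_iff.2 (sub_ne_zero.2 hab)
  by_cases hab' : a + b = 0
  · left
    refine ⟨a, ‖A‖, -‖B‖, hAa, ?_⟩
    have : b = -a := by rw [← sub_eq_zero, sub_neg_eq_add, add_comm, hab']
    rw [neg_smul, ← smul_neg, ← this]
    exact hBb
  right
  have hp : 0 < ‖a + b‖ := norm_pos_iff.2 hab'
  -- As `‖a‖ = ‖b‖`, the vectors `a - b` and `a + b` are orthogonal; about the bisector `f` the two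
  -- rays are mirror images.
  set e := ‖a - b‖⁻¹ • (a - b) with he
  set f := ‖a + b‖⁻¹ • (a + b) with hf
  have hae : a - b = ‖a - b‖ • e := by rw [he, smul_inv_smul₀ hm.ne']
  have haf : a + b = ‖a + b‖ • f := by rw [hf, smul_inv_smul₀ hp.ne']
  have ha2 : a = (‖a - b‖ / 2) • e + (‖a + b‖ / 2) • f := by
    rw [div_eq_inv_mul, div_eq_inv_mul, mul_smul, mul_smul, ← hae, ← haf, ← smul_add,
      sub_add_add_cancel, ← two_smul ℝ a, inv_smul_smul₀ two_ne_zero]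
  have hb2 : b = (-(‖a - b‖ / 2)) • e + (‖a + b‖ / 2) • f := by
    rw [neg_smul, div_eq_inv_mul, div_eq_inv_mul, mul_smul, mul_smul, ← hae, ← haf, ← smul_neg,
      ← smul_add, neg_sub, add_comm a b, sub_add_add_cancel, ← two_smul ℝ b,
      inv_smul_smul₀ two_ne_zero]
  refine ⟨e, f, ‖a + b‖ / ‖a - b‖, ?_, ?_, ?_, by positivity, fun r hr => ?_, fun r hr => ?_⟩
  · rw [he, norm_smul, norm_inv, norm_norm, inv_mul_cancel₀ hm.ne']
  · rw [hf, norm_smul, norm_inv, norm_norm, inv_mul_cancel₀ hp.ne']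
  · rw [he, hf, real_inner_smul_left, real_inner_smul_right, real_inner_comm,
      (real_inner_add_sub_eq_zero_iff a b).2 (by rw [ha1, hb1])]
    simp
  · refine ⟨r * ‖A‖ * (‖a - b‖ / 2), ?_⟩
    rw [abs_of_nonneg (by positivity)]
    have hcoef : ‖a + b‖ / ‖a - b‖ * (r * ‖A‖ * (‖a - b‖ / 2)) = r * ‖A‖ * (‖a + b‖ / 2) := by
      field_simp
    have h1 : r • A = (r * ‖A‖) • ((‖a - b‖ / 2) • e + (‖a + b‖ / 2) • f) := by
      rw [← ha2, mul_smul, ← hAa]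
    rw [hcoef, h1, smul_add, smul_smul _ _ f, smul_smul _ _ e]
  · refine ⟨-(r * ‖B‖ * (‖a - b‖ / 2)), ?_⟩
    rw [abs_neg, abs_of_nonneg (by positivity)]
    have hcoef : ‖a + b‖ / ‖a - b‖ * (r * ‖B‖ * (‖a - b‖ / 2)) = r * ‖B‖ * (‖a + b‖ / 2) := by
      field_simp
    have h1 : r • B = (r * ‖B‖) • ((-(‖a - b‖ / 2)) • e + (‖a + b‖ / 2) • f) := by
      rw [← hb2, mul_smul, ← hBb]
    rw [hcoef, h1, smul_add, smul_smul _ _ f, smul_smul _ _ e, mul_neg]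

theorem IsSimpleClosed.injOn_Ico {γ : ℝ → E3} (h : IsSimpleClosed γ) (a : ℝ) :
    InjOn γ (Ico a (a + 1)) :=
  injOn_Ico_of_periodic one_pos h.periodic h.injOn a

/-- Near a point of a link, the link is a short arc of one of its components. -/
theorem Link.exists_nhds_subset_arc {n : ℕ} (L : Link n) (i : Fin n) (t₀ : ℝ) {δ : ℝ}
    (hδ : 0 < δ) (hδ1 : δ ≤ 1 / 2) :
    ∃ U ∈ 𝓝 (L.curve i t₀), L.carrier ∩ U ⊆ L.curve i '' Ioo (t₀ - δ) (t₀ + δ) := by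
  set γ := L.curve i
  have hγ := L.simple i
  -- The rest of the link: the other components and the complementary arc of this one.
  set K : Set E3 := (⋃ j ∈ ({i}ᶜ : Set (Fin n)), range (L.curve j)) ∪
    γ '' Icc (t₀ + δ) (t₀ - δ + 1) with hK
  have hKcl : IsClosed K := by
    refine IsClosed.union ?_ (isCompact_Icc.image hγ.continuous).isClosed
    exact (Set.toFinite _).isClosed_biUnion fun j _ => (L.isCompact_range j).isClosed
  have hend : γ (t₀ - δ + 1) = γ (t₀ - δ) := hγ.periodic _
  have ht₀ : t₀ ∈ Ico (t₀ - δ) (t₀ - δ + 1) := ⟨by linarith, by linarith⟩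
  refine ⟨Kᶜ, hKcl.isOpen_compl.mem_nhds ?_, ?_⟩
  · rintro (hmem | ⟨s, hs, he⟩)
    · simp only [mem_iUnion, mem_compl_iff, mem_singleton_iff] at hmem
      obtain ⟨j, hj, s, hs⟩ := hmem
      exact Set.disjoint_left.1 (L.disjoint j i hj) ⟨s, hs⟩ ⟨t₀, rfl⟩
    · rcases hs.2.eq_or_lt with h | h
      · rw [h, hend] at he
        have := hγ.injOn_Ico (t₀ - δ) ⟨le_rfl, by linarith⟩ ht₀ he
        linarith
      · have := hγ.injOn_Ico (t₀ - δ) ⟨by linarith [hs.1], h⟩ ht₀ he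
        linarith [hs.1]
  · rintro p ⟨hp, hpK⟩
    obtain ⟨j, hj⟩ := mem_iUnion.1 hp
    by_cases hji : j = i
    · subst hji
      obtain ⟨s, rfl⟩ := hj
      obtain ⟨y, hy, he⟩ := hγ.periodic.exists_mem_Ico one_pos s (t₀ - δ)
      rw [he] at hpK ⊢
      refine ⟨y, ⟨lt_of_le_of_ne hy.1 fun h => ?_, ?_⟩, rfl⟩
      · exact hpK (Or.inr ⟨t₀ - δ + 1, ⟨by linarith, le_rfl⟩, by rw [hend, h]⟩)
      · by_contra hcon
        exact hpK (Or.inr ⟨y, ⟨not_lt.1 hcon, hy.2.le⟩, rfl⟩)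
    · exact absurd (Or.inl (mem_biUnion (show j ∈ ({i}ᶜ : Set (Fin n)) from hji) hj)) hpK

section Polygon

variable {n m : ℕ} {P : Link n}

theorem polygon_edge (hm : 0 < m) (hP : ∀ (i : Fin n) (k : ℕ), ∀ s ∈ Icc (0 : ℝ) 1,
      P.curve i (((k : ℝ) + s) / m) =
        (1 - s) • P.curve i ((k : ℝ) / m) + s • P.curve i (((k : ℝ) + 1) / m))
    (i : Fin n) (k : ℕ) {t : ℝ} (h1 : (k : ℝ) / m ≤ t) (h2 : t ≤ ((k : ℝ) + 1) / m) :
    P.curve i t = P.curve i ((k : ℝ) / m) +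
      (m * t - k) • (P.curve i (((k : ℝ) + 1) / m) - P.curve i ((k : ℝ) / m)) := by
  have hm' : (0 : ℝ) < m := by exact_mod_cast hm
  rw [div_le_iff₀ hm'] at h1
  rw [le_div_iff₀ hm'] at h2
  have h := hP i k (m * t - k) ⟨by linarith, by linarith⟩
  have e : ((k : ℝ) + (m * t - k)) / m = t := by field_simp; ring
  rw [e] at h
  rw [h, sub_smul, one_smul, smul_sub]
  abel

/-- Injectivity keeps the two edges at a vertex from overlapping, so they are either collinear and
opposite or form a genuine corner. The index `k + 1` guarantees a preceding edge with a natural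
index. -/
theorem polygon_vertex (hm : 0 < m) (hP : ∀ (i : Fin n) (k : ℕ), ∀ s ∈ Icc (0 : ℝ) 1,
      P.curve i (((k : ℝ) + s) / m) =
        (1 - s) • P.curve i ((k : ℝ) / m) + s • P.curve i (((k : ℝ) + 1) / m))
    (i : Fin n) (k : ℕ) :
    LocallyThickAt P.carrier (P.curve i (((k : ℝ) + 1) / m)) ∨
      IsCornerAt P.carrier (P.curve i (((k : ℝ) + 1) / m)) := by
  have hm' : (0 : ℝ) < m := by exact_mod_cast hm
  have hm1 : (1 : ℝ) ≤ m := by exact_mod_cast hm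
  set γ := P.curve i with hγdef
  have hγ : IsSimpleClosed γ := P.simple i
  set t₀ := ((k : ℝ) + 1) / m with ht₀
  have ht₀m : m * t₀ = k + 1 := by rw [ht₀]; field_simp
  set A := γ ((k : ℝ) / m) - γ t₀ with hA
  set B := γ (((k : ℝ) + 2) / m) - γ t₀ with hB
  have hright : ∀ r : ℝ, 0 ≤ r → r ≤ 1 → γ (t₀ + r / m) = γ t₀ + r • B := by
    intro r h0 h1
    have h := polygon_edge hm hP i (k + 1) (t := t₀ + r / m)
      (by push_cast; linarith [div_nonneg h0 hm'.le])
      (by push_cast; rw [add_div _ (1 : ℝ), ← ht₀]; gcongr)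
    push_cast at h
    rw [← hγdef, ← ht₀] at h
    rw [h, hB]
    congr 2
    · rw [mul_add, ht₀m]; field_simp; ring
    · congr 3; ring
  have hleft : ∀ r : ℝ, 0 ≤ r → r ≤ 1 → γ (t₀ - r / m) = γ t₀ + r • A := by
    intro r h0 h1
    have h := polygon_edge hm hP i k (t := t₀ - r / m)
      (by rw [ht₀, ← sub_div]; gcongr; linarith) (by linarith [div_nonneg h0 hm'.le])
    rw [← hγdef, ← ht₀] at h
    have e : m * (t₀ - r / m) - k = 1 - r := by rw [mul_sub, ht₀m]; field_simp; ring
    rw [h, hA, e, sub_smul, one_smul, smul_sub, smul_sub]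
    abel
  have hray : ¬ SameRay ℝ A B := by
    have key : ∀ r₁ r₂ : ℝ, 0 ≤ r₁ → 0 ≤ r₂ → r₁ • A = r₂ • B → r₁ = 0 ∧ r₂ = 0 := by
      intro r₁ r₂ h1 h2 he
      -- Scaling by `κ` brings both points onto the adjacent edges and both parameters within one
      -- period.
      set κ := 1 / (4 * (1 + r₁ + r₂)) with hκ
      have hκ0 : 0 < κ := by positivity
      have hκ1 : κ * r₁ ≤ 1 / 4 := by
        rw [hκ, one_div, inv_mul_le_iff₀ (by positivity)]; linarith
      have hκ2 : κ * r₂ ≤ 1 / 4 := by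
        rw [hκ, one_div, inv_mul_le_iff₀ (by positivity)]; linarith
      have p1 : 0 ≤ κ * r₁ := by positivity
      have p2 : 0 ≤ κ * r₂ := by positivity
      have e1 := hleft (κ * r₁) p1 (by linarith)
      have e2 := hright (κ * r₂) p2 (by linarith)
      have e3 : γ (t₀ - κ * r₁ / m) = γ (t₀ + κ * r₂ / m) := by
        rw [e1, e2, mul_smul, mul_smul, he]
      have q1 : κ * r₁ / m ≤ 1 / 4 := (div_le_self p1 hm1).trans hκ1
      have q2 : κ * r₂ / m ≤ 1 / 4 := (div_le_self p2 hm1).trans hκ2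
      have q3 : 0 ≤ κ * r₁ / m := by positivity
      have q4 : 0 ≤ κ * r₂ / m := by positivity
      have h5 := hγ.injOn_Ico (t₀ - 1 / 2) ⟨by linarith, by linarith⟩
        ⟨by linarith, by linarith⟩ e3
      have z1 : κ * r₁ / m = 0 := by linarith
      have z2 : κ * r₂ / m = 0 := by linarith
      constructor
      · rcases div_eq_zero_iff.1 z1 with h | h
        · exact (mul_eq_zero.1 h).resolve_left hκ0.ne'
        · exact absurd h hm'.ne'
      · rcases div_eq_zero_iff.1 z2 with h | h
        · exact (mul_eq_zero.1 h).resolve_left hκ0.ne'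
        · exact absurd h hm'.ne'
    rintro (h | h | ⟨r₁, r₂, h1, h2, he⟩)
    · have := (key 1 0 zero_le_one le_rfl (by rw [h]; simp)).1
      norm_num at this
    · have := (key 0 1 le_rfl zero_le_one (by rw [h]; simp)).2
      norm_num at this
    · exact h1.ne' (key r₁ r₂ h1.le h2.le he).1
  have hδ1 : 1 / (2 * (m : ℝ)) ≤ 1 / 2 := by
    apply one_div_le_one_div_of_le <;> linarith
  obtain ⟨U, hU, hSU⟩ := P.exists_nhds_subset_arc i t₀ (δ := 1 / (2 * m)) (by positivity) hδ1
  have hrays : ∀ q ∈ P.carrier ∩ U, (∃ r : ℝ, 0 ≤ r ∧ q = γ t₀ + r • A) ∨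
      ∃ r : ℝ, 0 ≤ r ∧ q = γ t₀ + r • B := by
    intro q hq
    obtain ⟨t, ht, rfl⟩ := hSU hq
    have e : m * (1 / (2 * (m : ℝ))) = 1 / 2 := by field_simp
    rcases le_total t t₀ with h | h
    · left
      have h0 : 0 ≤ m * (t₀ - t) := mul_nonneg hm'.le (by linarith)
      refine ⟨m * (t₀ - t), h0, ?_⟩
      rw [← hleft _ h0 (by nlinarith [ht.1])]
      congr 1; field_simp; ring
    · right
      have h0 : 0 ≤ m * (t - t₀) := mul_nonneg hm'.le (by linarith)
      refine ⟨m * (t - t₀), h0, ?_⟩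
      rw [← hright _ h0 (by nlinarith [ht.2])]
      congr 1; field_simp; ring
  rcases rays_subset_line_or_graph hray with ⟨w, α, β, hα, hβ⟩ | ⟨e, f, c, he, hf, hef, hc, gA, gB⟩
  · left
    refine locallyThickAt_of_line (v := γ t₀) (w := w) hU fun q hq => ?_
    rcases hrays q hq with ⟨r, -, rfl⟩ | ⟨r, -, rfl⟩
    · exact ⟨r * α, by rw [hα, smul_smul]⟩
    · exact ⟨r * β, by rw [hβ, smul_smul]⟩
  · right
    refine ⟨U, hU, e, f, c, he, hf, hef, hc, fun q hq => ?_⟩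
    rcases hrays q hq with ⟨r, hr, rfl⟩ | ⟨r, hr, rfl⟩
    · obtain ⟨x, hx⟩ := gA r hr
      exact ⟨x, by rw [hx, add_assoc]⟩
    · obtain ⟨x, hx⟩ := gB r hr
      exact ⟨x, by rw [hx, add_assoc]⟩

theorem polygon_edge_interior (hm : 0 < m) (hP : ∀ (i : Fin n) (k : ℕ), ∀ s ∈ Icc (0 : ℝ) 1,
      P.curve i (((k : ℝ) + s) / m) =
        (1 - s) • P.curve i ((k : ℝ) / m) + s • P.curve i (((k : ℝ) + 1) / m))
    (i : Fin n) (k : ℕ) {t : ℝ} (h1 : (k : ℝ) / m < t) (h2 : t < ((k : ℝ) + 1) / m) :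
    LocallyThickAt P.carrier (P.curve i t) := by
  set δ := min (1 / 2) (min (t - (k : ℝ) / m) (((k : ℝ) + 1) / m - t)) with hδ
  have hδ0 : 0 < δ := lt_min (by norm_num) (lt_min (by linarith) (by linarith))
  have d1 : δ ≤ t - (k : ℝ) / m := (min_le_right _ _).trans (min_le_left _ _)
  have d2 : δ ≤ ((k : ℝ) + 1) / m - t := (min_le_right _ _).trans (min_le_right _ _)
  obtain ⟨U, hU, hSU⟩ := P.exists_nhds_subset_arc i t hδ0 (min_le_left _ _)
  refine locallyThickAt_of_line (v := P.curve i ((k : ℝ) / m))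
    (w := P.curve i (((k : ℝ) + 1) / m) - P.curve i ((k : ℝ) / m)) hU fun q hq => ?_
  obtain ⟨s, hs, rfl⟩ := hSU hq
  exact ⟨_, polygon_edge hm hP i k (by linarith [hs.1]) (by linarith [hs.2])⟩

theorem polygon_length_ne_top (hm : 0 < m) (hP : ∀ (i : Fin n) (k : ℕ), ∀ s ∈ Icc (0 : ℝ) 1,
      P.curve i (((k : ℝ) + s) / m) =
        (1 - s) • P.curve i ((k : ℝ) / m) + s • P.curve i (((k : ℝ) + 1) / m))
    (i : Fin n) : eVariationOn (P.curve i) (Icc 0 1) ≠ ⊤ := by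
  have hm' : (0 : ℝ) < m := by exact_mod_cast hm
  have hmono : Monotone fun k : ℕ => (k : ℝ) / m := fun a b hab => by
    have : (a : ℝ) ≤ b := by exact_mod_cast hab
    simp only; gcongr
  have h := eVariationOn.sum' (P.curve i) hmono (n := m)
  simp only [Nat.cast_zero, zero_div, div_self hm'.ne'] at h
  rw [← h]
  refine ENNReal.sum_ne_top.2 fun k _ => ?_
  push_cast
  set D := P.curve i (((k : ℝ) + 1) / m) - P.curve i ((k : ℝ) / m) with hD
  have hL : LipschitzOnWith (m * ‖D‖₊) (P.curve i) (Icc ((k : ℝ) / m) (((k : ℝ) + 1) / m)) := by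
    refine LipschitzOnWith.of_dist_le_mul fun s hs t ht => ?_
    rw [polygon_edge hm hP i k hs.1 hs.2, polygon_edge hm hP i k ht.1 ht.2, dist_add_left,
      dist_eq_norm, ← sub_smul, norm_smul, sub_sub_sub_cancel_right, ← mul_sub, norm_mul,
      Real.norm_of_nonneg hm'.le, Real.dist_eq, Real.norm_eq_abs]
    refine le_of_eq ?_
    push_cast
    ring
  have h1 := hL.comp_eVariationOn_le (g := id) (s := Icc ((k : ℝ) / m) (((k : ℝ) + 1) / m))
    (fun x hx => hx)
  rw [eVariationOn_id_Icc] at h1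
  exact ne_top_of_le_ne_top (ENNReal.mul_ne_top ENNReal.coe_ne_top ENNReal.ofReal_ne_top) h1

end Polygon

theorem Link.IsPolygonal.exists_ropelength_lt_top {n : ℕ} {P : Link n} (h : P.IsPolygonal) :
    ∃ L : Link n, AmbientIsotopic P.carrier L.carrier ∧ L.ropelength < ⊤ := by
  classical
  obtain ⟨m, hm, hP⟩ := h
  have hm' : (0 : ℝ) < m := by exact_mod_cast hm
  let V : Finset E3 := Finset.univ.biUnion fun i : Fin n =>
    (Finset.range m).image fun k : ℕ => P.curve i (((k : ℝ) + 1) / m)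
  have hV : ∀ v ∈ V, ∃ i : Fin n, ∃ k < m, P.curve i (((k : ℝ) + 1) / m) = v := by
    intro v hv
    simpa [V] using hv
  have hV' : ∀ i : Fin n, ∀ k < m, P.curve i (((k : ℝ) + 1) / m) ∈ V := by
    intro i k hk
    simp only [V, Finset.mem_biUnion, Finset.mem_univ, Finset.mem_image, Finset.mem_range, true_and]
    exact ⟨i, k, hk, rfl⟩
  obtain ⟨F, hFc, hFi, ⟨C, hC⟩, hiso, hth⟩ := exists_rounding V P.carrier (fun x hx hxV => by
      obtain ⟨i, s, rfl⟩ := mem_iUnion.1 hx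
      obtain ⟨t, ht, he⟩ := (P.simple i).periodic.exists_mem_Ico₀ one_pos s
      rw [he] at hxV ⊢
      set k := ⌊(m : ℝ) * t⌋₊ with hk
      have hmt : 0 ≤ (m : ℝ) * t := mul_nonneg hm'.le ht.1
      have k1 : (k : ℝ) ≤ m * t := Nat.floor_le hmt
      have k2 : (m : ℝ) * t < k + 1 := Nat.lt_floor_add_one _
      have hkm : k < m := by
        have : (k : ℝ) < m := by nlinarith [ht.2]
        exact_mod_cast this
      rcases k1.eq_or_lt with h0 | h0
      · exfalso
        refine hxV ?_
        have e : t = (k : ℝ) / m := by rw [h0]; field_simp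
        -- The vertex at parameter 0 is listed in `V` as the one at `m / m = 1`.
        rcases Nat.eq_zero_or_pos k with hk0 | hk0
        · have := hV' i (m - 1) (by omega)
          rw [Nat.cast_pred hm, sub_add_cancel, div_self hm'.ne'] at this
          rw [e, hk0, Nat.cast_zero, zero_div]
          rwa [← (P.simple i).periodic 0, zero_add]
        · have := hV' i (k - 1) (by omega)
          rw [Nat.cast_pred hk0, sub_add_cancel] at this
          rwa [e]
      · exact polygon_edge_interior hm hP i k (by rw [div_lt_iff₀ hm']; linarith)
          (by rw [lt_div_iff₀ hm']; linarith))
    (fun v hv => by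
      obtain ⟨i, k, -, rfl⟩ := hV v hv
      exact polygon_vertex hm hP i k)
  refine ⟨P.map F hFc hFi, by rwa [Link.carrier_map], ?_⟩
  have hcomp : IsCompact (F '' P.carrier) := P.isCompact_carrier.image hFc
  obtain ⟨τ, hτ, hT⟩ := IsCompact.exists_thickSet hcomp hth
  refine ENNReal.div_lt_top ?_ ?_
  · refine ENNReal.sum_ne_top.2 fun i _ => ne_top_of_le_ne_top ?_ (P.length_map_le F hFc hFi hC i)
    exact ENNReal.mul_ne_top ENNReal.coe_ne_top (polygon_length_ne_top hm hP i)
  · rw [Link.carrier_map]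
    exact ((ENNReal.ofReal_pos.2 hτ).trans_le ((le_thickness_iff hτ.le).2 hT)).ne'

/-! ### Ropelength minimizers -/

/-- A simple closed curve is not contained in a line, so a nonempty link has finite thickness. -/
theorem Link.thickness_ne_top {n : ℕ} (L : Link n) (i : Fin n) : thickness L.carrier ≠ ⊤ := by
  intro htop
  set γ := L.curve i with hγdef
  have hγ : IsSimpleClosed γ := L.simple i
  have hmem : ∀ t, γ t ∈ L.carrier := fun t => mem_iUnion.2 ⟨i, t, rfl⟩
  set u := γ (1 / 2) - γ 0 with hu
  have hu0 : u ≠ 0 := fun h => by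
    have := hγ.injOn (x₁ := 1 / 2) (x₂ := 0) ⟨by norm_num, by norm_num⟩ ⟨le_rfl, one_pos⟩
      (sub_eq_zero.1 h)
    norm_num at this
  have hun : 0 < ‖u‖ := norm_pos_iff.2 hu0
  have hgram : ∀ t, ‖u‖ ^ 2 * ‖γ t - γ 0‖ ^ 2 - ⟪u, γ t - γ 0⟫ ^ 2 = 0 := by
    intro t
    refine le_antisymm ?_ (gram_nonneg _ _)
    by_contra hpos
    rw [not_le] at hpos
    set G := ‖u‖ ^ 2 * ‖γ t - γ 0‖ ^ 2 - ⟪u, γ t - γ 0⟫ ^ 2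
    set C := ‖u‖ ^ 2 * ‖γ t - γ 0‖ ^ 2 * ‖γ t - γ (1 / 2)‖ ^ 2 with hC
    have hC0 : 0 ≤ C := by positivity
    -- For this `τ`, `τ² G ≥ τ G = G + C > C`, which violates the inequality.
    have h := (le_thickness_iff (τ := 1 + C / G) (S := L.carrier) (by positivity)).1
      (htop ▸ le_top) _ (hmem 0) _ (hmem (1 / 2)) _ (hmem t)
    change 4 * (1 + C / G) ^ 2 * G ≤ C at h
    have h1 : 1 + C / G ≤ (1 + C / G) ^ 2 := by
      have : 0 ≤ C / G := by positivity
      nlinarith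
    have h2 : (1 + C / G) * G = G + C := by field_simp
    nlinarith [mul_le_mul_of_nonneg_right h1 hpos.le]
  -- The curve now lies on a line, with coordinate `f` vanishing at 0 and 1; the value halfway to `f
  -- (1/2)` is taken twice, against injectivity.
  set f : ℝ → ℝ := fun t => ⟪u, γ t - γ 0⟫ with hf
  have hrec : ∀ t, γ t = γ 0 + (f t / ‖u‖ ^ 2) • u := by
    intro t
    have h1 : ‖(γ t - γ 0) - (f t / ‖u‖ ^ 2) • u‖ ^ 2 = 0 := by
      rw [norm_sub_sq_real, real_inner_smul_right, norm_smul, real_inner_comm, mul_pow,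
        Real.norm_eq_abs, sq_abs]
      change _ - 2 * (f t / ‖u‖ ^ 2 * f t) + _ = 0
      have h2 : ‖u‖ ^ 2 * ‖γ t - γ 0‖ ^ 2 - f t ^ 2 = 0 := hgram t
      field_simp
      linarith
    have h3 := sub_eq_zero.1 (norm_eq_zero.1 (pow_eq_zero_iff two_ne_zero |>.1 h1))
    rw [← h3]; abel
  have hcont : Continuous f := continuous_const.inner (hγ.continuous.sub continuous_const)
  have f0 : f 0 = 0 := by simp [hf]
  have f1 : f 1 = 0 := by
    have := hγ.periodic 0
    rw [zero_add] at this
    simp [hf, this]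
  have f2 : f (1 / 2) = ‖u‖ ^ 2 := real_inner_self_eq_norm_sq u
  have hu2 : 0 < ‖u‖ ^ 2 := by positivity
  obtain ⟨a, ha, hfa⟩ := intermediate_value_Ioo (show (0 : ℝ) ≤ 1 / 2 by norm_num)
    hcont.continuousOn (show ‖u‖ ^ 2 / 2 ∈ Ioo (f 0) (f (1 / 2)) by
      rw [f0, f2]; constructor <;> linarith)
  obtain ⟨b, hb, hfb⟩ := intermediate_value_Ioo' (show (1 / 2 : ℝ) ≤ 1 by norm_num)
    hcont.continuousOn (show ‖u‖ ^ 2 / 2 ∈ Ioo (f 1) (f (1 / 2)) by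
      rw [f1, f2]; constructor <;> linarith)
  have he : γ a = γ b := by rw [hrec a, hrec b, hfa, hfb]
  have := hγ.injOn ⟨ha.1.le, by linarith [ha.2]⟩ ⟨by linarith [hb.1], hb.2⟩ he
  linarith [ha.2, hb.1]

theorem Link.length_ne_zero {n : ℕ} (L : Link n) (i : Fin n) : L.length ≠ 0 := by
  intro h
  have h1 := (Finset.sum_eq_zero_iff.1 h) i (Finset.mem_univ i)
  have h2 := eVariationOn.edist_le (L.curve i) (s := Icc (0 : ℝ) 1) (x := 1 / 2) (y := 0)
    ⟨by norm_num, by norm_num⟩ ⟨le_rfl, zero_le_one⟩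
  rw [h1] at h2
  have := (L.simple i).injOn (x₁ := 1 / 2) (x₂ := 0) ⟨by norm_num, by norm_num⟩ ⟨le_rfl, one_pos⟩
    (edist_le_zero.1 h2)
  norm_num at this

/-- In `ℝ≥0∞` both `0 / 0` and `∞ / ∞` are 0; nonzero length and finite thickness exclude these
cases. -/
theorem Link.of_ropelength_lt_top {n : ℕ} (L : Link n) (i : Fin n) (h : L.ropelength < ⊤) :
    thickness L.carrier ≠ 0 ∧ L.length ≠ ⊤ := by
  have h1 := mt ENNReal.div_eq_top.2 h.ne
  rw [not_or, not_and_or, not_and_or, not_not, not_not] at h1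
  exact ⟨h1.1.resolve_left (L.length_ne_zero i),
    h1.2.resolve_right (L.thickness_ne_top i)⟩

theorem Link.exists_thickSet {n : ℕ} (L : Link n) (i : Fin n) (h : L.ropelength < ⊤) :
    0 < (thickness L.carrier).toReal ∧ ThickSet (thickness L.carrier).toReal L.carrier := by
  have h0 := (L.of_ropelength_lt_top i h).1
  have h1 := L.thickness_ne_top i
  refine ⟨ENNReal.toReal_pos h0 h1, (le_thickness_iff ENNReal.toReal_nonneg).1 ?_⟩
  rw [ENNReal.ofReal_toReal h1]

/-- Regularity needs only positive thickness and finite length, not minimality. -/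
theorem Link.isC11_of_ropelength_lt_top {n : ℕ} (L : Link n) (h : L.ropelength < ⊤) :
    L.IsC11WithBoundedCurvature := by
  intro i
  obtain ⟨hτ, hth⟩ := L.exists_thickSet i h
  have hfin : eVariationOn (L.curve i) (Icc 0 1) ≠ ⊤ :=
    ENNReal.sum_ne_top.1 (L.of_ropelength_lt_top i h).2 i (Finset.mem_univ i)
  obtain ⟨β, hβ, hr⟩ := exists_unitLoop hτ (L.simple i)
    (hth.mono hτ.le le_rfl (subset_iUnion (fun i => range (L.curve i)) i)) hfin
  exact ⟨_, hr ▸ hβ.isC11⟩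

theorem Link.exists_normalized {n : ℕ} (L : Link n) (i₀ : Fin n) (h : L.ropelength < ⊤) :
    ∃ L' : Link n, AmbientIsotopic L.carrier L'.carrier ∧ ThickSet 1 L'.carrier ∧
      L'.length ≤ L.ropelength := by
  obtain ⟨hτ, hth⟩ := L.exists_thickSet i₀ h
  set τ := (thickness L.carrier).toReal with hτdef
  have hinv : 0 < τ⁻¹ := inv_pos.2 hτ
  have hinj : Function.Injective fun x : E3 => τ⁻¹ • x := smul_right_injective E3 hinv.ne'
  have hlip : LipschitzWith τ⁻¹.toNNReal fun x : E3 => τ⁻¹ • x :=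
    LipschitzWith.of_dist_le_mul fun x y => by
      rw [dist_smul₀, Real.norm_of_nonneg hinv.le, Real.coe_toNNReal _ hinv.le]
  refine ⟨L.map (fun x => τ⁻¹ • x) (continuous_const_smul _) hinj, ?_, ?_, ?_⟩
  · rw [Link.carrier_map]
    exact ambientIsotopic_smul hinv _
  · rw [Link.carrier_map]
    rintro _ ⟨x, hx, rfl⟩ _ ⟨y, hy, rfl⟩ _ ⟨z, hz, rfl⟩
    have := (hth x hx y hy z hz).smul τ⁻¹
    rwa [inv_mul_cancel₀ hτ.ne'] at this
  · have h1 : (τ⁻¹.toNNReal : ℝ≥0∞) = (thickness L.carrier)⁻¹ := by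
      change ENNReal.ofReal τ⁻¹ = _
      rw [ENNReal.ofReal_inv_of_pos hτ, hτdef, ENNReal.ofReal_toReal (L.thickness_ne_top i₀)]
    calc _ ≤ ∑ i, (τ⁻¹.toNNReal : ℝ≥0∞) * eVariationOn (L.curve i) (Icc 0 1) :=
          Finset.sum_le_sum fun i _ => L.length_map_le _ _ hinj hlip i
      _ = L.ropelength := by
          rw [← Finset.mul_sum, h1, mul_comm]; rfl

theorem Link.exists_unitLoops {n : ℕ} (L : Link n) (i₀ : Fin n) {Λ : ℝ} (hΛ0 : 0 ≤ Λ)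
    (hΛ : L.ropelength ≤ ENNReal.ofReal Λ) :
    ∃ (β : Fin n → ℝ → E3) (ℓ : Fin n → ℝ), (∀ i, UnitLoop 1 (ℓ i) (β i)) ∧
      AmbientIsotopic L.carrier (⋃ i, range (β i)) ∧ ThickSet 1 (⋃ i, range (β i)) ∧
      (∀ i j, i ≠ j → Disjoint (range (β i)) (range (β j))) ∧
      ∑ i, ℓ i ≤ L.ropelength.toReal ∧
      ∀ i t, ‖β i t‖ ≤ 2 * (1 + 2 * (Λ + 1) * n) := by
  have htop : L.ropelength < ⊤ := hΛ.trans_lt ENNReal.ofReal_lt_top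
  obtain ⟨L₁, iso₁, th₁, len₁⟩ := L.exists_normalized i₀ htop
  have hcomp : ∀ i, eVariationOn (L₁.curve i) (Icc 0 1) ≤ ENNReal.ofReal Λ := fun i =>
    ((Finset.single_le_sum (f := fun i => eVariationOn (L₁.curve i) (Icc 0 1))
      (fun _ _ => zero_le) (Finset.mem_univ i)).trans len₁).trans hΛ
  obtain ⟨L₂, iso₂, th₂, len₂, bd⟩ := exists_bounded L₁ hΛ0 hcomp th₁
  have hfin : ∀ i, eVariationOn (L₂.curve i) (Icc 0 1) ≠ ⊤ := fun i =>
    ne_top_of_le_ne_top ENNReal.ofReal_ne_top ((len₂ i).trans (hcomp i))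
  choose β hβ hr using fun i => exists_unitLoop one_pos (L₂.simple i)
    (th₂.mono zero_le_one le_rfl (subset_iUnion (fun i => range (L₂.curve i)) i)) (hfin i)
  have hcar : ⋃ i, range (β i) = L₂.carrier := iUnion_congr hr
  refine ⟨β, _, hβ, ?_, ?_, fun i j hij => ?_, ?_, fun i t => ?_⟩
  · rw [hcar]; exact iso₁.trans iso₂
  · rwa [hcar]
  · rw [hr, hr]; exact L₂.disjoint i j hij
  · rw [← ENNReal.toReal_sum fun i _ => hfin i]
    exact ENNReal.toReal_mono htop.ne ((Finset.sum_le_sum fun i _ => len₂ i).trans len₁)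
  · obtain ⟨s, hs⟩ : β i t ∈ range (L₂.curve i) := hr i ▸ mem_range_self t
    rw [← hs]
    exact bd i s

/-- The ultrafilter limit of a normalized minimizing sequence has thickness at least 1 and length at
most the infimum, and it is isotopic to some member of the sequence. -/
theorem exists_minimizer {n : ℕ} (i₀ : Fin n) (T : Set (Link n))
    (hT : ∀ L ∈ T, ∀ L', AmbientIsotopic L.carrier L'.carrier → L' ∈ T)
    (hfin : ∃ L ∈ T, L.ropelength < ⊤) : ∃ L, IsRopelengthMinimizer T L := by
  set S : Set ℝ≥0∞ := {r | r < ⊤ ∧ ∃ L ∈ T, L.ropelength = r} with hS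
  have hne : S.Nonempty := by
    obtain ⟨L, hL, h⟩ := hfin
    exact ⟨_, h, L, hL, rfl⟩
  obtain ⟨u, hanti, hlim, huS⟩ := exists_seq_tendsto_sInf hne (OrderBot.bddBelow S)
  choose htop Λseq hmem hrl using huS
  set Λ := (u 0).toReal with hΛ
  have hΛ0 : 0 ≤ Λ := ENNReal.toReal_nonneg
  have hle : ∀ k, (Λseq k).ropelength ≤ ENNReal.ofReal Λ := fun k => by
    rw [hrl, hΛ, ENNReal.ofReal_toReal (htop 0).ne]
    exact hanti (Nat.zero_le k)
  choose β ℓ hloop hiso hth hdisj hsum hbd using fun k => (Λseq k).exists_unitLoops i₀ hΛ0 (hle k)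
  have hℓ0 : ∀ k i, 0 ≤ ℓ k i := fun k i => (hloop k i).len_pos.le
  have hℓΛ : ∀ k i, ℓ k i ≤ Λ := fun k i => by
    refine (Finset.single_le_sum (fun i _ => hℓ0 k i) (Finset.mem_univ i)).trans
      ((hsum k).trans ?_)
    exact ENNReal.toReal_le_of_le_ofReal hΛ0 (hle k)
  choose D hD hD1 hDL using fun k i => (hloop k i).exists_tangent
  have hrange : ∀ k i, range (fun t => β k i (ℓ k i * t)) = range (β k i) := fun k i =>
    (hloop k i).range_rescale
  have hunion : ∀ k, ⋃ i, range (fun t => β k i (ℓ k i * t)) = ⋃ i, range (β k i) := fun k =>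
    iUnion_congr (hrange k)
  -- At thickness 1 the tangent is 8-Lipschitz in arclength, so the velocity `ℓ D(ℓ t)` is
  -- `8ℓ²`-Lipschitz; `c = 1/8` comes from the chord-arc bound.
  obtain ⟨L, hLth, ⟨m, hm, hlen⟩, hev⟩ := exists_limit_link (hyperfilter ℕ)
    (γ := fun k i t => β k i (ℓ k i * t)) (V := fun k i t => ℓ k i • D k i (ℓ k i * t))
    (ℓ := ℓ) (Λ := Λ) (M := 8 * Λ ^ 2) (c := 1 / 8) (by norm_num)
    (fun k i => (hloop k i).isSimpleClosed_rescale.periodic)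
    (fun k i t => UnitLoop.hasDerivAt_rescale (hD k i) t)
    (fun k i t => by rw [norm_smul, hD1, mul_one, Real.norm_of_nonneg (hℓ0 k i)])
    hℓΛ
    (fun k i s t => by
      rw [← smul_sub, norm_smul, Real.norm_of_nonneg (hℓ0 k i)]
      have h1 := mul_le_mul_of_nonneg_left (hDL k i (ℓ k i * s) (ℓ k i * t)) (hℓ0 k i)
      rw [← mul_sub, abs_mul, abs_of_nonneg (hℓ0 k i)] at h1
      have h2 : ℓ k i ^ 2 ≤ Λ ^ 2 := pow_le_pow_left₀ (hℓ0 k i) (hℓΛ k i) 2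
      have h3 := mul_le_mul_of_nonneg_right h2 (abs_nonneg (s - t))
      linarith)
    (fun k i => hbd k i _)
    (fun k i s t h => (hloop k i).chord_arc h)
    (fun k i j hij s t => by
      have := (hloop k j).two_mul_le_norm_sub (x := β k i (ℓ k i * s))
        (Set.disjoint_left.1 (hdisj k i j hij) (mem_range_self _))
        (fun t t' => hth k _ (mem_iUnion.2 ⟨j, t, rfl⟩) _ (mem_iUnion.2 ⟨i, _, rfl⟩) _
          (mem_iUnion.2 ⟨j, t', rfl⟩)) (ℓ k j * t)
      linarith)
    (fun k => by rw [hunion]; exact hth k)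
  obtain ⟨k, hk⟩ := hev.exists
  rw [hunion] at hk
  refine ⟨L, hT _ (hmem k) L ((hiso k).trans hk), fun L' hL' => ?_⟩
  have hinf : sInf S ≤ L'.ropelength := by
    by_cases h : L'.ropelength < ⊤
    · exact sInf_le ⟨h, L', hL', rfl⟩
    · rw [not_lt_top_iff.1 h]; exact le_top
  have hinftop : sInf S ≠ ⊤ := ne_top_of_le_ne_top (htop 0).ne (sInf_le ⟨htop 0, _, hmem 0, hrl 0⟩)
  refine le_trans ?_ hinf
  have hsum' : ∑ i, m i ≤ (sInf S).toReal := by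
    refine le_of_tendsto_of_tendsto' (tendsto_finsetSum Finset.univ fun i _ => hm i)
      (((ENNReal.tendsto_toReal hinftop).comp hlim).mono_left Nat.hyperfilter_le_atTop) fun k => ?_
    rw [Function.comp_apply, ← hrl]
    exact hsum k
  have hthick : 1 ≤ thickness L.carrier := by
    simpa using (le_thickness_iff zero_le_one).2 hLth
  calc L.ropelength ≤ L.length / 1 := ENNReal.div_le_div_left hthick _
    _ = L.length := div_one _
    _ ≤ ENNReal.ofReal (sInf S).toReal := hlen.trans (ENNReal.ofReal_le_ofReal hsum')
    _ = sInf S := ENNReal.ofReal_toReal hinftop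

theorem Link.ropelength_eq_zero (L : Link 0) : L.ropelength = 0 := by
  simp [Link.ropelength, Link.length]

end Ropelength

theorem mainTheorem2 (n : ℕ) (L₀ : Ropelength.Link n) (hL₀ : L₀.IsTame) :
    (∃ L : Ropelength.Link n,
      Ropelength.IsRopelengthMinimizer (Ropelength.linkType L₀) L) ∧
    (∀ L : Ropelength.Link n,
      Ropelength.IsRopelengthMinimizer (Ropelength.linkType L₀) L →
        L.IsC11WithBoundedCurvature) := by
  obtain ⟨P, hP, hpoly⟩ := hL₀
  obtain ⟨L₁, h₁, hfin⟩ := hpoly.exists_ropelength_lt_top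
  have hL₁ : L₁ ∈ Ropelength.linkType L₀ := Ropelength.AmbientIsotopic.trans hP h₁
  refine ⟨?_, fun L hL => L.isC11_of_ropelength_lt_top ((hL.2 L₁ hL₁).trans_lt hfin)⟩
  -- The empty link has ropelength 0 and offers no component to normalize by.
  rcases n with _ | n
  · exact ⟨L₁, hL₁, fun L' _ => by rw [L₁.ropelength_eq_zero]; exact zero_le⟩
  · exact Ropelength.exists_minimizer 0 _
      (fun L hL L' h => Ropelength.AmbientIsotopic.trans hL h) ⟨L₁, hL₁, hfin⟩
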